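/- Let $X$ be a closed (compact, connected) Riemann surface with a Kähler metric, let $E\to X$ be a smooth Hermitian vector bundle of finite rank, let $A$ be a unitary connection on $E$ and $\Phi\in\Omega^{1,0}(\mathrm{End}\,E)$ with $\bar\partial_A\Phi=0$ and $F_A+[\Phi,\Phi^*]=0$. Let $D''=\bar\partial_A+\Phi$ be the differential of the deformation complex $$\Omega^0(\mathrm{End}\,E)\to\Omega^{0,1}(\mathrm{End}\,E)\oplus\Omega^{1,0}(\mathrm{End}\,E)\to\Omega^{1,1}(\mathrm{End}\,E),$$ let $(D'')^*$ be its $L^2$ adjoint, $\mathbf H^1=\ker D''\cap\ker (D'')^*$ and $\mathbf H^2=\ker (D'')^*\subset\Omega^{1,1}(\mathrm{End}\,E)$ the harmonic spaces, $H$ the $L^2$-orthogonal projection onto $\mathbf H^2$, and $G$ the Green operator of $D''(D'')^*$ on $\Omega^{1,1}(\mathrm{End}\,E)$. Fix an integer $k>1$; a subscript $k$ denotes completion in the Sobolev norm $L^2_k$. For $(\alpha'',\eta)\in\Omega^{0,1}(\mathrm{End}\,E)_k\oplus\Omega^{1,0}(\mathrm{End}\,E)_k$ let $$\mu_{\mathbb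 C}(A+\alpha,\Phi+\eta)=\bar\partial_{A+\alpha}(\Phi+\eta)=\bar\partial_A(\Phi+\eta)+[\alpha'',\Phi+\eta],\qquad F(\alpha'',\eta)=(\alpha'',\eta)+(D'')^*G[\alpha'',\eta],$$ and let the Lyapunov–Schmidt slice $S_k$ be the set of all $(\alpha'',\eta)$ with $(1-H)\mu_{\mathbb C}(A+\alpha,\Phi+\eta)=0$ and $(D'')^*(\alpha'',\eta)=0$. With $[\cdot,\cdot]$ the graded bracket of $\mathrm{End}\,E$-valued $1$-forms (so that $\tfrac12[(\alpha'',\eta),(\alpha'',\eta)]=[\alpha'',\eta]$): 1. For every $a=(\alpha'',\eta)\in S_k$, $\ \mu_{\mathbb C}(A+\alpha,\Phi+\eta)=\tfrac12 H[F(a),F(a)]$. 2. Let $U\subset\mathbf H^1$ be an open ball around $0$ in the $L^2$ norm and $\tilde U$ an open neighbourhood of $0$ in $S_k$ (that is, of $(A,\Phi)$ in the slice) such that $F\colon\tilde U\to U$ is a biholomorphism, and let $\theta\colon U\to\tilde U$ be its inverse (the Kuranishi map). Then the Kuranishi space $Z=\{x\in U:\mu_{\mathbb C}((A,\Phi)+\theta(x))=0\}$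 is an open neighbourhood of $0$ in the quadratic cone $Q=\{x\in\mathbf H^1:\tfrac12H[x,x]=0\}$. -/

import Mathlib

open Bundle MeasureTheory Filter VectorField
open scoped Manifold ContDiff Topology ENNReal InnerProductSpace

noncomputable section

namespace HiggsKuranishi

section Tangent

variable {X : Type*} [TopologicalSpace X] [ChartedSpace ℂ X]

/-- The real tangent space of a Riemann surface. -/
abbrev Tan (x : X) : Type := TangentSpace 𝓘(ℝ, ℂ) x

/-- The real tangent vector with coordinate `z` in the preferred chart at `x`. -/
def tanOf (x : X) (z : ℂ) : Tan x := z

/-- The complex structure `J` of the tangent spaces: multiplication by `i` in the preferred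
holomorphic chart (hence in every holomorphic chart). -/
def J (x : X) (v : Tan x) : Tan x :=
  let z : ℂ := v
  tanOf x (Complex.I * z)

variable (X) in
/-- A Kähler metric on a Riemann surface: a smooth Riemannian metric for which `J` is isometric. -/
structure KahlerMetric [IsManifold 𝓘(ℝ, ℂ) ∞ X] where
  metric : ContMDiffRiemannianMetric 𝓘(ℝ, ℂ) ∞ ℂ (fun x : X ↦ TangentSpace 𝓘(ℝ, ℂ) x)
  inner_J : ∀ (x : X) (v w : Tan x), metric.inner x (J x v) (J x w) = metric.inner x v w

variable [IsManifold 𝓘(ℝ, ℂ) ∞ X]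

/-- The squared length of the tangent vector `1` in the preferred chart at `x`.  As the metric is
conformal, `(1, i)` is an orthogonal frame of `T_x X` whose two vectors have this squared length,
and the area form takes this value on it. -/
def KahlerMetric.lam (g : KahlerMetric X) (x : X) : ℝ :=
  g.metric.inner x (tanOf x 1) (tanOf x 1)

/-- The Riemannian area measure restricted to the domain of the chart at `x₀`: in the coordinate
`z = s + it` it is `g(∂_s, ∂_s) ds dt`. -/
def KahlerMetric.chartArea [MeasurableSpace X] (g : KahlerMetric X) (x₀ : X) : Measure X :=
  let φ := chartAt ℂ x₀
  let ds (z : ℂ) : Tan (φ.symm z) := mfderiv 𝓘(ℝ, ℂ) 𝓘(ℝ, ℂ) φ.symm z (1 : ℂ)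
  ((((volume : Measure ℂ).restrict φ.target).withDensity fun z ↦
    ENNReal.ofReal (g.metric.inner (φ.symm z) (ds z) (ds z))).map φ.symm)

/-- The Riemannian area measure: the supremum of its restrictions to the chart domains. -/
def KahlerMetric.area [MeasurableSpace X] (g : KahlerMetric X) : Measure X :=
  ⨆ x₀ : X, g.chartArea x₀

/-- A vector field that is smooth on all of `X`. -/
def IsSmoothField (V : ∀ x : X, Tan x) : Prop :=
  ContMDiff 𝓘(ℝ, ℂ) (𝓘(ℝ, ℂ).prod 𝓘(ℝ, ℂ)) ∞
    (fun x ↦ TotalSpace.mk' ℂ (E := fun x : X ↦ TangentSpace 𝓘(ℝ, ℂ) x) x (V x))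

/-- A vector field is `C^n` at a point. -/
def FieldCnAt (n : ℕ∞ω) (V : ∀ x : X, Tan x) (x : X) : Prop :=
  ContMDiffAt 𝓘(ℝ, ℂ) (𝓘(ℝ, ℂ).prod 𝓘(ℝ, ℂ)) n
    (fun x ↦ TotalSpace.mk' ℂ (E := fun x : X ↦ TangentSpace 𝓘(ℝ, ℂ) x) x (V x)) x

end Tangent

section Forms

variable {X : Type*} [TopologicalSpace X] [ChartedSpace ℂ X]
  (E : X → Type*) [∀ x, NormedAddCommGroup (E x)] [∀ x, InnerProductSpace ℂ (E x)]

/-- Arbitrary sections of `End E`. -/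
abbrev Form0 : Type _ := ∀ x : X, Module.End ℂ (E x)

/-- Arbitrary families of maps `T_x X → End E_x`; the `End E`-valued complex 1-forms among them are
those satisfying `IsForm1`.  An `End E`-valued 1-form `a` is the same thing as the pair
`(α'', η) ∈ Ω^{0,1} ⊕ Ω^{1,0}` of its components. -/
abbrev Form1 : Type _ := ∀ x : X, Tan x → Module.End ℂ (E x)

/-- Arbitrary families of maps `T_x X × T_x X → End E_x`; see `IsForm2`. -/
abbrev Form2 : Type _ := ∀ x : X, Tan x → Tan x → Module.End ℂ (E x)

variable {E}

/-- The `(1,0)`-component. -/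
def part10 (a : Form1 E) : Form1 E := fun x v ↦
  (1 / 2 : ℂ) • (a x v - Complex.I • a x (J x v))

/-- The `(0,1)`-component. -/
def part01 (a : Form1 E) : Form1 E := fun x v ↦
  (1 / 2 : ℂ) • (a x v + Complex.I • a x (J x v))

/-- The graded bracket of `End E`-valued 1-forms. -/
def bracket (a b : Form1 E) : Form2 E := fun x v w ↦ ⁅a x v, b x w⁆ - ⁅a x w, b x v⁆

section Regularity

variable (F : Type*) [NormedAddCommGroup F] [NormedSpace ℂ F] [TopologicalSpace (TotalSpace F E)]
  [FiberBundle F E]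

/-- A section of `E` is `C^n` at a point. -/
def SecCnAt (n : ℕ∞ω) (s : ∀ x, E x) (x : X) : Prop :=
  ContMDiffAt 𝓘(ℝ, ℂ) (𝓘(ℝ, ℂ).prod 𝓘(ℝ, F)) n (fun x ↦ TotalSpace.mk' F x (s x)) x

/-- A section of `E` is (real) differentiable at a point. -/
def SecDiffAt (s : ∀ x, E x) (x : X) : Prop :=
  MDifferentiableAt 𝓘(ℝ, ℂ) (𝓘(ℝ, ℂ).prod 𝓘(ℝ, F)) (fun x ↦ TotalSpace.mk' F x (s x)) x

variable (E) in
/-- The inner products of the fibres form a smooth Hermitian metric. -/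
def IsSmoothHermitian : Prop :=
  ∀ (s t : ∀ x, E x) (x : X), SecCnAt F ∞ s x → SecCnAt F ∞ t x →
    ContMDiffAt 𝓘(ℝ, ℂ) 𝓘(ℝ, ℂ) ∞ (fun y ↦ ⟪s y, t y⟫_ℂ) x

/-- `u` is a section of `End E` of class `C^n` (`n = 0`: continuous). -/
def IsForm0 (n : ℕ∞ω) (u : Form0 E) : Prop :=
  ∀ (s : ∀ x, E x) (x : X), SecCnAt F n s x → SecCnAt F n (fun y ↦ u y (s y)) x

/-- `a` is an `End E`-valued 1-form of class `C^n`. -/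
def IsForm1 [IsManifold 𝓘(ℝ, ℂ) ∞ X] (n : ℕ∞ω) (a : Form1 E) : Prop :=
  (∀ x, IsLinearMap ℝ (a x)) ∧
  ∀ (V : ∀ x : X, Tan x) (s : ∀ x, E x) (x : X), FieldCnAt n V x → SecCnAt F n s x →
    SecCnAt F n (fun y ↦ a y (V y) (s y)) x

/-- `σ` is an `End E`-valued 2-form of class `C^n`. -/
def IsForm2 [IsManifold 𝓘(ℝ, ℂ) ∞ X] (n : ℕ∞ω) (σ : Form2 E) : Prop :=
  (∀ x v, IsLinearMap ℝ (σ x v)) ∧ (∀ x v w, σ x v w = -σ x w v) ∧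
  ∀ (V W : ∀ x : X, Tan x) (s : ∀ x, E x) (x : X), FieldCnAt n V x → FieldCnAt n W x →
    SecCnAt F n s x → SecCnAt F n (fun y ↦ σ y (V y) (W y) (s y)) x

end Regularity

section Pairings

variable [∀ x, FiniteDimensional ℂ (E x)] [IsManifold 𝓘(ℝ, ℂ) ∞ X]
  [MeasurableSpace X] (g : KahlerMetric X)

/-- The Hermitian inner product `tr (u v^*)` on `End E_x`. -/
def hs {x : X} (u v : Module.End ℂ (E x)) : ℂ :=
  LinearMap.trace ℂ (E x) (u * LinearMap.adjoint v)

/-- The `L²` inner product of sections of `End E`. -/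
def pair0 (u v : Form0 E) : ℂ := ∫ x, hs (u x) (v x) ∂g.area

/-- The `L²` inner product of `End E`-valued 1-forms. -/
def pair1 (a b : Form1 E) : ℂ :=
  ∫ x, ((g.lam x : ℂ)⁻¹ * (hs (a x (tanOf x 1)) (b x (tanOf x 1)) +
    hs (a x (tanOf x Complex.I)) (b x (tanOf x Complex.I)))) ∂g.area

/-- The `L²` inner product of `End E`-valued 2-forms. -/
def pair2 (σ τ : Form2 E) : ℂ :=
  ∫ x, ((g.lam x : ℂ)⁻¹ ^ 2 * hs (σ x (tanOf x 1) (tanOf x Complex.I))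
    (τ x (tanOf x 1) (tanOf x Complex.I))) ∂g.area

/-- The `L²` norm of a (continuous) 1-form. -/
def norm1 (a : Form1 E) : ℝ := Real.sqrt (pair1 g a a).re

/-- The squared `L²` norm of an arbitrary section of `End E`, as an extended number. -/
def sqL2 (u : Form0 E) : ℝ≥0∞ := ∫⁻ x, ENNReal.ofReal (hs (u x) (u x)).re ∂g.area

end Pairings

end Forms

section Connection

variable {X : Type*} [TopologicalSpace X] [ChartedSpace ℂ X] [IsManifold 𝓘(ℝ, ℂ) ∞ X]
  (F : Type*) [NormedAddCommGroup F] [NormedSpace ℂ F]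
  (E : X → Type*) [TopologicalSpace (TotalSpace F E)]
  [∀ x, NormedAddCommGroup (E x)] [∀ x, InnerProductSpace ℂ (E x)]
  [FiberBundle F E] [VectorBundle ℝ F E]

/-- A smooth unitary connection on the Hermitian bundle `E`. -/
structure UnitaryConnection where
  cov : CovariantDerivative 𝓘(ℝ, ℂ) F E
  smooth : ∀ U : Set X, IsOpen U → ContMDiffCovariantDerivativeOn F ∞ cov.toFun U
  complex_linear : ∀ (s : ∀ x, E x) (x : X), SecDiffAt F s x → ∀ v : Tan x,
    cov (fun y ↦ Complex.I • s y) x v = Complex.I • cov s x v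
  unitary : ∀ (s t : ∀ x, E x) (x : X), SecDiffAt F s x → SecDiffAt F t x → ∀ v : Tan x,
    mvfderiv 𝓘(ℝ, ℂ) (fun y ↦ ⟪s y, t y⟫_ℂ) x v = ⟪cov s x v, t x⟫_ℂ + ⟪s x, cov t x v⟫_ℂ

variable {F E}
variable (A : UnitaryConnection F E)

/-- The local extension of a tangent vector to a vector field with constant coordinates. -/
def extendTan {x : X} (v : Tan x) : ∀ y : X, Tan y :=
  FiberBundle.extend ℂ (E := fun y : X ↦ TangentSpace 𝓘(ℝ, ℂ) y) v

/-- `(∇_v u) e = ∇_v (u ẽ) - u (∇_v ẽ)`, where the local section `ẽ` extends `e`. -/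
def covEndFun (u : Form0 E) (x : X) (v : Tan x) (e : E x) : E x :=
  A.cov (fun y ↦ u y (FiberBundle.extend F e y)) x v - u x (A.cov (FiberBundle.extend F e) x v)

open Classical in
/-- The induced connection on `End E` (linear in `e` as soon as `u` is differentiable). -/
def covEnd (u : Form0 E) (x : X) (v : Tan x) : Module.End ℂ (E x) :=
  if h : IsLinearMap ℂ (covEndFun A u x v) then h.mk' _ else 0

/-- The exterior covariant derivative `d_A` of an `End E`-valued 1-form:
`(d_A a)(V, W) = ∇_V (a W) - ∇_W (a V) - a [V, W]`. -/
def extCov (a : Form1 E) : Form2 E := fun x v w ↦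
  covEnd A (fun y ↦ a y (extendTan w y)) x v - covEnd A (fun y ↦ a y (extendTan v y)) x w
    - a x (mlieBracket 𝓘(ℝ, ℂ) (extendTan v) (extendTan w) x)

/-- The curvature `F_A`, applied to an element of the fibre. -/
def curvature (x : X) (v w : Tan x) (e : E x) : E x :=
  A.cov (fun y ↦ A.cov (FiberBundle.extend F e) y (extendTan w y)) x v
    - A.cov (fun y ↦ A.cov (FiberBundle.extend F e) y (extendTan v y)) x w
    - A.cov (FiberBundle.extend F e) x (mlieBracket 𝓘(ℝ, ℂ) (extendTan v) (extendTan w) x)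

/-- `∂̄_A : Ω^0 → Ω^{0,1}`. -/
def dbar0 (u : Form0 E) : Form1 E := part01 (covEnd A u)

/-- `∂̄_A : Ω^{0,1} ⊕ Ω^{1,0} → Ω^{1,1}`; it only sees the `(1,0)`-component. -/
def dbar1 (a : Form1 E) : Form2 E := extCov A (part10 a)

variable [∀ x, FiniteDimensional ℂ (E x)]

variable (F E) in
/-- A Higgs bundle `(A, Φ)` (with `∂̄_A Φ = 0`) that solves Hitchin's equation
`F_A + [Φ, Φ^*] = 0`. -/
structure HitchinPair where
  A : UnitaryConnection F E
  Φ : Form1 E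
  smooth : IsForm1 F ∞ Φ
  type10 : part10 Φ = Φ
  holomorphic : dbar1 A Φ = 0
  hitchin : ∀ (x : X) (v w : Tan x) (e : E x),
    curvature A x v w e + bracket Φ (fun y t ↦ LinearMap.adjoint (Φ y t)) x v w e = 0

variable (P : HitchinPair F E)

/-- `D'' = ∂̄_A + Φ` on `Ω^0`. -/
def D0 (u : Form0 E) : Form1 E := fun x v ↦ dbar0 P.A u x v + ⁅P.Φ x v, u x⁆

/-- `D'' = ∂̄_A + Φ` on `Ω^{0,1} ⊕ Ω^{1,0}`. -/
def D1 (a : Form1 E) : Form2 E := dbar1 P.A a + bracket P.Φ a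

section Hodge

variable [MeasurableSpace X] (g : KahlerMetric X)

variable (F) in
open Classical in
/-- The `L²` adjoint of a first order operator `T : Ω^1 → Ω^2`: `adj T σ` is the continuous 1-form
`b` such that `⟨b, a⟩ = ⟨σ, T a⟩` for all smooth `a`. -/
def adj (T : Form1 E → Form2 E) (σ : Form2 E) : Form1 E :=
  if h : ∃ b : Form1 E, IsForm1 F 0 b ∧
      ∀ a, IsForm1 F ∞ a → pair1 g b a = pair2 g σ (T a)
  then h.choose else 0

/-- `(D'')^* a = 0` on 1-forms, where `(D'')^*` is the `L²` adjoint of `D''` on `Ω^0`. -/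
def Coclosed1 (a : Form1 E) : Prop := ∀ u, IsForm0 F ∞ u → pair1 g a (D0 P u) = 0

/-- The harmonic space `H^1 = ker D'' ∩ ker (D'')^*`. -/
def H1 : Set (Form1 E) := {a | IsForm1 F ∞ a ∧ D1 P a = 0 ∧ Coclosed1 P g a}

/-- The harmonic space `H^2 = ker (D'')^*` in `Ω^{1,1}`. -/
def H2 : Set (Form2 E) :=
  {h | IsForm2 F ∞ h ∧ ∀ a, IsForm1 F ∞ a → pair2 g h (D1 P a) = 0}

open Classical in
/-- The harmonic projection `H` of a distributional 2-form, which is a functional on smooth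
2-forms; a 2-form `σ` is viewed as the functional `τ ↦ ⟨σ, τ⟩`. -/
def harmDist (T : Form2 E → ℂ) : Form2 E :=
  if h : ∃ s : Form2 E, s ∈ H2 P g ∧ ∀ s' ∈ H2 P g, pair2 g s s' = T s'
  then h.choose else 0

/-- The harmonic projection `H`: the `L²`-orthogonal projection of `Ω^{1,1}` onto `H^2`. -/
def harm (σ : Form2 E) : Form2 E := harmDist P g (pair2 g σ)

/-- Iterated covariant derivative `∇_{V_1} ⋯ ∇_{V_j}` on sections of `End E`. -/
def iterCov (w : List (∀ x : X, Tan x)) (u : Form0 E) : Form0 E :=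
  w.foldr (fun V f x ↦ covEnd A f x (V x)) u

/-- A differential monomial `∇_{V_1} ⋯ ∇_{V_j}` of order at most `k`, with smooth `V_i`. -/
def IsWord (k : ℕ) (w : List (∀ x : X, Tan x)) : Prop :=
  w.length ≤ k ∧ ∀ V ∈ w, IsSmoothField V

/-- The sequence of smooth sections is Cauchy in the Sobolev topology `L²_k`. -/
def SobCauchy (k : ℕ) (f : ℕ → Form0 E) : Prop :=
  ∀ w, IsWord k w →
    Tendsto (fun p : ℕ × ℕ ↦ sqL2 g (iterCov A w (f p.1 - f p.2))) atTop (𝓝 0)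

/-- `s` is an `L²_k`-Cauchy sequence of smooth 1-forms that converges to `a` in `L²`. -/
def Approx1 (k : ℕ) (s : ℕ → Form1 E) (a : Form1 E) : Prop :=
  (∀ n, IsForm1 F ∞ (s n)) ∧ ∀ V : (∀ x : X, Tan x), IsSmoothField V →
    SobCauchy A g k (fun n x ↦ s n x (V x)) ∧
    Tendsto (fun n ↦ sqL2 g (fun x ↦ s n x (V x) - a x (V x))) atTop (𝓝 0)

/-- The Sobolev completion `L²_k` of the space of smooth 1-forms, for `k ≥ 2`.  As these Sobolev
spaces embed in `C^0`, their elements are continuous 1-forms: those which are the limits of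
`L²_k`-Cauchy sequences of smooth forms. -/
def Sob1 (k : ℕ) : Set (Form1 E) := {a | IsForm1 F 0 a ∧ ∃ s, Approx1 A g k s a}

/-- The Sobolev completion `L²_k` of the space of smooth 2-forms, for `k ≥ 2`. -/
def Sob2 (k : ℕ) : Set (Form2 E) :=
  {σ | IsForm2 F 0 σ ∧ ∃ s : ℕ → Form2 E, (∀ n, IsForm2 F ∞ (s n)) ∧
    ∀ V W : (∀ x : X, Tan x), IsSmoothField V → IsSmoothField W →
      SobCauchy A g k (fun n x ↦ s n x (V x) (W x)) ∧
      Tendsto (fun n ↦ sqL2 g (fun x ↦ s n x (V x) (W x) - σ x (V x) (W x))) atTop (𝓝 0)}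

/-- The continuous extension to `L²_k` of the (squared) seminorm `‖∇_w (a(V))‖²` in `L²`. These
seminorms, for all words `w` of length at most `k` and all smooth `V`, define the topology of
`L²_k`. -/
def sobSemi (k : ℕ) (V : ∀ x : X, Tan x) (w : List (∀ x : X, Tan x)) (a : Form1 E) : ℝ≥0∞ :=
  ⨅ (s : ℕ → Form1 E) (_ : Approx1 A g k s a),
    limsup (fun n ↦ sqL2 g (iterCov A w (fun x ↦ s n x (V x)))) atTop

/-- `N ⊆ S` is open in `S`, where `S` has the topology induced by `L²_k`. -/
def IsSobOpenIn (k : ℕ) (S N : Set (Form1 E)) : Prop :=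
  N ⊆ S ∧ ∀ a ∈ N, ∃ (L : List ((∀ x : X, Tan x) × List (∀ x : X, Tan x))) (ε : ℝ≥0∞),
    0 < ε ∧ (∀ p ∈ L, IsSmoothField p.1 ∧ IsWord k p.2) ∧
    ∀ b ∈ S, (∀ p ∈ L, sobSemi A g k p.1 p.2 (b - a) < ε) → b ∈ N

open Classical in
/-- The Green operator `G` of `Δ = D'' (D'')^*` on `Ω^{1,1}`: `G σ` is the 2-form in `L²_{k+1}`
orthogonal to `H^2` with `Δ (G σ) = σ - H σ`. -/
def green (k : ℕ) (σ : Form2 E) : Form2 E :=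
  if h : ∃ ξ : Form2 E, ξ ∈ Sob2 P.A g (k + 1) ∧ (∀ s ∈ H2 P g, pair2 g ξ s = 0) ∧
      ∀ τ, IsForm2 F ∞ τ →
        pair2 g ξ (D1 P (adj F g (D1 P) τ)) = pair2 g (σ - harm P g σ) τ
  then h.choose else 0

/-- The map `F(α'', η) = (α'', η) + (D'')^* G [α'', η]`. -/
def kurF (k : ℕ) (a : Form1 E) : Form1 E :=
  a + adj F g (D1 P) (green P g k (bracket (part01 a) (part10 a)))

/-- The complex moment map `μ_ℂ(A + α, Φ + η) = ∂̄_{A+α} (Φ + η) = ∂̄_A (Φ + η) + [α'', Φ + η]` at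
the point `(A, Φ) + a`, `a = α'' + η`.  It lies in `L²_{k-1}` when `a` lies in `L²_k`, and is
given here as a distribution, that is, as a functional on smooth 2-forms. -/
def muC (a : Form1 E) (τ : Form2 E) : ℂ :=
  pair1 g (P.Φ + part10 a) (adj F g (dbar1 P.A) τ)
    + pair2 g (bracket (part01 a) (P.Φ + part10 a)) τ

variable (F) in
/-- The distribution `T` is the 2-form `σ`. -/
def EqDist (T : Form2 E → ℂ) (σ : Form2 E) : Prop :=
  ∀ τ, IsForm2 F ∞ τ → T τ = pair2 g σ τ

/-- The Lyapunov–Schmidt slice `B̃_k ∩ ((A, Φ) + ker (D'')^*)`, with `(A, Φ)` as the origin: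
`a ∈ L²_k`, `(1 - H) μ_ℂ = 0` and `(D'')^* a = 0`. -/
def slice (k : ℕ) : Set (Form1 E) :=
  {a | a ∈ Sob1 P.A g k ∧ EqDist F g (muC P g a) (harmDist P g (muC P g a)) ∧ Coclosed1 P g a}

/-- The open ball of radius `ρ` around `0` in `H^1`, in the `L²` norm. -/
def ball1 (ρ : ℝ) : Set (Form1 E) := {x | x ∈ H1 P g ∧ norm1 g x < ρ}

/-- `θ` is a Kuranishi map: for an open neighbourhood `N` of `(A, Φ)` in the slice, `F` is a
biholomorphism from `N` to the ball `U` of radius `ρ`, with inverse `θ`.  Here `F` is the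
restriction of a continuous polynomial map, so only `θ` has to be required to be holomorphic, as
a map on the finite-dimensional space `H^1` with values in `L²_k`. -/
structure IsKuranishiMap (k : ℕ) (ρ : ℝ) (N : Set (Form1 E)) (θ : Form1 E → Form1 E) : Prop where
  pos : 0 < ρ
  zero_mem : (0 : Form1 E) ∈ N
  isOpen : IsSobOpenIn P.A g k (slice P g k) N
  mapsTo : Set.MapsTo (kurF P g k) N (ball1 P g ρ)
  mapsTo_inv : Set.MapsTo θ (ball1 P g ρ) N
  invOn : Set.InvOn θ (kurF P g k) N (ball1 P g ρ)
  holomorphic : ∀ x ∈ ball1 P g ρ, ∀ v ∈ H1 P g, ∃ b ∈ Sob1 P.A g k,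
    ∀ V w, IsSmoothField V → IsWord k w →
      Tendsto (fun z : ℂ ↦ sobSemi P.A g k V w (z⁻¹ • (θ (x + z • v) - θ x) - b)) (𝓝[≠] 0) (𝓝 0)

/-- The Kuranishi space `Z = θ⁻¹(B ∩ N)`, where `B` is the zero set of `μ_ℂ`. -/
def kuranishiSpace (ρ : ℝ) (N : Set (Form1 E)) (θ : Form1 E → Form1 E) : Set (Form1 E) :=
  {x | x ∈ ball1 P g ρ ∧ θ x ∈ N ∧ EqDist F g (muC P g (θ x)) 0}

/-- The quadratic cone `Q = {x ∈ H^1 : ½ H[x, x] = 0}`. -/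
def quadraticCone : Set (Form1 E) :=
  {x | x ∈ H1 P g ∧ (1 / 2 : ℂ) • harm P g (bracket x x) = 0}

/-- `Z` is an open neighbourhood of `0` in `Q ⊆ H^1`, for the topology given by the `L²` norm. -/
def IsOpenNhdZeroIn (Q Z : Set (Form1 E)) : Prop :=
  Z ⊆ Q ∧ 0 ∈ Z ∧ ∀ z ∈ Z, ∃ ε : ℝ, 0 < ε ∧ ∀ q ∈ Q, norm1 g (q - z) < ε → q ∈ Z

end Hodge

end Connection

end HiggsKuranishi

end

noncomputable section

namespace HiggsKuranishi

set_option linter.unusedSectionVars false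
set_option linter.unusedVariables false

/-! ### The trace inner product on the fibres of `End E`. -/

section FibreAlgebra

variable {X : Type*} {E : X → Type*} [∀ x, NormedAddCommGroup (E x)]
  [∀ x, InnerProductSpace ℂ (E x)] [∀ x, FiniteDimensional ℂ (E x)] {x : X}

/-! On the slice, `μ_ℂ` equals its own harmonic part, so only the pairings `⟨μ_ℂ, h⟩` with harmonic
`h ∈ H²` matter. Write `t = Λh` for the contraction of `h` with the area form.

Vanishing of `(D'')^* h` splits by type into `∂̄_A^* h = 0` and `[Φ^*, t] = 0` (`harmonic_parts`).
These two equations kill every term of `⟨μ_ℂ, h⟩` except the quadratic one, so `⟨μ_ℂ, h⟩ = ½⟨[a, a],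
h⟩` (`muC_harmonic`). It remains to replace `a` by `F(a) = a + b`, where `b = (D'')^* G[α'', η]`.

The geometric input is a Weitzenböck argument (`harmonic_parallel`). Integrating `⟨h, d_A ∇t⟩` by
parts and inserting `F_A = -[Φ, Φ^*]` gives `‖[Φ, t]‖² + ‖∇t‖² = 0`, so `t` is parallel and commutes
with `Φ`. Bracketing with `t` is then compatible with the complex: up to sign, the adjoint of
`(D'')^* ξ`, rotated by `J` and bracketed with `t`, is `D''[t, (Λξ)^*]` (`contract_dstar_adjoint`).
Hence `⟨[c, (D'')^* ξ], h⟩ = -⟨c, D''[t, (Λξ)^*]⟩ = 0` for every coclosed `c` and smooth `ξ`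
(`pair2_bracket_dstar`). Both `a` and `b` are coclosed, the latter because `D'' D'' = 0`, so all the
terms of `[a + b, a + b]` that involve `b` are orthogonal to `H²` (`pair2_bracket_kurF`).

The form `G[α'', η]` is only of Sobolev class, so the orthogonality is passed to the limit along
smooth approximations (`pair1_weak_dstar`). This needs an `L²` bound for `(D'')^*` by first
derivatives and the density of smooth forms in continuous ones. No elliptic theory enters: of the
Green operator only the membership of its values in `L²_{k+1}` matters, and wherever `H`, `G` or an
adjoint takes its default value `0` the identities remain valid.

For the second assertion put `a = θ(x)`. Since `F(θ(x)) = x`, the first assertion reads `μ_ℂ(θ(x)) =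
½H[x, x]`, so `Z` is the intersection of `Q` with the ball `U`. -/

theorem hs_add_left (u v w : Module.End ℂ (E x)) : hs (u + v) w = hs u w + hs v w := by
  simp [hs, add_mul]

theorem hs_sub_left (u v w : Module.End ℂ (E x)) : hs (u - v) w = hs u w - hs v w := by
  simp [hs, sub_mul]

theorem hs_smul_left (c : ℂ) (u w : Module.End ℂ (E x)) : hs (c • u) w = c * hs u w := by
  simp [hs]

theorem hs_neg_left (u w : Module.End ℂ (E x)) : hs (-u) w = -hs u w := by
  simp [hs]

theorem hs_add_right (u v w : Module.End ℂ (E x)) : hs w (u + v) = hs w u + hs w v := by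
  simp [hs, mul_add]

theorem hs_sub_right (u v w : Module.End ℂ (E x)) : hs w (u - v) = hs w u - hs w v := by
  simp [hs, mul_sub]

theorem hs_smul_right (c : ℂ) (u w : Module.End ℂ (E x)) :
    hs w (c • u) = starRingEnd ℂ c * hs w u := by
  simp [hs, map_smulₛₗ]

theorem hs_neg_right (u w : Module.End ℂ (E x)) : hs w (-u) = -hs w u := by
  simp [hs]

@[simp] theorem hs_zero_left (w : Module.End ℂ (E x)) : hs 0 w = 0 := by simp [hs]

@[simp] theorem hs_zero_right (w : Module.End ℂ (E x)) : hs w 0 = 0 := by simp [hs]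

theorem hs_eq_sum {ι : Type*} [Fintype ι] (b : OrthonormalBasis ι ℂ (E x))
    (u v : Module.End ℂ (E x)) : hs u v = ∑ i, ⟪v (b i), u (b i)⟫_ℂ := by
  rw [hs, LinearMap.trace_mul_comm, LinearMap.trace_eq_sum_inner _ b]
  simp [LinearMap.adjoint_inner_right]

theorem hs_conj_symm (u v : Module.End ℂ (E x)) : starRingEnd ℂ (hs u v) = hs v u := by
  rw [hs_eq_sum (stdOrthonormalBasis ℂ (E x)), hs_eq_sum (stdOrthonormalBasis ℂ (E x)), map_sum]
  simp

theorem hs_self_eq_sum {ι : Type*} [Fintype ι] (b : OrthonormalBasis ι ℂ (E x))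
    (u : Module.End ℂ (E x)) : hs u u = ((∑ i, ‖u (b i)‖ ^ 2 : ℝ) : ℂ) := by
  rw [hs_eq_sum b]
  push_cast
  exact Finset.sum_congr rfl fun i _ ↦ inner_self_eq_norm_sq_to_K (u (b i))

theorem hs_self_nonneg (u : Module.End ℂ (E x)) : 0 ≤ (hs u u).re := by
  rw [hs_self_eq_sum (stdOrthonormalBasis ℂ (E x)), Complex.ofReal_re]
  positivity

theorem hs_self_ofReal (u : Module.End ℂ (E x)) : (((hs u u).re : ℝ) : ℂ) = hs u u := by
  rw [hs_self_eq_sum (stdOrthonormalBasis ℂ (E x)), Complex.ofReal_re]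

theorem hs_self_eq_zero {u : Module.End ℂ (E x)} (h : (hs u u).re = 0) : u = 0 := by
  have hb := hs_self_eq_sum (stdOrthonormalBasis ℂ (E x)) u
  rw [hb, Complex.ofReal_re, Finset.sum_eq_zero_iff_of_nonneg (fun i _ ↦ by positivity)] at h
  refine (stdOrthonormalBasis ℂ (E x)).toBasis.ext fun i ↦ ?_
  simpa using h i (Finset.mem_univ i)

/-- Cyclicity of the trace: the adjoint of bracketing with `b` is bracketing with `b^*`. -/
theorem hs_lie_left (a b t : Module.End ℂ (E x)) :
    hs ⁅a, b⁆ t = hs a ⁅t, LinearMap.adjoint b⁆ := by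
  have h (u v : Module.End ℂ (E x)) : LinearMap.adjoint (u * v) =
      LinearMap.adjoint v * LinearMap.adjoint u := LinearMap.adjoint_comp u v
  simp only [hs, Ring.lie_def, map_sub, sub_mul, mul_sub, h, LinearMap.adjoint_adjoint]
  rw [mul_assoc, mul_assoc b, LinearMap.trace_mul_comm ℂ b, mul_assoc]

theorem hs_lie_right (a b t : Module.End ℂ (E x)) :
    hs ⁅a, b⁆ t = hs b ⁅LinearMap.adjoint a, t⁆ := by
  have h (u v : Module.End ℂ (E x)) : LinearMap.adjoint (u * v) =
      LinearMap.adjoint v * LinearMap.adjoint u := LinearMap.adjoint_comp u v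
  simp only [hs, Ring.lie_def, map_sub, sub_mul, mul_sub, h, LinearMap.adjoint_adjoint]
  rw [mul_assoc a b, LinearMap.trace_mul_comm ℂ a, mul_assoc, mul_assoc]

theorem adjoint_lie (a b : Module.End ℂ (E x)) :
    LinearMap.adjoint ⁅a, b⁆ = ⁅LinearMap.adjoint b, LinearMap.adjoint a⁆ := by
  have h (u v : Module.End ℂ (E x)) : LinearMap.adjoint (u * v) =
      LinearMap.adjoint v * LinearMap.adjoint u := LinearMap.adjoint_comp u v
  simp [Ring.lie_def, h]

/-- The parallelogram law with the square of `u - v` dropped. -/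
theorem hs_add_self_le (u v : Module.End ℂ (E x)) :
    (hs (u + v) (u + v)).re ≤ 2 * ((hs u u).re + (hs v v).re) := by
  have h := hs_self_nonneg (u - v)
  rw [hs_sub_left, hs_sub_right, hs_sub_right] at h
  rw [hs_add_left, hs_add_right, hs_add_right]
  simp only [Complex.sub_re, Complex.add_re] at h ⊢
  linarith

end FibreAlgebra

/-! ### Conformal linear algebra of the tangent spaces. -/

section ComplexStructure

variable {X : Type*} [TopologicalSpace X] [ChartedSpace ℂ X]

@[simp] theorem J_J {x : X} (v : Tan x) : J x (J x v) = -v := by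
  let z : ℂ := v
  change Complex.I * (Complex.I * z) = -z
  rw [← mul_assoc, Complex.I_mul_I, neg_one_mul]

theorem J_one (x : X) : J x (tanOf x 1) = tanOf x Complex.I := mul_one Complex.I

theorem J_I (x : X) : J x (tanOf x Complex.I) = -tanOf x 1 := Complex.I_mul_I

theorem J_add {x : X} (v w : Tan x) : J x (v + w) = J x v + J x w := mul_add Complex.I (v : ℂ) w

theorem J_smul {x : X} (c : ℝ) (v : Tan x) : J x (c • v) = c • J x v := by
  let z : ℂ := v
  change Complex.I * (c • z) = c • (Complex.I * z)
  exact mul_smul_comm c Complex.I z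

theorem J_neg {x : X} (v : Tan x) : J x (-v) = -J x v := mul_neg Complex.I (v : ℂ)

theorem tan_eq (x : X) (v : Tan x) :
    v = (v : ℂ).re • tanOf x 1 + (v : ℂ).im • tanOf x Complex.I := by
  let z : ℂ := v
  change z = z.re • (1 : ℂ) + z.im • Complex.I
  simp

/-- Every tangent vector is a combination of `v` and `J v` as soon as `v ≠ 0`. -/
theorem exists_tan_eq {x : X} {v : Tan x} (hv : v ≠ 0) (w : Tan x) :
    ∃ a b : ℝ, w = a • v + b • J x v := by
  let z : ℂ := v
  let y : ℂ := w
  have hz : z ≠ 0 := hv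
  refine ⟨(y / z).re, (y / z).im, ?_⟩
  change y = (y / z).re • z + (y / z).im • (Complex.I * z)
  have : y = (y / z) * z := by field_simp
  nth_rewrite 1 [this, ← Complex.re_add_im (y / z)]
  simp only [Complex.real_smul]
  ring

variable [IsManifold 𝓘(ℝ, ℂ) ∞ X] (g : KahlerMetric X)

theorem KahlerMetric.lam_pos (x : X) : 0 < g.lam x :=
  g.metric.pos x _ (one_ne_zero (α := ℂ))

/-- As `J` is an isometry with `J² = -1`, the number `g(v, Jv)` equals its own negative. -/
theorem KahlerMetric.inner_J_self {x : X} (v : Tan x) : g.metric.inner x v (J x v) = 0 := by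
  have h := g.inner_J x v (J x v)
  rw [J_J, map_neg, g.metric.symm x (J x v) v] at h
  linarith

theorem KahlerMetric.inner_self {x : X} (a b : ℝ) (v : Tan x) :
    g.metric.inner x (a • v + b • J x v) (a • v + b • J x v) =
      (a ^ 2 + b ^ 2) * g.metric.inner x v v := by
  have h := g.inner_J_self v
  have h' : g.metric.inner x (J x v) v = 0 := by rw [g.metric.symm, h]
  simp only [map_add, map_smul, add_apply, smul_eq_mul,
    smul_apply, h, h', g.inner_J]
  ring

theorem KahlerMetric.inner_self_pos {x : X} {v : Tan x} (hv : v ≠ 0) :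
    0 < g.metric.inner x v v := g.metric.pos x v hv

variable {E : X → Type*} [∀ x, NormedAddCommGroup (E x)] [∀ x, InnerProductSpace ℂ (E x)]

/-- The value of an alternating form on a frame `(v, J v)` scales like the metric. -/
theorem form2_conformal {x : X} {V : Type*} [AddCommGroup V] [Module ℂ V]
    {σ : Tan x → Tan x → V}
    (hσ : ∀ v, IsLinearMap ℝ (σ v)) (hσ' : ∀ v w, σ v w = -σ w v) {v : Tan x} (hv : v ≠ 0) :
    ((g.metric.inner x v v : ℝ) : ℂ)⁻¹ • σ v (J x v) =
      (g.lam x : ℂ)⁻¹ • σ (tanOf x 1) (tanOf x Complex.I) := by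
  obtain ⟨a, b, hab⟩ : ∃ a b : ℝ, v = a • tanOf x 1 + b • J x (tanOf x 1) :=
    exists_tan_eq (one_ne_zero (α := ℂ)) v
  have hJ : J x v = a • J x (tanOf x 1) - b • tanOf x 1 := by
    rw [hab, J_add, J_smul, J_smul, J_J, smul_neg, sub_eq_add_neg]
  have hself (w : Tan x) : σ w w = 0 := by
    have h := hσ' w w
    have h2 : (2 : ℂ) • σ w w = 0 := by rw [two_smul]; nth_rewrite 1 [h]; simp
    simpa using h2
  have hl (c d : ℝ) (u w y : Tan x) : σ (c • u + d • w) y = c • σ u y + d • σ w y := by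
    rw [hσ', (hσ y).map_add, (hσ y).map_smul, (hσ y).map_smul, hσ' y u, hσ' y w]
    simp only [smul_neg, neg_add_rev, neg_neg]
    exact add_comm _ _
  -- The change of frame from `(1, i)` to `(v, Jv)` has determinant `a² + b²`, which is also the
  -- factor by which the squared length changes.
  have hval : σ v (J x v) = ((a ^ 2 + b ^ 2 : ℝ) : ℂ) • σ (tanOf x 1) (J x (tanOf x 1)) := by
    rw [hJ]
    conv_lhs => rw [hab]
    rw [sub_eq_add_neg, ← neg_smul, (hσ _).map_add, (hσ _).map_smul, (hσ _).map_smul,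
      hl, hl, hself, hself, hσ' (J x (tanOf x 1)) (tanOf x 1)]
    simp only [smul_zero, add_zero, zero_add, smul_neg, neg_smul, neg_neg,
      ← Complex.coe_smul, smul_smul, ← add_smul]
    congr 1
    push_cast; ring
  have hab0 : a ^ 2 + b ^ 2 ≠ 0 := by
    intro h0
    have ha : a = 0 := by nlinarith [sq_nonneg a, sq_nonneg b]
    have hb : b = 0 := by nlinarith [sq_nonneg a, sq_nonneg b]
    exact hv (by rw [hab, ha, hb]; simp)
  rw [hval]
  conv_lhs => rw [hab]
  rw [g.inner_self, smul_smul, J_one]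
  congr 1
  have h1 : (g.lam x : ℂ) ≠ 0 := by exact_mod_cast (g.lam_pos x).ne'
  have h2 : ((a ^ 2 + b ^ 2 : ℝ) : ℂ) ≠ 0 := by exact_mod_cast hab0
  change ((((a ^ 2 + b ^ 2) * g.lam x : ℝ) : ℂ))⁻¹ * _ = _
  rw [Complex.ofReal_mul, mul_inv, mul_right_comm, inv_mul_cancel₀ h2, one_mul]

end ComplexStructure


/-! ### Sections of `E`: algebraic operations, inner products, local orthonormal frames. -/

section Sections

theorem contMDiffAt_mul_complex {X : Type*} [TopologicalSpace X] [ChartedSpace ℂ X] {n : ℕ∞ω}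
    {x : X} {f h : X → ℂ} (hf : ContMDiffAt 𝓘(ℝ, ℂ) 𝓘(ℝ, ℂ) n f x)
    (hh : ContMDiffAt 𝓘(ℝ, ℂ) 𝓘(ℝ, ℂ) n h x) :
    ContMDiffAt 𝓘(ℝ, ℂ) 𝓘(ℝ, ℂ) n (fun y ↦ f y * h y) x :=
  (contDiff_mul (𝕜 := ℝ) (𝔸 := ℂ)).contMDiff.contMDiffAt.comp x (hf.prodMk_space hh)

variable {X : Type*} [TopologicalSpace X] [ChartedSpace ℂ X]
  {F : Type*} [NormedAddCommGroup F] [NormedSpace ℂ F]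
  {E : X → Type*} [TopologicalSpace (TotalSpace F E)]
  [∀ x, NormedAddCommGroup (E x)] [∀ x, InnerProductSpace ℂ (E x)]
  [FiberBundle F E] {n : ℕ∞ω} {x : X}

theorem SecCnAt.congr {s t : ∀ x, E x} (hs : SecCnAt F n s x) (h : ∀ᶠ y in 𝓝 x, t y = s y) :
    SecCnAt F n t x :=
  ContMDiffAt.congr_of_eventuallyEq hs (h.mono fun y hy ↦ by simp only [hy])

variable [VectorBundle ℝ F E]

theorem SecCnAt.secDiffAt {s : ∀ x, E x} (hs : SecCnAt F ∞ s x) : SecDiffAt F s x :=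
  ContMDiffAt.mdifferentiableAt hs (by simp)

theorem SecCnAt.add {s t : ∀ x, E x} (hs : SecCnAt F n s x) (ht : SecCnAt F n t x) :
    SecCnAt F n (fun y ↦ s y + t y) x :=
  ContMDiffAt.add_section hs ht

theorem SecCnAt.sum {ι : Type*} {S : Finset ι} {s : ι → ∀ x, E x}
    (hs : ∀ i ∈ S, SecCnAt F n (s i) x) : SecCnAt F n (fun y ↦ ∑ i ∈ S, s i y) x :=
  ContMDiffAt.sum_section hs

theorem SecCnAt.zero : SecCnAt F n (fun y ↦ (0 : E y)) x :=
  SecCnAt.sum (S := (∅ : Finset ℕ)) (s := fun _ _ ↦ 0) (by simp)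

theorem SecCnAt.sub {s t : ∀ x, E x} (hs : SecCnAt F n s x) (ht : SecCnAt F n t x) :
    SecCnAt F n (fun y ↦ s y - t y) x :=
  ContMDiffAt.sub_section hs ht

variable [VectorBundle ℂ F E]

theorem SecCnAt.smul {f : X → ℂ} {s : ∀ x, E x} (hf : ContMDiffAt 𝓘(ℝ, ℂ) 𝓘(ℝ, ℂ) n f x)
    (hs : SecCnAt F n s x) : SecCnAt F n (fun y ↦ f y • s y) x := by
  rw [SecCnAt, contMDiffAt_section] at hs ⊢
  have h := (contDiff_smul (𝕜 := ℝ) (𝕜' := ℂ) (F := F) (n := n)).contMDiff.contMDiffAt.comp x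
    (hf.prodMk_space hs)
  refine h.congr_of_eventuallyEq ?_
  have hx := (trivializationAt F E x).open_baseSet.mem_nhds
    (FiberBundle.mem_baseSet_trivializationAt' x)
  filter_upwards [hx] with y hy
  exact ((trivializationAt F E x).linear ℂ hy).map_smul (f y) (s y)

variable [ContMDiffVectorBundle ∞ F E 𝓘(ℝ, ℂ)]

theorem secCnAt_extend (e : E x) : SecCnAt F n (FiberBundle.extend F e) x :=
  FiberBundle.contMDiffAt_extend 𝓘(ℝ, ℂ) F e

/-- The extension has constant coordinates in the trivialization, so it is smooth on the whole base
set and not only at `x`; second covariant derivatives need this. -/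
theorem secCnAt_extend_of_mem (e : E x) {y : X} (hy : y ∈ (trivializationAt F E x).baseSet) :
    SecCnAt F ∞ (FiberBundle.extend F e) y := by
  rw [SecCnAt, (trivializationAt F E x).contMDiffAt_section_iff hy]
  refine (contMDiffAt_const (c := (trivializationAt F E x ⟨x, e⟩).2)).congr_of_eventuallyEq ?_
  filter_upwards [(trivializationAt F E x).open_baseSet.mem_nhds hy] with z hz
  simp [FiberBundle.extend, hz]

variable [FiniteDimensional ℂ F]

/-- Smoothness of the metric is only assumed on smooth sections. Expanding both sections in a smooth
local frame reduces the `C^n` case to the Gram matrix of that frame. -/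
theorem SecCnAt.inner (hE : IsSmoothHermitian E F) (hn : n ≤ (∞ : ℕ∞ω)) {s t : ∀ x, E x}
    (hs : SecCnAt F n s x) (ht : SecCnAt F n t x) :
    ContMDiffAt 𝓘(ℝ, ℂ) 𝓘(ℝ, ℂ) n (fun y ↦ ⟪s y, t y⟫_ℂ) x := by
  have : ContMDiffVectorBundle n F E 𝓘(ℝ, ℂ) := ContMDiffVectorBundle.of_le hn
  have : ContMDiffVectorBundle 1 F E 𝓘(ℝ, ℂ) := ContMDiffVectorBundle.of_le (n := (∞ : ℕ∞ω)) (by simp)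
  have : FiniteDimensional ℝ F := FiniteDimensional.complexToReal F
  let e := trivializationAt F E x
  let b := Module.finBasis ℝ F
  have hx : x ∈ e.baseSet := FiberBundle.mem_baseSet_trivializationAt' x
  let c (r : ∀ x, E x) (i) (y : X) : ℝ := e.localFrameCoeff 𝓘(ℝ, ℂ) b i y (r y)
  have hc {r : ∀ x, E x} (hr : SecCnAt F n r x) (i) :
      ContMDiffAt 𝓘(ℝ, ℂ) 𝓘(ℝ, ℂ) n (fun y ↦ (c r i y : ℂ)) x :=
    Complex.ofRealCLM.contDiff.contMDiff.contMDiffAt.comp x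
      (contMDiffAt_localFrameCoeff (I := 𝓘(ℝ, ℂ)) b hx hr i)
  have hf (i) : SecCnAt F ∞ (e.localFrame b i) x := contMDiffAt_localFrame_of_mem (∞ : ℕ∞ω) e b i hx
  have hsum : ContMDiffAt 𝓘(ℝ, ℂ) 𝓘(ℝ, ℂ) n (fun y ↦ ∑ i, ∑ j, (c s i y : ℂ) * (c t j y : ℂ) *
      ⟪e.localFrame b i y, e.localFrame b j y⟫_ℂ) x :=
    contMDiffAt_finsetSum fun i _ ↦ contMDiffAt_finsetSum fun j _ ↦
      contMDiffAt_mul_complex (contMDiffAt_mul_complex (hc hs i) (hc ht j)) ((hE _ _ x (hf i) (hf j)).of_le hn)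
  refine hsum.congr_of_eventuallyEq ?_
  filter_upwards [e.eventually_eq_localFrame_sum_coeff_smul (I := 𝓘(ℝ, ℂ)) b hx (s := s),
    e.eventually_eq_localFrame_sum_coeff_smul (I := 𝓘(ℝ, ℂ)) b hx (s := t)] with y hy hy'
  rw [hy, hy', sum_inner]
  refine Finset.sum_congr rfl fun i _ ↦ ?_
  rw [inner_sum]
  refine Finset.sum_congr rfl fun j _ ↦ ?_
  simp only [← Complex.coe_smul, inner_smul_left, inner_smul_right, Complex.conj_ofReal]
  simp only [c]
  ring

variable [∀ x, FiniteDimensional ℂ (E x)]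

theorem linearIndependent_extend {ι : Type*} {b : ι → E x} (hb : LinearIndependent ℂ b) {y : X}
    (hy : y ∈ (trivializationAt F E x).baseSet) :
    LinearIndependent ℂ (fun i ↦ FiberBundle.extend F (b i) y) := by
  let e := trivializationAt F E x
  have hx : x ∈ e.baseSet := FiberBundle.mem_baseSet_trivializationAt' x
  have h := hb.map' ((e.linearEquivAt ℂ x hx).trans (e.linearEquivAt ℂ y hy).symm).toLinearMap
    (LinearEquiv.ker _)
  exact h

/-- Induction along the Gram–Schmidt recursion; its denominators do not vanish at `x` because the
family is independent there. -/
theorem secCnAt_gramSchmidt (hE : IsSmoothHermitian E F) {m : ℕ} (f : Fin m → ∀ y, E y)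
    (hf : ∀ i, SecCnAt F ∞ (f i) x) (hl : LinearIndependent ℂ (fun i ↦ f i x)) (i : Fin m) :
    SecCnAt F ∞ (fun y ↦ InnerProductSpace.gramSchmidt ℂ (fun j ↦ f j y) i) x := by
  induction i using WellFoundedLT.induction with
  | ind i ih =>
    have h : (fun y ↦ InnerProductSpace.gramSchmidt ℂ (fun j ↦ f j y) i) = fun y ↦
        f i y - ∑ k ∈ Finset.Iio i,
          (⟪InnerProductSpace.gramSchmidt ℂ (fun j ↦ f j y) k, f i y⟫_ℂ *
            (⟪InnerProductSpace.gramSchmidt ℂ (fun j ↦ f j y) k,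
              InnerProductSpace.gramSchmidt ℂ (fun j ↦ f j y) k⟫_ℂ)⁻¹) •
            InnerProductSpace.gramSchmidt ℂ (fun j ↦ f j y) k := by
      funext y
      rw [eq_sub_iff_add_eq]
      conv_rhs => rw [InnerProductSpace.gramSchmidt_def'' ℂ (fun j ↦ f j y) i]
      simp only [inner_self_eq_norm_sq_to_K, div_eq_mul_inv]
    rw [h]
    refine (hf i).sub (SecCnAt.sum fun k hk ↦ ?_)
    have hk' := ih k (Finset.mem_Iio.mp hk)
    refine SecCnAt.smul (contMDiffAt_mul_complex (hk'.inner hE le_rfl (hf i)) ?_) hk'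
    have hne : ⟪InnerProductSpace.gramSchmidt ℂ (fun j ↦ f j x) k,
        InnerProductSpace.gramSchmidt ℂ (fun j ↦ f j x) k⟫_ℂ ≠ 0 :=
      inner_self_ne_zero.mpr (InnerProductSpace.gramSchmidt_ne_zero k hl)
    exact ((contDiffAt_inv ℝ hne).contMDiffAt).comp x (hk'.inner hE le_rfl hk')

/-- Smooth orthonormal frames exist locally. -/
theorem exists_orthonormal_frame (hE : IsSmoothHermitian E F) (x : X) :
    ∃ U : Set X, IsOpen U ∧ x ∈ U ∧ ∃ (m : ℕ) (e : Fin m → ∀ y, E y),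
      (∀ y ∈ U, ∀ i, SecCnAt F ∞ (e i) y) ∧
      ∀ y ∈ U, ∃ b : OrthonormalBasis (Fin m) ℂ (E y), ∀ i, b i = e i y := by
  let t := trivializationAt F E x
  let b := stdOrthonormalBasis ℂ (E x)
  let f (i) (y : X) : E y := FiberBundle.extend F (b i) y
  have hf (y) (hy : y ∈ t.baseSet) (i) : SecCnAt F ∞ (f i) y := secCnAt_extend_of_mem (b i) hy
  have hl (y) (hy : y ∈ t.baseSet) : LinearIndependent ℂ (fun i ↦ f i y) :=
    linearIndependent_extend b.orthonormal.linearIndependent hy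
  have hx : x ∈ t.baseSet := FiberBundle.mem_baseSet_trivializationAt' x
  refine ⟨t.baseSet, t.open_baseSet, hx, _,
    fun i y ↦ InnerProductSpace.gramSchmidtNormed ℂ (fun j ↦ f j y) i, fun y hy i ↦ ?_,
    fun y hy ↦ ?_⟩
  · have hg := secCnAt_gramSchmidt hE f (hf y hy) (hl y hy) i
    have hne : (⟪InnerProductSpace.gramSchmidt ℂ (fun j ↦ f j y) i,
        InnerProductSpace.gramSchmidt ℂ (fun j ↦ f j y) i⟫_ℂ).re ≠ 0 := by
      have h := InnerProductSpace.gramSchmidt_ne_zero (𝕜 := ℂ) i (hl y hy)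
      rw [← RCLike.re_eq_complex_re, inner_self_eq_norm_sq]
      simpa using h
    have h1 : ContMDiffAt 𝓘(ℝ, ℂ) 𝓘(ℝ, ℝ) ∞ (fun y ↦
        (⟪InnerProductSpace.gramSchmidt ℂ (fun j ↦ f j y) i,
          InnerProductSpace.gramSchmidt ℂ (fun j ↦ f j y) i⟫_ℂ).re) y :=
      Complex.reCLM.contDiff.contMDiff.contMDiffAt.comp y (hg.inner hE le_rfl hg)
    have h2 := ((Real.contDiffAt_sqrt (n := ∞) hne).inv
      (Real.sqrt_ne_zero'.mpr (lt_of_le_of_ne (inner_self_nonneg (𝕜 := ℂ)) hne.symm))).contMDiffAt.comp y h1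
    refine SecCnAt.congr (SecCnAt.smul
      (Complex.ofRealCLM.contDiff.contMDiff.contMDiffAt.comp y h2) hg)
      (Eventually.of_forall fun z ↦ ?_)
    simp only [InnerProductSpace.gramSchmidtNormed, Function.comp_apply, Complex.ofRealCLM_apply]
    rw [norm_eq_sqrt_re_inner (𝕜 := ℂ)]
    simp
  · have hdim : Module.finrank ℂ (E y) =
        Fintype.card (Fin (Module.finrank ℂ (E x))) := by
      rw [Fintype.card_fin]
      exact ((t.linearEquivAt ℂ y hy).trans (t.linearEquivAt ℂ x hx).symm).finrank_eq
    have ho := InnerProductSpace.gramSchmidtNormed_orthonormal (hl y hy)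
    have hs : ⊤ ≤ Submodule.span ℂ
        (Set.range (InnerProductSpace.gramSchmidtNormed ℂ fun j ↦ f j y)) :=
      (LinearIndependent.span_eq_top_of_card_eq_finrank' ho.linearIndependent hdim.symm).ge
    exact ⟨OrthonormalBasis.mk ho hs, fun i ↦ by simp⟩

end Sections

/-! ### Sections of `End E` and their matrices in orthonormal frames. -/

section EndSections

variable {X : Type*} [TopologicalSpace X] [ChartedSpace ℂ X]
  (F : Type*) [NormedAddCommGroup F] [NormedSpace ℂ F]
  {E : X → Type*} [TopologicalSpace (TotalSpace F E)]
  [∀ x, NormedAddCommGroup (E x)] [∀ x, InnerProductSpace ℂ (E x)]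
  [FiberBundle F E] {n : ℕ∞ω} {x : X}

/-- A section of `End E` is `C^n` at a point. -/
def EndCnAt (n : ℕ∞ω) (u : Form0 E) (x : X) : Prop :=
  ∀ s : ∀ x, E x, SecCnAt F n s x → SecCnAt F n (fun y ↦ u y (s y)) x

/-- A smooth orthonormal frame over an open set. -/
structure IsFrame {m : ℕ} (U : Set X) (e : Fin m → ∀ y, E y) : Prop where
  isOpen : IsOpen U
  smooth : ∀ y ∈ U, ∀ i, SecCnAt F ∞ (e i) y
  basis : ∀ y ∈ U, ∃ b : OrthonormalBasis (Fin m) ℂ (E y), ∀ i, b i = e i y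

variable {F}

theorem isForm0_iff {u : Form0 E} : IsForm0 F n u ↔ ∀ x, EndCnAt F n u x :=
  ⟨fun h x s ↦ h s x, fun h s x ↦ h x s⟩

namespace EndCnAt

theorem congr {u v : Form0 E} (hu : EndCnAt F n u x) (h : ∀ᶠ y in 𝓝 x, v y = u y) :
    EndCnAt F n v x := fun s hs ↦
  (hu s hs).congr (h.mono fun y hy ↦ by rw [hy])

theorem mul {u v : Form0 E} (hu : EndCnAt F n u x) (hv : EndCnAt F n v x) :
    EndCnAt F n (fun y ↦ u y * v y) x := fun s hs ↦ hu _ (hv s hs)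

variable [VectorBundle ℝ F E]

theorem add {u v : Form0 E} (hu : EndCnAt F n u x) (hv : EndCnAt F n v x) :
    EndCnAt F n (fun y ↦ u y + v y) x := fun s hs ↦ (hu s hs).add (hv s hs)

theorem sub {u v : Form0 E} (hu : EndCnAt F n u x) (hv : EndCnAt F n v x) :
    EndCnAt F n (fun y ↦ u y - v y) x := fun s hs ↦ (hu s hs).sub (hv s hs)

theorem sum {ι : Type*} {S : Finset ι} {u : ι → Form0 E} (hu : ∀ i ∈ S, EndCnAt F n (u i) x) :
    EndCnAt F n (fun y ↦ ∑ i ∈ S, u i y) x := fun s hs ↦ by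
  simp only [LinearMap.sum_apply]
  exact SecCnAt.sum fun i hi ↦ hu i hi s hs

theorem zero : EndCnAt F n (fun y ↦ (0 : Module.End ℂ (E y))) x := fun _ _ ↦ SecCnAt.zero

theorem lie {u v : Form0 E} (hu : EndCnAt F n u x) (hv : EndCnAt F n v x) :
    EndCnAt F n (fun y ↦ ⁅u y, v y⁆) x := (hu.mul hv).sub (hv.mul hu)

variable [VectorBundle ℂ F E]

theorem smul {f : X → ℂ} {u : Form0 E} (hf : ContMDiffAt 𝓘(ℝ, ℂ) 𝓘(ℝ, ℂ) n f x)
    (hu : EndCnAt F n u x) : EndCnAt F n (fun y ↦ f y • u y) x := fun s hs ↦ (hu s hs).smul hf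

theorem const_smul {u : Form0 E} (c : ℂ) (hu : EndCnAt F n u x) :
    EndCnAt F n (fun y ↦ c • u y) x := hu.smul contMDiffAt_const

theorem neg {u : Form0 E} (hu : EndCnAt F n u x) : EndCnAt F n (fun y ↦ -u y) x :=
  (hu.const_smul (-1)).congr (Eventually.of_forall fun y ↦ by simp)

end EndCnAt

section Frame

variable [VectorBundle ℝ F E] [VectorBundle ℂ F E] [ContMDiffVectorBundle ∞ F E 𝓘(ℝ, ℂ)]
  [FiniteDimensional ℂ F] {m : ℕ} {U : Set X} {e : Fin m → ∀ y, E y}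

theorem exists_isFrame [∀ x, FiniteDimensional ℂ (E x)] (hE : IsSmoothHermitian E F) (x : X) :
    ∃ U : Set X, x ∈ U ∧ ∃ (m : ℕ) (e : Fin m → ∀ y, E y), IsFrame F U e := by
  obtain ⟨U, hU, hx, m, e, he, hb⟩ := exists_orthonormal_frame hE x
  exact ⟨U, hx, m, e, hU, he, hb⟩

theorem IsFrame.sum_eq (he : IsFrame F U e) {y : X} (hy : y ∈ U) (v : E y) :
    v = ∑ i, ⟪e i y, v⟫_ℂ • e i y := by
  obtain ⟨b, hb⟩ := he.basis y hy
  simpa only [hb] using (b.sum_repr' v).symm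

theorem IsFrame.inner_eq (he : IsFrame F U e) {y : X} (hy : y ∈ U) (i j : Fin m) :
    ⟪e i y, e j y⟫_ℂ = if i = j then 1 else 0 := by
  obtain ⟨b, hb⟩ := he.basis y hy
  rw [← hb, ← hb]
  exact orthonormal_iff_ite.mp b.orthonormal i j

theorem IsFrame.eventually_sum_eq (he : IsFrame F U e) (hx : x ∈ U) (s : ∀ y, E y) :
    ∀ᶠ y in 𝓝 x, s y = ∑ i, ⟪e i y, s y⟫_ℂ • e i y := by
  filter_upwards [he.isOpen.mem_nhds hx] with y hy using he.sum_eq hy (s y)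

theorem IsFrame.secCnAt (he : IsFrame F U e) (hx : x ∈ U) (hn : n ≤ (∞ : ℕ∞ω)) (i : Fin m) :
    SecCnAt F n (e i) x := ContMDiffAt.of_le (he.smooth x hx i) hn

/-- A section of `End E` is `C^n` as soon as its matrix in an orthonormal frame is. -/
theorem IsFrame.endCnAt (he : IsFrame F U e) (hx : x ∈ U) (hE : IsSmoothHermitian E F)
    (hn : n ≤ (∞ : ℕ∞ω)) {u : Form0 E}
    (h : ∀ i j, ContMDiffAt 𝓘(ℝ, ℂ) 𝓘(ℝ, ℂ) n (fun y ↦ ⟪e i y, u y (e j y)⟫_ℂ) x) :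
    EndCnAt F n u x := by
  intro s hs
  have h1 : SecCnAt F n (fun y ↦ ∑ i, ∑ j, (⟪e i y, u y (e j y)⟫_ℂ * ⟪e j y, s y⟫_ℂ) • e i y) x :=
    SecCnAt.sum fun i _ ↦ SecCnAt.sum fun j _ ↦ SecCnAt.smul
      (contMDiffAt_mul_complex (h i j) ((he.secCnAt hx hn j).inner hE hn hs)) (he.secCnAt hx hn i)
  refine h1.congr ?_
  filter_upwards [he.isOpen.mem_nhds hx] with y hy
  rw [he.sum_eq hy (u y (s y))]
  refine Finset.sum_congr rfl fun i _ ↦ ?_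
  rw [← Finset.sum_smul]
  congr 1
  conv_lhs => rw [he.sum_eq hy (s y)]
  rw [map_sum, inner_sum]
  refine Finset.sum_congr rfl fun j _ ↦ ?_
  rw [map_smul, inner_smul_right, mul_comm]

theorem IsFrame.matrix (he : IsFrame F U e) (hx : x ∈ U) (hE : IsSmoothHermitian E F)
    (hn : n ≤ (∞ : ℕ∞ω)) {u : Form0 E} (hu : EndCnAt F n u x) (i j : Fin m) :
    ContMDiffAt 𝓘(ℝ, ℂ) 𝓘(ℝ, ℂ) n (fun y ↦ ⟪e i y, u y (e j y)⟫_ℂ) x :=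
  (he.secCnAt hx hn i).inner hE hn (hu _ (he.secCnAt hx hn j))

variable [∀ x, FiniteDimensional ℂ (E x)]

theorem contMDiffAt_conj {f : X → ℂ} (hf : ContMDiffAt 𝓘(ℝ, ℂ) 𝓘(ℝ, ℂ) n f x) :
    ContMDiffAt 𝓘(ℝ, ℂ) 𝓘(ℝ, ℂ) n (fun y ↦ starRingEnd ℂ (f y)) x :=
  (Complex.conjCLE.contDiff (n := n)).contMDiff.contMDiffAt.comp x hf

/-- In an orthonormal frame the matrix of the adjoint is the conjugate transpose. -/
theorem EndCnAt.adjoint (hE : IsSmoothHermitian E F) (hn : n ≤ (∞ : ℕ∞ω)) {u : Form0 E}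
    (hu : EndCnAt F n u x) : EndCnAt F n (fun y ↦ LinearMap.adjoint (u y)) x := by
  obtain ⟨U, hx, m, e, he⟩ := exists_isFrame hE x
  refine he.endCnAt hx hE hn fun i j ↦ ?_
  refine (contMDiffAt_conj (he.matrix hx hE hn hu j i)).congr_of_eventuallyEq
    (Eventually.of_forall fun y ↦ ?_)
  simp [LinearMap.adjoint_inner_right]

theorem EndCnAt.hs (hE : IsSmoothHermitian E F) (hn : n ≤ (∞ : ℕ∞ω)) {u v : Form0 E}
    (hu : EndCnAt F n u x) (hv : EndCnAt F n v x) :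
    ContMDiffAt 𝓘(ℝ, ℂ) 𝓘(ℝ, ℂ) n (fun y ↦ HiggsKuranishi.hs (u y) (v y)) x := by
  obtain ⟨U, hx, m, e, he⟩ := exists_isFrame hE x
  have h : ContMDiffAt 𝓘(ℝ, ℂ) 𝓘(ℝ, ℂ) n
      (fun y ↦ ∑ i, ⟪v y (e i y), u y (e i y)⟫_ℂ) x :=
    contMDiffAt_finsetSum fun i _ ↦
      (hv _ (he.secCnAt hx hn i)).inner hE hn (hu _ (he.secCnAt hx hn i))
  refine h.congr_of_eventuallyEq ?_
  filter_upwards [he.isOpen.mem_nhds hx] with y hy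
  obtain ⟨b, hb⟩ := he.basis y hy
  simp only [hs_eq_sum b, hb]

end Frame

end EndSections

/-! ### Calculus of the connection on `E` and tensoriality. -/

section CovariantCalculus

variable {X : Type*} [TopologicalSpace X] [ChartedSpace ℂ X] [IsManifold 𝓘(ℝ, ℂ) ∞ X]
  {F : Type*} [NormedAddCommGroup F] [NormedSpace ℂ F]
  {E : X → Type*} [TopologicalSpace (TotalSpace F E)]
  [∀ x, NormedAddCommGroup (E x)] [∀ x, InnerProductSpace ℂ (E x)]
  [FiberBundle F E] [VectorBundle ℝ F E] [VectorBundle ℂ F E]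
  (A : UnitaryConnection F E) {x : X}

theorem mvfderiv_re {f : X → ℂ} (hf : MDifferentiableAt 𝓘(ℝ, ℂ) 𝓘(ℝ, ℂ) f x) (v : Tan x) :
    mvfderiv 𝓘(ℝ, ℂ) (fun y ↦ (f y).re) x v = (mvfderiv 𝓘(ℝ, ℂ) f x v).re := by
  have h := Complex.reCLM.hasMFDerivAt (x := f x) |>.comp x hf.hasMFDerivAt
  exact congrArg (fun L : ℂ →L[ℝ] ℝ ↦ L v) h.mfderiv

theorem mvfderiv_im {f : X → ℂ} (hf : MDifferentiableAt 𝓘(ℝ, ℂ) 𝓘(ℝ, ℂ) f x) (v : Tan x) :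
    mvfderiv 𝓘(ℝ, ℂ) (fun y ↦ (f y).im) x v = (mvfderiv 𝓘(ℝ, ℂ) f x v).im := by
  have h := Complex.imCLM.hasMFDerivAt (x := f x) |>.comp x hf.hasMFDerivAt
  exact congrArg (fun L : ℂ →L[ℝ] ℝ ↦ L v) h.mfderiv

theorem mvfderiv_congr {V : Type*} [NormedAddCommGroup V] [NormedSpace ℝ V] {f h : X → V}
    (hf : f =ᶠ[𝓝 x] h) : mvfderiv 𝓘(ℝ, ℂ) f x = mvfderiv 𝓘(ℝ, ℂ) h x := by
  ext v
  exact congrArg (fun L : ℂ →L[ℝ] V ↦ L v) hf.mfderiv_eq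

namespace UnitaryConnection

theorem cov_congr {s t : ∀ x, E x} (hs : SecCnAt F ∞ s x) (h : ∀ᶠ y in 𝓝 x, t y = s y) :
    A.cov t x = A.cov s x :=
  (A.cov.isCovariantDerivativeOn (s := Set.univ)).congr_of_eventuallyEq
    (hs.congr h).secDiffAt hs.secDiffAt univ_mem h

theorem cov_add {s t : ∀ x, E x} (hs : SecCnAt F ∞ s x) (ht : SecCnAt F ∞ t x) :
    A.cov (fun y ↦ s y + t y) x = A.cov s x + A.cov t x :=
  (A.cov.isCovariantDerivativeOn (s := Set.univ)).add hs.secDiffAt ht.secDiffAt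

/-- The Leibniz rule of the connection concerns real functions. The complex case follows by
splitting `f` into real and imaginary parts and using that the connection commutes with `i`. -/
theorem cov_smul {f : X → ℂ} {s : ∀ x, E x} (hf : ContMDiffAt 𝓘(ℝ, ℂ) 𝓘(ℝ, ℂ) ∞ f x)
    (hs : SecCnAt F ∞ s x) (v : Tan x) :
    A.cov (fun y ↦ f y • s y) x v =
      f x • A.cov s x v + mvfderiv 𝓘(ℝ, ℂ) f x v • s x := by
  have hre : ContMDiffAt 𝓘(ℝ, ℂ) 𝓘(ℝ, ℝ) ∞ (fun y ↦ (f y).re) x :=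
    Complex.reCLM.contDiff.contMDiff.contMDiffAt.comp x hf
  have him : ContMDiffAt 𝓘(ℝ, ℂ) 𝓘(ℝ, ℝ) ∞ (fun y ↦ (f y).im) x :=
    Complex.imCLM.contDiff.contMDiff.contMDiffAt.comp x hf
  have hI : SecCnAt F ∞ (fun y ↦ Complex.I • s y) x := SecCnAt.smul contMDiffAt_const hs
  have h1 : SecCnAt F ∞ (fun y ↦ (f y).re • s y) x := ContMDiffAt.smul_section hre hs
  have h2 : SecCnAt F ∞ (fun y ↦ (f y).im • (Complex.I • s y)) x :=
    ContMDiffAt.smul_section him hI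
  have e : (fun y ↦ f y • s y) =
      fun y ↦ (f y).re • s y + (f y).im • (Complex.I • s y) := by
    funext y
    conv_lhs => rw [← Complex.re_add_im (f y)]
    rw [add_smul, mul_smul]
    rfl
  have hcov := A.cov.isCovariantDerivativeOn (s := Set.univ)
  have l1 := hcov.leibniz (g := fun y ↦ (f y).re) hs.secDiffAt (hre.mdifferentiableAt (by simp))
  have l2 := hcov.leibniz (g := fun y ↦ (f y).im) hI.secDiffAt (him.mdifferentiableAt (by simp))
  have hfd := hf.mdifferentiableAt (by simp)
  rw [e, A.cov_add h1 h2, _root_.add_apply]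
  change A.cov ((fun y ↦ (f y).re) • s) x v +
    A.cov ((fun y ↦ (f y).im) • fun y ↦ Complex.I • s y) x v = _
  rw [l1, l2]
  simp only [_root_.add_apply, _root_.smul_apply, ContinuousLinearMap.smulRight_apply]
  rw [mvfderiv_re hfd, mvfderiv_im hfd, A.complex_linear s x hs.secDiffAt]
  conv_rhs => rw [← Complex.re_add_im (f x), ← Complex.re_add_im (mvfderiv 𝓘(ℝ, ℂ) f x v)]
  simp only [← Complex.coe_smul]
  module

theorem cov_const_smul (c : ℂ) {s : ∀ x, E x} (hs : SecCnAt F ∞ s x) (v : Tan x) :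
    A.cov (fun y ↦ c • s y) x v = c • A.cov s x v := by
  have h := A.cov_smul (f := fun _ ↦ c) contMDiffAt_const hs v
  rwa [mvfderiv_const, _root_.zero_apply, zero_smul, add_zero] at h

theorem cov_sub {s t : ∀ x, E x} (hs : SecCnAt F ∞ s x) (ht : SecCnAt F ∞ t x) (v : Tan x) :
    A.cov (fun y ↦ s y - t y) x v = A.cov s x v - A.cov t x v := by
  have h := A.cov_add hs (SecCnAt.smul (f := fun _ ↦ (-1 : ℂ)) contMDiffAt_const ht)
  have h2 := A.cov_const_smul (-1) ht v
  have e : (fun y ↦ s y - t y) = fun y ↦ s y + (-1 : ℂ) • t y := by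
    funext y; rw [neg_one_smul, sub_eq_add_neg]
  rw [e, h, _root_.add_apply, h2, neg_one_smul, sub_eq_add_neg]

theorem secCnAt_cov {s : ∀ x, E x} {V : ∀ x : X, Tan x} (hs : ∀ᶠ y in 𝓝 x, SecCnAt F ∞ s y)
    (hV : FieldCnAt ∞ V x) : SecCnAt F ∞ (fun y ↦ A.cov s y (V y)) x := by
  obtain ⟨U, hUs, hU, hx⟩ := eventually_nhds_iff.mp hs
  have h := (A.smooth U hU).contMDiff (σ := s) (fun y hy ↦ by
    have := hUs y hy
    exact this.contMDiffWithinAt)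
  exact ContMDiffAt.clm_bundle_apply (F₁ := ℂ) (E₁ := fun y : X ↦ TangentSpace 𝓘(ℝ, ℂ) y) (h.contMDiffAt (hU.mem_nhds hx)) hV

end UnitaryConnection

variable [ContMDiffVectorBundle ∞ F E 𝓘(ℝ, ℂ)] [FiniteDimensional ℂ F]
  [∀ x, FiniteDimensional ℂ (E x)]

/-- An operation on sections that is local and linear over smooth functions is pointwise.  The
sections are smooth at `x` (`l = pure x`) or near `x` (`l = 𝓝 x`). -/
theorem exists_linearMap_of_tensorial (hE : IsSmoothHermitian E F) {W : Type*} [AddCommGroup W]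
    [Module ℂ W] {l : Filter X} (hl : l ≤ 𝓝 x) (D : (∀ y, E y) → W)
    (hc : ∀ s t : ∀ y, E y, (∀ᶠ y in l, SecCnAt F ∞ s y) → (∀ᶠ y in 𝓝 x, t y = s y) → D t = D s)
    (ha : ∀ s t : ∀ y, E y, (∀ᶠ y in l, SecCnAt F ∞ s y) → (∀ᶠ y in l, SecCnAt F ∞ t y) →
      D (fun y ↦ s y + t y) = D s + D t)
    (hs : ∀ (f : X → ℂ) (s : ∀ y, E y), (∀ᶠ y in l, ContMDiffAt 𝓘(ℝ, ℂ) 𝓘(ℝ, ℂ) ∞ f y) →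
      (∀ᶠ y in l, SecCnAt F ∞ s y) → D (fun y ↦ f y • s y) = f x • D s) :
    ∃ L : E x →ₗ[ℂ] W, ∀ s, (∀ᶠ y in l, SecCnAt F ∞ s y) → D s = L (s x) := by
  obtain ⟨U, hx, m, e, he⟩ := exists_isFrame hE x
  have hU : ∀ᶠ y in l, y ∈ U := hl (he.isOpen.mem_nhds hx)
  have hel (i : Fin m) : ∀ᶠ y in l, SecCnAt F ∞ (e i) y := hU.mono fun y hy ↦ he.smooth y hy i
  have hz : D (fun _ ↦ 0) = 0 := by
    have h := hs 0 (fun _ ↦ 0) (Eventually.of_forall fun _ ↦ contMDiffAt_const)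
      (Eventually.of_forall fun _ ↦ SecCnAt.zero)
    simpa using h
  have hsum (S : Finset (Fin m)) (t : Fin m → ∀ y, E y)
      (ht : ∀ i, ∀ᶠ y in l, SecCnAt F ∞ (t i) y) :
      D (fun y ↦ ∑ i ∈ S, t i y) = ∑ i ∈ S, D (t i) := by
    classical
    induction S using Finset.induction_on with
    | empty => simpa using hz
    | insert a S haS ih =>
      simp only [Finset.sum_insert haS, ← ih]
      exact ha _ _ (ht a) ((eventually_all.mpr ht).mono fun y hy ↦ SecCnAt.sum fun i _ ↦ hy i)
  -- The candidate is forced by the frame expansion: `L v = ∑ ⟨e_i, v⟩ D(e_i)`.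
  refine ⟨∑ i, (innerSL ℂ (e i x)).toLinearMap.smulRight (D (e i)), fun s hss ↦ ?_⟩
  have hcoef (i : Fin m) : ∀ᶠ y in l, ContMDiffAt 𝓘(ℝ, ℂ) 𝓘(ℝ, ℂ) ∞ (fun y ↦ ⟪e i y, s y⟫_ℂ) y := by
    filter_upwards [hel i, hss] with y h1 h2 using h1.inner hE le_rfl h2
  have hterm (i : Fin m) : ∀ᶠ y in l, SecCnAt F ∞ (fun y ↦ ⟪e i y, s y⟫_ℂ • e i y) y := by
    filter_upwards [hel i, hcoef i] with y h1 h2 using h1.smul h2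
  have h1 : D s = D (fun y ↦ ∑ i, ⟪e i y, s y⟫_ℂ • e i y) :=
    hc _ _ ((eventually_all.mpr hterm).mono fun y hy ↦ SecCnAt.sum fun i _ ↦ hy i)
      (he.eventually_sum_eq hx s)
  rw [h1, hsum _ (fun i y ↦ ⟪e i y, s y⟫_ℂ • e i y) hterm]
  simp only [LinearMap.sum_apply, LinearMap.smulRight_apply, ContinuousLinearMap.coe_coe,
    innerSL_apply_apply]
  exact Finset.sum_congr rfl fun i _ ↦ hs _ _ (hcoef i) (hel i)

/-- The expression is tensorial in `s`. This removes the dependence on the particular extension used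
in `covEndFun`, and shows that the linearity test in `covEnd` succeeds, so that the default value is
not taken. -/
theorem covEnd_apply (hE : IsSmoothHermitian E F) {u : Form0 E} (hu : EndCnAt F ∞ u x)
    {s : ∀ y, E y} (hs : SecCnAt F ∞ s x) (v : Tan x) :
    covEnd A u x v (s x) = A.cov (fun y ↦ u y (s y)) x v - u x (A.cov s x v) := by
  obtain ⟨L, hL⟩ := exists_linearMap_of_tensorial hE (x := x) (pure_le_nhds x)
    (fun s ↦ A.cov (fun y ↦ u y (s y)) x v - u x (A.cov s x v))
    (fun s t hs h ↦ by
      have hs := eventually_pure.mp hs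
      rw [A.cov_congr hs h, A.cov_congr (hu s hs) (h.mono fun y hy ↦ by simp only [hy])])
    (fun s t hs ht ↦ by
      have hs := eventually_pure.mp hs
      have ht := eventually_pure.mp ht
      simp only [map_add]
      rw [A.cov_add hs ht, A.cov_add (hu s hs) (hu t ht)]
      simp only [_root_.add_apply, map_add]
      abel)
    (fun f s hf hs ↦ by
      have hs := eventually_pure.mp hs
      have hf := eventually_pure.mp hf
      simp only [map_smul]
      rw [A.cov_smul hf hs, A.cov_smul hf (hu s hs), map_add, map_smul, map_smul, smul_sub]
      abel)
  have h : covEndFun A u x v = L := by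
    funext e
    have := hL _ (eventually_pure.mpr (secCnAt_extend e))
    rw [FiberBundle.extend_apply_self] at this
    exact this
  have hlin : IsLinearMap ℂ (covEndFun A u x v) := h ▸ L.isLinear
  rw [covEnd, dif_pos hlin]
  exact (congrFun h (s x)).trans (hL s (eventually_pure.mpr hs)).symm

end CovariantCalculus

/-! ### The induced connection on `End E`. -/

section CovariantEnd

variable {X : Type*} [TopologicalSpace X] [ChartedSpace ℂ X] [IsManifold 𝓘(ℝ, ℂ) ∞ X]
  {F : Type*} [NormedAddCommGroup F] [NormedSpace ℂ F]
  {E : X → Type*} [TopologicalSpace (TotalSpace F E)]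
  [∀ x, NormedAddCommGroup (E x)] [∀ x, InnerProductSpace ℂ (E x)]
  [FiberBundle F E] [VectorBundle ℝ F E] [VectorBundle ℂ F E]
  (A : UnitaryConnection F E) {x : X}
  [ContMDiffVectorBundle ∞ F E 𝓘(ℝ, ℂ)] [FiniteDimensional ℂ F]
  [∀ x, FiniteDimensional ℂ (E x)]

/-- Endomorphisms of a fibre agree as soon as they agree on values of smooth sections. -/
theorem end_ext {T S : Module.End ℂ (E x)}
    (h : ∀ s : ∀ y, E y, SecCnAt F ∞ s x → T (s x) = S (s x)) : T = S :=
  LinearMap.ext fun e ↦ by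
    have := h _ (secCnAt_extend e)
    rwa [FiberBundle.extend_apply_self] at this

theorem covEnd_congr {u v : Form0 E} (hE : IsSmoothHermitian E F) (hu : EndCnAt F ∞ u x)
    (h : ∀ᶠ y in 𝓝 x, v y = u y) : covEnd A v x = covEnd A u x := by
  funext w
  refine end_ext (F := F) fun s hs ↦ ?_
  rw [covEnd_apply A hE hu hs, covEnd_apply A hE (hu.congr h) hs,
    A.cov_congr (hu s hs) (h.mono fun y hy ↦ by simp only [hy]), h.self_of_nhds]

theorem covEnd_add_vec (u : Form0 E) (hE : IsSmoothHermitian E F) (hu : EndCnAt F ∞ u x)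
    (v w : Tan x) : covEnd A u x (v + w) = covEnd A u x v + covEnd A u x w := by
  refine end_ext (F := F) fun s hs ↦ ?_
  rw [LinearMap.add_apply, covEnd_apply A hE hu hs, covEnd_apply A hE hu hs,
    covEnd_apply A hE hu hs]
  simp only [map_add]
  abel

theorem covEnd_smul_vec (u : Form0 E) (hE : IsSmoothHermitian E F) (hu : EndCnAt F ∞ u x)
    (c : ℝ) (v : Tan x) : covEnd A u x (c • v) = c • covEnd A u x v := by
  refine end_ext (F := F) fun s hs ↦ ?_
  rw [LinearMap.smul_apply, covEnd_apply A hE hu hs, covEnd_apply A hE hu hs]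
  simp only [map_smul, ← Complex.coe_smul, smul_sub]

theorem covEnd_isLinearMap (u : Form0 E) (hE : IsSmoothHermitian E F) (hu : EndCnAt F ∞ u x) :
    IsLinearMap ℝ (covEnd A u x) :=
  ⟨covEnd_add_vec A u hE hu, covEnd_smul_vec A u hE hu⟩

theorem covEnd_add (hE : IsSmoothHermitian E F) {u v : Form0 E} (hu : EndCnAt F ∞ u x)
    (hv : EndCnAt F ∞ v x) (w : Tan x) :
    covEnd A (fun y ↦ u y + v y) x w = covEnd A u x w + covEnd A v x w := by
  refine end_ext (F := F) fun s hs ↦ ?_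
  rw [LinearMap.add_apply, covEnd_apply A hE hu hs, covEnd_apply A hE hv hs,
    covEnd_apply A hE (hu.add hv) hs]
  simp only [LinearMap.add_apply]
  rw [A.cov_add (hu s hs) (hv s hs), _root_.add_apply]
  abel

theorem covEnd_mul (hE : IsSmoothHermitian E F) {u v : Form0 E} (hu : EndCnAt F ∞ u x)
    (hv : EndCnAt F ∞ v x) (w : Tan x) :
    covEnd A (fun y ↦ u y * v y) x w = covEnd A u x w * v x + u x * covEnd A v x w := by
  refine end_ext (F := F) fun s hs ↦ ?_
  rw [LinearMap.add_apply, Module.End.mul_apply, Module.End.mul_apply,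
    covEnd_apply A hE (hu.mul hv) hs, covEnd_apply A hE hv hs, covEnd_apply A hE hu (hv s hs)]
  simp only [Module.End.mul_apply, map_sub]
  abel

theorem covEnd_smul (hE : IsSmoothHermitian E F) {f : X → ℂ} {u : Form0 E}
    (hf : ContMDiffAt 𝓘(ℝ, ℂ) 𝓘(ℝ, ℂ) ∞ f x) (hu : EndCnAt F ∞ u x) (w : Tan x) :
    covEnd A (fun y ↦ f y • u y) x w =
      f x • covEnd A u x w + mvfderiv 𝓘(ℝ, ℂ) f x w • u x := by
  refine end_ext (F := F) fun s hs ↦ ?_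
  rw [LinearMap.add_apply, LinearMap.smul_apply, LinearMap.smul_apply,
    covEnd_apply A hE (hu.smul hf) hs, covEnd_apply A hE hu hs]
  simp only [LinearMap.smul_apply]
  rw [A.cov_smul hf (hu s hs), smul_sub]
  abel

theorem covEnd_const_smul (hE : IsSmoothHermitian E F) (c : ℂ) {u : Form0 E}
    (hu : EndCnAt F ∞ u x) (w : Tan x) :
    covEnd A (fun y ↦ c • u y) x w = c • covEnd A u x w := by
  rw [covEnd_smul A hE (f := fun _ ↦ c) contMDiffAt_const hu, mvfderiv_const, _root_.zero_apply,
    zero_smul, add_zero]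

theorem covEnd_neg (hE : IsSmoothHermitian E F) {u : Form0 E}
    (hu : EndCnAt F ∞ u x) (w : Tan x) :
    covEnd A (fun y ↦ -u y) x w = -covEnd A u x w := by
  have h := covEnd_const_smul A hE (-1) hu w
  simpa only [neg_one_smul] using h

theorem covEnd_sub (hE : IsSmoothHermitian E F) {u v : Form0 E} (hu : EndCnAt F ∞ u x)
    (hv : EndCnAt F ∞ v x) (w : Tan x) :
    covEnd A (fun y ↦ u y - v y) x w = covEnd A u x w - covEnd A v x w := by
  simp only [sub_eq_add_neg]
  rw [covEnd_add A hE hu hv.neg, covEnd_neg A hE hv]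

theorem covEnd_lie (hE : IsSmoothHermitian E F) {u v : Form0 E} (hu : EndCnAt F ∞ u x)
    (hv : EndCnAt F ∞ v x) (w : Tan x) :
    covEnd A (fun y ↦ ⁅u y, v y⁆) x w = ⁅covEnd A u x w, v x⁆ + ⁅u x, covEnd A v x w⁆ := by
  simp only [Ring.lie_def]
  rw [covEnd_sub A hE (hu.mul hv) (hv.mul hu), covEnd_mul A hE hu hv, covEnd_mul A hE hv hu]
  abel

/-- Differentiate `⟨u^* s, t⟩ = ⟨s, u t⟩` on both sides with the unitarity of the connection. -/
theorem covEnd_adjoint (hE : IsSmoothHermitian E F) {u : Form0 E} (hu : EndCnAt F ∞ u x)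
    (w : Tan x) :
    covEnd A (fun y ↦ LinearMap.adjoint (u y)) x w = LinearMap.adjoint (covEnd A u x w) := by
  have hu' := hu.adjoint hE le_rfl
  refine end_ext (F := F) fun s hs ↦ ext_inner_right ℂ fun e ↦ ?_
  have ht := secCnAt_extend (F := F) (n := ∞) e
  set t := FiberBundle.extend F e with htdef
  have hte : t x = e := FiberBundle.extend_apply_self F e
  rw [← hte, covEnd_apply A hE hu' hs, LinearMap.adjoint_inner_left, covEnd_apply A hE hu ht,
    inner_sub_left, inner_sub_right, LinearMap.adjoint_inner_left]
  have h1 := A.unitary _ t x (hu' s hs).secDiffAt ht.secDiffAt w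
  have h2 := A.unitary s _ x hs.secDiffAt (hu t ht).secDiffAt w
  simp only [LinearMap.adjoint_inner_left] at h1
  rw [h1] at h2
  linear_combination h2

theorem endCnAt_covEnd (hE : IsSmoothHermitian E F) {u : Form0 E} {V : ∀ x : X, Tan x}
    (hu : ∀ᶠ y in 𝓝 x, EndCnAt F ∞ u y) (hV : FieldCnAt ∞ V x) :
    EndCnAt F ∞ (fun y ↦ covEnd A u y (V y)) x := by
  obtain ⟨U, hx, m, e, he⟩ := exists_isFrame hE x
  have heU (j : Fin m) : ∀ᶠ y in 𝓝 x, SecCnAt F ∞ (e j) y := by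
    filter_upwards [he.isOpen.mem_nhds hx] with y hy using he.smooth y hy j
  refine he.endCnAt hx hE le_rfl fun i j ↦ (he.smooth x hx i).inner hE le_rfl ?_
  have h1 : SecCnAt F ∞ (fun y ↦ A.cov (fun z ↦ u z (e j z)) y (V y) -
      u y (A.cov (e j) y (V y))) x := by
    refine (A.secCnAt_cov ?_ hV).sub (hu.self_of_nhds _ (A.secCnAt_cov (heU j) hV))
    filter_upwards [hu, heU j] with y h1 h2 using h1 _ h2
  refine h1.congr ?_
  filter_upwards [hu, heU j] with y h1 h2
  exact covEnd_apply A hE h1 h2 (V y)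

theorem mvfderiv_add_fun {f h : X → ℂ} (hf : ContMDiffAt 𝓘(ℝ, ℂ) 𝓘(ℝ, ℂ) ∞ f x)
    (hh : ContMDiffAt 𝓘(ℝ, ℂ) 𝓘(ℝ, ℂ) ∞ h x) (v : Tan x) :
    mvfderiv 𝓘(ℝ, ℂ) (fun y ↦ f y + h y) x v =
      mvfderiv 𝓘(ℝ, ℂ) f x v + mvfderiv 𝓘(ℝ, ℂ) h x v := by
  rw [mvfderiv_fun_add (hf.mdifferentiableAt (by simp)) (hh.mdifferentiableAt (by simp))]
  rfl

theorem mvfderiv_sum_fun {ι : Type*} (S : Finset ι) {f : ι → X → ℂ}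
    (hf : ∀ i, ContMDiffAt 𝓘(ℝ, ℂ) 𝓘(ℝ, ℂ) ∞ (f i) x) (v : Tan x) :
    mvfderiv 𝓘(ℝ, ℂ) (fun y ↦ ∑ i ∈ S, f i y) x v = ∑ i ∈ S, mvfderiv 𝓘(ℝ, ℂ) (f i) x v := by
  classical
  induction S using Finset.induction_on with
  | empty =>
    simp only [Finset.sum_empty]
    rw [mvfderiv_const, _root_.zero_apply]
  | insert a S haS ih =>
    simp only [Finset.sum_insert haS]
    rw [mvfderiv_add_fun (hf a) (contMDiffAt_finsetSum fun i _ ↦ hf i), ih]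

/-- In an orthonormal frame the connection matrix is skew-adjoint, so it contributes only the trace
of a commutator. -/
theorem mvfderiv_trace (hE : IsSmoothHermitian E F) {u : Form0 E} (hu : EndCnAt F ∞ u x)
    (w : Tan x) :
    mvfderiv 𝓘(ℝ, ℂ) (fun y ↦ LinearMap.trace ℂ (E y) (u y)) x w =
      LinearMap.trace ℂ (E x) (covEnd A u x w) := by
  obtain ⟨U, hx, m, e, he⟩ := exists_isFrame hE x
  obtain ⟨b, hb⟩ := he.basis x hx
  have hs (i) := he.smooth x hx i
  have h1 : (fun y ↦ LinearMap.trace ℂ (E y) (u y)) =ᶠ[𝓝 x]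
      fun y ↦ ∑ i, ⟪e i y, u y (e i y)⟫_ℂ := by
    filter_upwards [he.isOpen.mem_nhds hx] with y hy
    obtain ⟨b, hb⟩ := he.basis y hy
    simp only [LinearMap.trace_eq_sum_inner _ b, hb]
  rw [mvfderiv_congr h1,
    mvfderiv_sum_fun (f := fun i y ↦ ⟪e i y, u y (e i y)⟫_ℂ) _
      fun i ↦ (hs i).inner hE le_rfl (hu _ (hs i))]
  have h2 (i) : mvfderiv 𝓘(ℝ, ℂ) (fun y ↦ ⟪e i y, u y (e i y)⟫_ℂ) x w =
      ⟪A.cov (e i) x w, u x (e i x)⟫_ℂ + ⟪e i x, u x (A.cov (e i) x w)⟫_ℂ +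
        ⟪e i x, covEnd A u x w (e i x)⟫_ℂ := by
    rw [A.unitary _ _ x (hs i).secDiffAt (hu _ (hs i)).secDiffAt w, covEnd_apply A hE hu (hs i),
      inner_sub_right]
    ring
  simp only [h2, Finset.sum_add_distrib]
  -- The connection matrix at `x`. It is skew-adjoint because the inner products `⟨e_j, e_i⟩` are
  -- locally constant.
  let T : Module.End ℂ (E x) := b.toBasis.constr ℂ fun i ↦ A.cov (e i) x w
  have hT (i) : T (b i) = A.cov (e i) x w := by
    have := b.toBasis.constr_basis ℂ (fun i ↦ A.cov (e i) x w) i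
    rwa [OrthonormalBasis.coe_toBasis] at this
  have hskew : LinearMap.adjoint T = -T := by
    refine b.toBasis.ext fun i ↦ b.repr.injective ?_
    ext j
    rw [b.repr_apply_apply, b.repr_apply_apply]
    simp only [OrthonormalBasis.coe_toBasis, LinearMap.neg_apply, inner_neg_right]
    rw [LinearMap.adjoint_inner_right, hT, hT, hb, hb]
    have h3 := A.unitary _ _ x (hs j).secDiffAt (hs i).secDiffAt w
    have h4 : (fun y ↦ ⟪e j y, e i y⟫_ℂ) =ᶠ[𝓝 x] fun _ ↦ if j = i then 1 else 0 := by
      filter_upwards [he.isOpen.mem_nhds hx] with y hy using he.inner_eq hy j i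
    rw [mvfderiv_congr h4, mvfderiv_const, _root_.zero_apply] at h3
    linear_combination -h3
  have h5 : ∑ i, ⟪A.cov (e i) x w, u x (e i x)⟫_ℂ + ∑ i, ⟪e i x, u x (A.cov (e i) x w)⟫_ℂ = 0 := by
    simp only [← hT, ← hb, ← LinearMap.adjoint_inner_right T, hskew, LinearMap.neg_apply,
      inner_neg_right, Finset.sum_neg_distrib]
    have h6 := LinearMap.trace_eq_sum_inner (T * u x) b
    have h7 := LinearMap.trace_eq_sum_inner (u x * T) b
    simp only [Module.End.mul_apply] at h6 h7
    rw [← h6, ← h7, LinearMap.trace_mul_comm]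
    ring
  rw [h5, zero_add, LinearMap.trace_eq_sum_inner _ b]
  simp only [hb]

theorem mvfderiv_hs (hE : IsSmoothHermitian E F) {u v : Form0 E} (hu : EndCnAt F ∞ u x)
    (hv : EndCnAt F ∞ v x) (w : Tan x) :
    mvfderiv 𝓘(ℝ, ℂ) (fun y ↦ hs (u y) (v y)) x w =
      hs (covEnd A u x w) (v x) + hs (u x) (covEnd A v x w) := by
  have hv' := hv.adjoint hE le_rfl
  have h := mvfderiv_trace A hE (hu.mul hv') w
  rw [covEnd_mul A hE hu hv', covEnd_adjoint A hE hv, map_add] at h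
  exact h

end CovariantEnd

/-! ### Holomorphic coordinate changes and coordinate vector fields. -/

section HolomorphicCharts

variable {X : Type*} [TopologicalSpace X] [ChartedSpace ℂ X] [IsManifold 𝓘(ℂ) ω X]
  [IsManifold 𝓘(ℝ, ℂ) ∞ X]

/-- Coordinate changes of the tangent bundle are complex linear. -/
theorem tangentCoordChange_I {x y z : X} (hx : z ∈ (chartAt ℂ x).source)
    (hy : z ∈ (chartAt ℂ y).source) (c : ℂ) :
    tangentCoordChange 𝓘(ℝ, ℂ) x y z (Complex.I * c) =
      Complex.I * tangentCoordChange 𝓘(ℝ, ℂ) x y z c := by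
  -- The holomorphic atlas makes the transition map complex differentiable; the real coordinate
  -- change is its derivative with scalars restricted to the reals.
  have h := ModelWithCorners.contDiffWithinAt_extendCoordChange' (I := 𝓘(ℂ)) (n := ω)
    (IsManifold.subset_maximalAtlas (chart_mem_atlas ℂ x))
    (IsManifold.subset_maximalAtlas (chart_mem_atlas ℂ y)) hx hy
  have hd : DifferentiableAt ℂ (chartAt ℂ y ∘ (chartAt ℂ x).symm) (chartAt ℂ x z) := by
    have h2 := h.differentiableWithinAt (by simp)
    simp only [mfld_simps] at h2
    exact differentiableWithinAt_univ.mp h2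
  have hr := hd.hasFDerivAt.restrictScalars ℝ
  have e : tangentCoordChange 𝓘(ℝ, ℂ) x y z =
      (fderiv ℂ (chartAt ℂ y ∘ (chartAt ℂ x).symm) (chartAt ℂ x z)).restrictScalars ℝ := by
    rw [tangentCoordChange_def]
    simp only [mfld_simps, fderivWithin_univ]
    exact hr.fderiv
  rw [e]
  exact (fderiv ℂ (chartAt ℂ y ∘ (chartAt ℂ x).symm) (chartAt ℂ x z)).map_smul Complex.I c

theorem extendTan_apply {x y : X} (hy : y ∈ (chartAt ℂ x).source) (c : ℂ) :
    extendTan (tanOf x c) y = tangentCoordChange 𝓘(ℝ, ℂ) x y y c := by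
  have h := TangentBundle.symmL_trivializationAt_eq_core (I := 𝓘(ℝ, ℂ)) hy
  have h2 : (trivializationAt ℂ (TangentSpace 𝓘(ℝ, ℂ)) x ⟨x, tanOf x c⟩).2 = c := by
    exact tangentCoordChange_self (I := 𝓘(ℝ, ℂ)) (x := x) (z := x) (mem_extChartAt_source x)
  rw [extendTan, FiberBundle.extend, h2]
  have hy' : y ∈ (trivializationAt ℂ (fun y : X ↦ TangentSpace 𝓘(ℝ, ℂ) y) x).baseSet := hy
  exact (Trivialization.symmL_apply _ hy' c).symm.trans
    (congrArg (fun L : ℂ →L[ℝ] ℂ ↦ L c) h)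

/-- Consequently the two coordinate fields of a chart form a frame `(v, Jv)` at every point of its
domain, which is what the conformal formulas require. -/
theorem J_extendTan {x y : X} (hy : y ∈ (chartAt ℂ x).source) (v : Tan x) :
    extendTan (J x v) y = J y (extendTan v y) := by
  let c : ℂ := v
  have h1 := extendTan_apply hy (Complex.I * c)
  have h2 := extendTan_apply hy c
  rw [tangentCoordChange_I (mem_chart_source ℂ x |> fun _ ↦ hy) (mem_chart_source ℂ y)] at h1
  exact h1.trans (congrArg (J y) h2.symm)

theorem extendTan_ne_zero {x y : X} (hy : y ∈ (chartAt ℂ x).source) {v : Tan x} (hv : v ≠ 0) :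
    extendTan v y ≠ 0 := by
  let c : ℂ := v
  have h2 := extendTan_apply hy c
  intro h0
  have h3 : tangentCoordChange 𝓘(ℝ, ℂ) x y y c = 0 := h2.symm.trans h0
  have h4 := tangentCoordChange_comp (I := 𝓘(ℝ, ℂ)) (w := x) (x := y) (y := x) (z := y) (v := c)
    (by simpa using hy)
  rw [h3, map_zero, tangentCoordChange_self (by simpa using hy)] at h4
  exact hv h4.symm

theorem fieldCnAt_extendTan {x y : X} (hy : y ∈ (chartAt ℂ x).source) (v : Tan x) (n : ℕ∞ω)
    (hn : n ≤ (∞ : ℕ∞ω)) : FieldCnAt n (extendTan v) y := by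
  refine ContMDiffAt.of_le ?_ hn
  rw [(trivializationAt ℂ (TangentSpace 𝓘(ℝ, ℂ)) x).contMDiffAt_section_iff hy]
  refine (contMDiffAt_const (c := (trivializationAt ℂ
    (fun y : X ↦ TangentSpace 𝓘(ℝ, ℂ) y) x ⟨x, v⟩).2)).congr_of_eventuallyEq ?_
  filter_upwards [(chartAt ℂ x).open_source.mem_nhds hy] with z hz
  have hz' : z ∈ (trivializationAt ℂ (fun y : X ↦ TangentSpace 𝓘(ℝ, ℂ) y) x).baseSet := hz
  simp only [extendTan, FiberBundle.extend]
  rw [(trivializationAt ℂ (fun y : X ↦ TangentSpace 𝓘(ℝ, ℂ) y) x).apply_mk_symm hz']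

theorem fieldCnAt_J {V : ∀ x : X, Tan x} {x : X} {n : ℕ∞ω} (hn : n ≤ (∞ : ℕ∞ω))
    (hV : FieldCnAt n V x) : FieldCnAt n (fun y ↦ J y (V y)) x := by
  have : ContMDiffVectorBundle n ℂ (fun x : X ↦ TangentSpace 𝓘(ℝ, ℂ) x) 𝓘(ℝ, ℂ) :=
    ContMDiffVectorBundle.of_le hn
  rw [FieldCnAt, contMDiffAt_section] at hV ⊢
  have hI : ContMDiff 𝓘(ℝ, ℂ) 𝓘(ℝ, ℂ) n (fun z : ℂ ↦ Complex.I * z) :=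
    (contDiff_const.mul contDiff_id).contMDiff
  refine (hI.contMDiffAt.comp x hV).congr_of_eventuallyEq ?_
  filter_upwards [(chartAt ℂ x).open_source.mem_nhds (mem_chart_source ℂ x)] with y hy
  exact tangentCoordChange_I (mem_chart_source ℂ y) hy (V y)

/-- A vector field is a combination of the coordinate fields with coefficients of the same
regularity. -/
theorem exists_field_eq {V : ∀ x : X, Tan x} {x : X} {n : ℕ∞ω} (hn : n ≤ (∞ : ℕ∞ω))
    (hV : FieldCnAt n V x) : ∃ p q : X → ℝ, ContMDiffAt 𝓘(ℝ, ℂ) 𝓘(ℝ, ℝ) n p x ∧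
      ContMDiffAt 𝓘(ℝ, ℂ) 𝓘(ℝ, ℝ) n q x ∧ ∀ᶠ y in 𝓝 x,
        V y = p y • extendTan (tanOf x 1) y + q y • extendTan (tanOf x Complex.I) y := by
  have : ContMDiffVectorBundle n ℂ (fun x : X ↦ TangentSpace 𝓘(ℝ, ℂ) x) 𝓘(ℝ, ℂ) :=
    ContMDiffVectorBundle.of_le hn
  rw [FieldCnAt, contMDiffAt_section] at hV
  let c (y : X) : ℂ := tangentCoordChange 𝓘(ℝ, ℂ) y x y (V y)
  have hc : ContMDiffAt 𝓘(ℝ, ℂ) 𝓘(ℝ, ℂ) n c x := hV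
  refine ⟨fun y ↦ (c y).re, fun y ↦ (c y).im,
    Complex.reCLM.contDiff.contMDiff.contMDiffAt.comp x hc,
    Complex.imCLM.contDiff.contMDiff.contMDiffAt.comp x hc, ?_⟩
  filter_upwards [(chartAt ℂ x).open_source.mem_nhds (mem_chart_source ℂ x)] with y hy
  have h1 : tangentCoordChange 𝓘(ℝ, ℂ) x y y (c y) = V y := by
    have h := tangentCoordChange_comp (I := 𝓘(ℝ, ℂ)) (w := y) (x := x) (y := y) (z := y)
      (v := V y) (by simpa using hy)
    exact h.trans (tangentCoordChange_self (I := 𝓘(ℝ, ℂ)) (x := y) (z := y)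
      (mem_extChartAt_source y))
  have h2 : c y = (c y).re • (1 : ℂ) + (c y).im • Complex.I := by simp
  rw [← h1, extendTan_apply hy, extendTan_apply hy]
  conv_lhs => rw [h2, map_add, map_smul, map_smul]
  rfl

/-- In the chart at `x` the two fields become constant, and constant fields commute. The bracket
terms of `extCov` and `curvature` therefore disappear. -/
theorem mlieBracket_extendTan (x : X) (v w : Tan x) :
    mlieBracket 𝓘(ℝ, ℂ) (extendTan v) (extendTan w) x = 0 := by
  have key (v : Tan x) : mpullbackWithin 𝓘(ℝ, ℂ) 𝓘(ℝ, ℂ) (extChartAt 𝓘(ℝ, ℂ) x).symm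
      (extendTan v) (Set.range 𝓘(ℝ, ℂ)) =ᶠ[𝓝 (extChartAt 𝓘(ℝ, ℂ) x x)] fun _ ↦ (v : ℂ) := by
    have ht : (extChartAt 𝓘(ℝ, ℂ) x).target ∈ 𝓝 (extChartAt 𝓘(ℝ, ℂ) x x) :=
      extChartAt_target_mem_nhds x
    filter_upwards [ht] with z hz
    have hy : (extChartAt 𝓘(ℝ, ℂ) x).symm z ∈ (chartAt ℂ x).source := by
      simpa using (extChartAt 𝓘(ℝ, ℂ) x).map_target hz
    have hs := TangentBundle.symmL_trivializationAt (I := 𝓘(ℝ, ℂ)) hy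
    rw [(extChartAt 𝓘(ℝ, ℂ) x).right_inv hz] at hs
    have hv : extendTan v ((extChartAt 𝓘(ℝ, ℂ) x).symm z) =
        mfderivWithin 𝓘(ℝ, ℂ) 𝓘(ℝ, ℂ) (extChartAt 𝓘(ℝ, ℂ) x).symm (Set.range 𝓘(ℝ, ℂ)) z v := by
      have e1 := extendTan_apply hy (v : ℂ)
      have e2 := TangentBundle.symmL_trivializationAt_eq_core (I := 𝓘(ℝ, ℂ)) hy
      rw [hs] at e2
      exact e1.trans (congrArg (fun L : ℂ →L[ℝ] ℂ ↦ L (v : ℂ)) e2).symm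
    rw [mpullbackWithin_apply, hv]
    have hinv := isInvertible_mfderivWithin_extChartAt_symm (I := 𝓘(ℝ, ℂ)) hz
    exact hinv.inverse_apply_eq.mpr rfl
  have h0 : ∀ (a b : ℂ) (V W : ℂ → ℂ), V =ᶠ[𝓝 (extChartAt 𝓘(ℝ, ℂ) x x)] (fun _ ↦ a) →
      W =ᶠ[𝓝 (extChartAt 𝓘(ℝ, ℂ) x x)] (fun _ ↦ b) →
      lieBracketWithin ℝ V W
        ((extChartAt 𝓘(ℝ, ℂ) x).symm ⁻¹' Set.univ ∩ Set.range 𝓘(ℝ, ℂ))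
        (extChartAt 𝓘(ℝ, ℂ) x x) = 0 := by
    intro a b V W hV hW
    rw [Set.preimage_univ, Set.univ_inter, ModelWithCorners.range_eq_univ, lieBracketWithin_univ,
      Filter.EventuallyEq.lieBracket_vectorField_eq hV hW]
    simp [VectorField.lieBracket]
  rw [mlieBracket, mlieBracketWithin_apply]
  exact (congrArg _ (h0 _ _ _ _ (key v) (key w))).trans (map_zero _)

/-- Coordinate fields extend to global smooth fields. -/
theorem exists_smoothField_eq [T2Space X] (x : X) (v : Tan x) :
    ∃ V : ∀ y : X, Tan y, IsSmoothField V ∧ ∀ᶠ y in 𝓝 x, V y = extendTan v y := by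
  let f : SmoothBumpFunction 𝓘(ℝ, ℂ) x := Classical.arbitrary _
  refine ⟨fun y ↦ f y • extendTan v y, ?_, ?_⟩
  · refine ContMDiffOn.smul_section_of_tsupport (V := fun y : X ↦ TangentSpace 𝓘(ℝ, ℂ) y)
      (s := extendTan v) f.contMDiff.contMDiffOn
      (chartAt ℂ x).open_source f.tsupport_subset_chartAt_source fun y hy ↦ ?_
    exact ContMDiffAt.contMDiffWithinAt (fieldCnAt_extendTan hy v ∞ le_rfl)
  · filter_upwards [f.eventuallyEq_one] with y hy
    simp [hy]

end HolomorphicCharts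

/-! ### Commutator identities for endomorphisms. -/

section EndLie

variable {M : Type*} [AddCommGroup M] [Module ℂ M] (u v w : Module.End ℂ M)

theorem end_lie_add : ⁅u, v + w⁆ = ⁅u, v⁆ + ⁅u, w⁆ := by
  simp only [Ring.lie_def, mul_add, add_mul]; abel

theorem end_add_lie : ⁅u + v, w⁆ = ⁅u, w⁆ + ⁅v, w⁆ := by
  simp only [Ring.lie_def, mul_add, add_mul]; abel

theorem end_lie_smul (c : ℂ) : ⁅u, c • v⁆ = c • ⁅u, v⁆ := by
  simp only [Ring.lie_def, mul_smul_comm, smul_mul_assoc, smul_sub]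

theorem end_smul_lie (c : ℂ) : ⁅c • u, v⁆ = c • ⁅u, v⁆ := by
  simp only [Ring.lie_def, mul_smul_comm, smul_mul_assoc, smul_sub]

theorem end_lie_neg : ⁅u, -v⁆ = -⁅u, v⁆ := by
  simp only [Ring.lie_def, mul_neg, neg_mul]; abel

theorem end_neg_lie : ⁅-u, v⁆ = -⁅u, v⁆ := by
  simp only [Ring.lie_def, mul_neg, neg_mul]; abel

theorem end_lie_skew : -⁅u, v⁆ = ⁅v, u⁆ := by
  simp only [Ring.lie_def]; abel

end EndLie

/-! ### Regularity of `End E`-valued forms. -/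

section FormRegularity

variable {X : Type*} [TopologicalSpace X] [ChartedSpace ℂ X] [IsManifold 𝓘(ℂ) ω X]
  [IsManifold 𝓘(ℝ, ℂ) ∞ X]
  {F : Type*} [NormedAddCommGroup F] [NormedSpace ℂ F] [FiniteDimensional ℂ F]
  {E : X → Type*} [TopologicalSpace (TotalSpace F E)]
  [∀ x, NormedAddCommGroup (E x)] [∀ x, InnerProductSpace ℂ (E x)]
  [∀ x, FiniteDimensional ℂ (E x)]
  [FiberBundle F E] [VectorBundle ℝ F E] [VectorBundle ℂ F E]
  [ContMDiffVectorBundle ∞ F E 𝓘(ℝ, ℂ)] {n : ℕ∞ω}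

theorem EndCnAt.of_le {x : X} (hE : IsSmoothHermitian E F) (hn : n ≤ (∞ : ℕ∞ω)) {u : Form0 E}
    (hu : EndCnAt F ∞ u x) : EndCnAt F n u x := by
  obtain ⟨U, hx, m, e, he⟩ := exists_isFrame hE x
  exact he.endCnAt hx hE hn fun i j ↦ ContMDiffAt.of_le (he.matrix hx hE le_rfl hu i j) hn

theorem EndCnAt.real_smul {x : X} {f : X → ℝ} {u : Form0 E}
    (hf : ContMDiffAt 𝓘(ℝ, ℂ) 𝓘(ℝ, ℝ) n f x) (hu : EndCnAt F n u x) :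
    EndCnAt F n (fun y ↦ f y • u y) x := by
  refine (hu.smul (f := fun y ↦ (f y : ℂ))
    (Complex.ofRealCLM.contDiff.contMDiff.contMDiffAt.comp x hf)).congr ?_
  exact Eventually.of_forall fun y ↦ (Complex.coe_smul (f y) (u y)).symm

theorem IsForm1.endCnAt {a : Form1 E} (ha : IsForm1 F n a) {V : ∀ x : X, Tan x} {x : X}
    (hV : FieldCnAt n V x) : EndCnAt F n (fun y ↦ a y (V y)) x :=
  fun s hs ↦ ha.2 V s x hV hs

theorem IsForm2.endCnAt {σ : Form2 E} (hσ : IsForm2 F n σ) {V W : ∀ x : X, Tan x} {x : X}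
    (hV : FieldCnAt n V x) (hW : FieldCnAt n W x) : EndCnAt F n (fun y ↦ σ y (V y) (W y)) x :=
  fun s hs ↦ hσ.2.2 V W s x hV hW hs

theorem IsForm1.endCnAt_extend {a : Form1 E} (ha : IsForm1 F n a) (hn : n ≤ (∞ : ℕ∞ω)) {x y : X}
    (hy : y ∈ (chartAt ℂ x).source) (v : Tan x) :
    EndCnAt F n (fun y ↦ a y (extendTan v y)) y :=
  ha.endCnAt (fieldCnAt_extendTan hy v n hn)

theorem isForm1_of_field {a : Form1 E} (hl : ∀ x, IsLinearMap ℝ (a x))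
    (h : ∀ (V : ∀ x : X, Tan x) (x : X), FieldCnAt n V x → EndCnAt F n (fun y ↦ a y (V y)) x) :
    IsForm1 F n a :=
  ⟨hl, fun V s x hV hs ↦ h V x hV s hs⟩

/-- It suffices to test the regularity of a 1-form on coordinate fields. -/
theorem isForm1_of_coord {a : Form1 E} (hn : n ≤ (∞ : ℕ∞ω)) (hl : ∀ x, IsLinearMap ℝ (a x))
    (h : ∀ (x : X) (v : Tan x), EndCnAt F n (fun y ↦ a y (extendTan v y)) x) :
    IsForm1 F n a := by
  refine isForm1_of_field hl fun V x hV ↦ ?_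
  obtain ⟨p, q, hp, hq, hpq⟩ := exists_field_eq hn hV
  refine (((h x (tanOf x 1)).real_smul hp).add
    ((h x (tanOf x Complex.I)).real_smul hq)).congr ?_
  filter_upwards [hpq] with y hy
  rw [hy, (hl y).map_add, (hl y).map_smul, (hl y).map_smul]

theorem IsForm2.isLinearMap_left {σ : Form2 E} (hσ : IsForm2 F n σ) (x : X) (w : Tan x) :
    IsLinearMap ℝ (fun v ↦ σ x v w) := by
  constructor
  · intro u v
    rw [hσ.2.1, (hσ.1 x w).map_add, hσ.2.1 x u w, hσ.2.1 x v w]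
    abel
  · intro c v
    rw [hσ.2.1, (hσ.1 x w).map_smul, hσ.2.1 x v w, smul_neg]

theorem alternating_self {x : X} {σ : Tan x → Tan x → Module.End ℂ (E x)}
    (h : ∀ v w, σ v w = -σ w v) (v : Tan x) : σ v v = 0 := by
  have h1 := h v v
  have h2 : (2 : ℂ) • σ v v = 0 := by rw [two_smul]; nth_rewrite 1 [h1]; simp
  simpa using h2

theorem isForm2_of_coord {σ : Form2 E} (hn : n ≤ (∞ : ℕ∞ω)) (hl : ∀ x v, IsLinearMap ℝ (σ x v))
    (ha : ∀ x v w, σ x v w = -σ x w v)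
    (h : ∀ (x : X) (v w : Tan x), EndCnAt F n (fun y ↦ σ y (extendTan v y) (extendTan w y)) x) :
    IsForm2 F n σ := by
  have hl' (x) (w : Tan x) : IsLinearMap ℝ (fun v ↦ σ x v w) := by
    constructor
    · intro u v
      rw [ha, (hl x w).map_add, ha x u w, ha x v w]
      abel
    · intro c v
      rw [ha, (hl x w).map_smul, ha x v w, smul_neg]
  refine ⟨hl, ha, fun V W s x hV hW hs ↦ ?_⟩
  obtain ⟨p, q, hp, hq, hpq⟩ := exists_field_eq hn hV
  obtain ⟨p', q', hp', hq', hpq'⟩ := exists_field_eq hn hW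
  have h0 := h x (tanOf x 1) (tanOf x Complex.I)
  -- With `V = p∂_s + q∂_t` and `W = p'∂_s + q'∂_t`, an alternating form takes the value `(pq' -
  -- qp') σ(∂_s, ∂_t)`.
  refine (((h0.real_smul hq').real_smul hp).sub ((h0.real_smul hp').real_smul hq)).congr ?_ s hs
  filter_upwards [hpq, hpq'] with y hy hy'
  have e1 := alternating_self (ha y) (extendTan (tanOf x 1) y)
  have e2 := alternating_self (ha y) (extendTan (tanOf x Complex.I) y)
  rw [hy, hy', (hl' y _).map_add, (hl' y _).map_smul, (hl' y _).map_smul, (hl y _).map_add,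
    (hl y _).map_add, (hl y _).map_smul, (hl y _).map_smul, (hl y _).map_smul, (hl y _).map_smul,
    e1, e2, ha y (extendTan (tanOf x Complex.I) y)]
  module

theorem IsForm1.of_le (hE : IsSmoothHermitian E F) (hn : n ≤ (∞ : ℕ∞ω)) {a : Form1 E}
    (ha : IsForm1 F ∞ a) : IsForm1 F n a :=
  isForm1_of_coord hn ha.1 fun x v ↦
    (ha.endCnAt_extend le_rfl (mem_chart_source ℂ x) v).of_le hE hn

theorem IsForm2.of_le (hE : IsSmoothHermitian E F) (hn : n ≤ (∞ : ℕ∞ω)) {σ : Form2 E}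
    (hσ : IsForm2 F ∞ σ) : IsForm2 F n σ :=
  isForm2_of_coord hn hσ.1 hσ.2.1 fun x v w ↦
    (hσ.endCnAt (fieldCnAt_extendTan (mem_chart_source ℂ x) v _ le_rfl)
      (fieldCnAt_extendTan (mem_chart_source ℂ x) w _ le_rfl)).of_le hE hn

namespace IsForm1

variable {a b : Form1 E}

theorem zero : IsForm1 F n (0 : Form1 E) :=
  isForm1_of_field (fun x ↦ ⟨fun _ _ ↦ (add_zero _).symm, fun _ _ ↦ (smul_zero _).symm⟩)
    fun _ _ _ ↦ EndCnAt.zero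

theorem add (ha : IsForm1 F n a) (hb : IsForm1 F n b) : IsForm1 F n (a + b) := by
  refine isForm1_of_field (fun x ↦ ⟨fun v w ↦ ?_, fun c v ↦ ?_⟩) fun V x hV ↦
    (ha.endCnAt hV).add (hb.endCnAt hV)
  · simp only [Pi.add_apply, (ha.1 x).map_add, (hb.1 x).map_add]; abel
  · simp only [Pi.add_apply, (ha.1 x).map_smul, (hb.1 x).map_smul, smul_add]

theorem smul_fun {f : X → ℂ} (hf : ∀ x, ContMDiffAt 𝓘(ℝ, ℂ) 𝓘(ℝ, ℂ) n f x)
    (ha : IsForm1 F n a) : IsForm1 F n (fun x v ↦ f x • a x v) := by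
  refine isForm1_of_field (fun x ↦ ⟨fun v w ↦ ?_, fun c v ↦ ?_⟩) fun V x hV ↦
    (ha.endCnAt hV).smul (hf x)
  · simp only [(ha.1 x).map_add, smul_add]
  · rw [(ha.1 x).map_smul, smul_comm]

theorem const_smul (c : ℂ) (ha : IsForm1 F n a) : IsForm1 F n (c • a) :=
  ha.smul_fun (f := fun _ ↦ c) fun _ ↦ contMDiffAt_const

theorem neg (ha : IsForm1 F n a) : IsForm1 F n (-a) := by
  have := ha.const_smul (-1)
  rwa [neg_one_smul] at this

theorem sub (ha : IsForm1 F n a) (hb : IsForm1 F n b) : IsForm1 F n (a - b) := by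
  rw [sub_eq_add_neg]; exact ha.add hb.neg

theorem sum {ι : Type*} {S : Finset ι} {c : ι → Form1 E} (hc : ∀ i ∈ S, IsForm1 F n (c i)) :
    IsForm1 F n (∑ i ∈ S, c i) := by
  classical
  induction S using Finset.induction_on with
  | empty => simpa using zero
  | insert i S hi ih =>
    rw [Finset.sum_insert hi]
    exact (hc i (Finset.mem_insert_self i S)).add
      (ih fun j hj ↦ hc j (Finset.mem_insert_of_mem hj))

theorem comp_J (hn : n ≤ (∞ : ℕ∞ω)) (ha : IsForm1 F n a) : IsForm1 F n (fun x v ↦ a x (J x v)) :=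
  isForm1_of_field (fun x ↦ ⟨fun v w ↦ by rw [J_add, (ha.1 x).map_add],
    fun c v ↦ by rw [J_smul, (ha.1 x).map_smul]⟩) fun V x hV ↦ ha.endCnAt (fieldCnAt_J hn hV)

theorem part10 (hn : n ≤ (∞ : ℕ∞ω)) (ha : IsForm1 F n a) : IsForm1 F n (part10 a) :=
  (ha.sub ((ha.comp_J hn).const_smul Complex.I)).const_smul (1 / 2)

theorem part01 (hn : n ≤ (∞ : ℕ∞ω)) (ha : IsForm1 F n a) : IsForm1 F n (part01 a) :=
  (ha.add ((ha.comp_J hn).const_smul Complex.I)).const_smul (1 / 2)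

theorem adjoint (hE : IsSmoothHermitian E F) (hn : n ≤ (∞ : ℕ∞ω)) (ha : IsForm1 F n a) :
    IsForm1 F n (fun x v ↦ LinearMap.adjoint (a x v)) := by
  refine isForm1_of_field (fun x ↦ ⟨fun v w ↦ ?_, fun c v ↦ ?_⟩) fun V x hV ↦
    (ha.endCnAt hV).adjoint hE hn
  · rw [(ha.1 x).map_add, map_add]
  · rw [(ha.1 x).map_smul, ← Complex.coe_smul, map_smulₛₗ, Complex.conj_ofReal, Complex.coe_smul]

theorem lie_left {u : Form0 E} (hu : IsForm0 F n u) (ha : IsForm1 F n a) :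
    IsForm1 F n (fun x v ↦ ⁅u x, a x v⁆) := by
  refine isForm1_of_field (fun x ↦ ⟨fun v w ↦ ?_, fun c v ↦ ?_⟩) fun V x hV ↦
    (isForm0_iff.mp hu x).lie (ha.endCnAt hV)
  · rw [(ha.1 x).map_add, end_lie_add]
  · rw [(ha.1 x).map_smul, ← Complex.coe_smul, end_lie_smul, Complex.coe_smul]

theorem lie_right {u : Form0 E} (hu : IsForm0 F n u) (ha : IsForm1 F n a) :
    IsForm1 F n (fun x v ↦ ⁅a x v, u x⁆) := by
  have := (ha.lie_left hu).neg
  simpa only [Pi.neg_def, end_lie_skew] using this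

theorem bracket (ha : IsForm1 F n a) (hb : IsForm1 F n b) : IsForm2 F n (bracket a b) := by
  refine ⟨fun x v ↦ ⟨fun w w' ↦ ?_, fun c w ↦ ?_⟩, fun x v w ↦ ?_, fun V W s x hV hW hs ↦ ?_⟩
  · simp only [HiggsKuranishi.bracket, (ha.1 x).map_add, (hb.1 x).map_add, end_lie_add, end_add_lie]
    abel
  · simp only [HiggsKuranishi.bracket, (ha.1 x).map_smul, (hb.1 x).map_smul]
    simp only [← Complex.coe_smul, end_lie_smul, end_smul_lie, smul_sub]
  · simp only [HiggsKuranishi.bracket, neg_sub]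
  · exact (((ha.endCnAt hV).lie (hb.endCnAt hW)).sub ((ha.endCnAt hW).lie (hb.endCnAt hV))) s hs

end IsForm1

namespace IsForm2

variable {σ τ : Form2 E}

theorem zero : IsForm2 F n (0 : Form2 E) :=
  ⟨fun x v ↦ ⟨fun _ _ ↦ (add_zero _).symm, fun _ _ ↦ (smul_zero _).symm⟩,
    fun _ _ _ ↦ neg_zero.symm, fun V W s x _ _ hs ↦ EndCnAt.zero s hs⟩

theorem add (hσ : IsForm2 F n σ) (hτ : IsForm2 F n τ) : IsForm2 F n (σ + τ) := by
  refine ⟨fun x v ↦ ⟨fun w w' ↦ ?_, fun c w ↦ ?_⟩, fun x v w ↦ ?_, fun V W s x hV hW hs ↦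
    ((hσ.endCnAt hV hW).add (hτ.endCnAt hV hW)) s hs⟩
  · simp only [Pi.add_apply, (hσ.1 x v).map_add, (hτ.1 x v).map_add]; abel
  · simp only [Pi.add_apply, (hσ.1 x v).map_smul, (hτ.1 x v).map_smul, smul_add]
  · simp only [Pi.add_apply]; rw [hσ.2.1 x v w, hτ.2.1 x v w, neg_add]

theorem const_smul (c : ℂ) (hσ : IsForm2 F n σ) : IsForm2 F n (c • σ) := by
  refine ⟨fun x v ↦ ⟨fun w w' ↦ ?_, fun r w ↦ ?_⟩, fun x v w ↦ ?_, fun V W s x hV hW hs ↦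
    ((hσ.endCnAt hV hW).const_smul c) s hs⟩
  · simp only [Pi.smul_apply, (hσ.1 x v).map_add, smul_add]
  · change c • σ x v (r • w) = r • c • σ x v w
    rw [(hσ.1 x v).map_smul, smul_comm]
  · simp only [Pi.smul_apply]; rw [hσ.2.1 x v w, smul_neg]

theorem sub (hσ : IsForm2 F n σ) (hτ : IsForm2 F n τ) : IsForm2 F n (σ - τ) := by
  have := hσ.add (hτ.const_smul (-1))
  rwa [neg_one_smul, ← sub_eq_add_neg] at this

/-- A 2-form on a surface is determined by its value on one frame. -/
theorem eq_zero (hσ : IsForm2 F n σ)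
    (h : ∀ x, σ x (tanOf x 1) (tanOf x Complex.I) = 0) : σ = 0 := by
  funext x v w
  rw [tan_eq x v, tan_eq x w, (hσ.isLinearMap_left x _).map_add,
    (hσ.isLinearMap_left x _).map_smul, (hσ.isLinearMap_left x _).map_smul]
  simp only [(hσ.1 x _).map_add, (hσ.1 x _).map_smul, h x, alternating_self (hσ.2.1 x)]
  rw [hσ.2.1 x (tanOf x Complex.I), h x]
  simp

end IsForm2

theorem isForm1_covEnd (A : UnitaryConnection F E) (hE : IsSmoothHermitian E F) {u : Form0 E}
    (hu : IsForm0 F ∞ u) : IsForm1 F ∞ (covEnd A u) :=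
  isForm1_of_field (fun x ↦ covEnd_isLinearMap A u hE (isForm0_iff.mp hu x)) fun V x hV ↦
    endCnAt_covEnd A hE (Eventually.of_forall fun y ↦ isForm0_iff.mp hu y) hV

variable (g : KahlerMetric X)

theorem contMDiffAt_inner {V W : ∀ x : X, Tan x} {x : X} (hn : n ≤ (∞ : ℕ∞ω))
    (hV : FieldCnAt n V x) (hW : FieldCnAt n W x) :
    ContMDiffAt 𝓘(ℝ, ℂ) 𝓘(ℝ, ℝ) n (fun y ↦ g.metric.inner y (V y) (W y)) x := by
  have h1 : ContMDiffAt 𝓘(ℝ, ℂ) (𝓘(ℝ, ℂ).prod 𝓘(ℝ, ℝ)) n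
      (fun y ↦ TotalSpace.mk' ℝ (E := Bundle.Trivial X ℝ) y
        (g.metric.inner y (V y) (W y))) x := by
    apply ContMDiffAt.clm_bundle_apply₂ (F₁ := ℂ) (F₂ := ℂ)
    · exact g.metric.contMDiff.contMDiffAt.of_le hn
    · exact hV
    · exact hW
  exact (contMDiffAt_totalSpace.mp h1).2

/-- The contraction of a 2-form with the area form. -/
def contract (σ : Form2 E) : Form0 E := fun x ↦ (g.lam x : ℂ)⁻¹ • σ x (tanOf x 1) (tanOf x Complex.I)

theorem IsForm2.contract_eq {σ : Form2 E} (hσ : IsForm2 F n σ) {x : X} {v : Tan x} (hv : v ≠ 0) :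
    contract g σ x = ((g.metric.inner x v v : ℝ) : ℂ)⁻¹ • σ x v (J x v) :=
  (form2_conformal g (hσ.1 x) (hσ.2.1 x) hv).symm

/-- The definition of `contract` uses the preferred chart at each point, which may jump from point
to point. Conformal invariance rewrites it near `x` in the coordinate frame of a single chart, where
regularity is visible. -/
theorem IsForm2.contract {σ : Form2 E} (hn : n ≤ (∞ : ℕ∞ω)) (hσ : IsForm2 F n σ) :
    IsForm0 F n (contract g σ) := by
  rw [isForm0_iff]
  intro x
  have hV := fieldCnAt_extendTan (mem_chart_source ℂ x) (tanOf x 1) n hn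
  have hne : ∀ {y}, y ∈ (chartAt ℂ x).source → extendTan (tanOf x 1) y ≠ 0 := fun hy ↦
    extendTan_ne_zero hy (one_ne_zero (α := ℂ))
  have hg : ContMDiffAt 𝓘(ℝ, ℂ) 𝓘(ℝ, ℝ) n
      (fun y ↦ (g.metric.inner y (extendTan (tanOf x 1) y) (extendTan (tanOf x 1) y))⁻¹) x :=
    (contMDiffAt_inner g hn hV hV).inv₀ (g.inner_self_pos (hne (mem_chart_source ℂ x))).ne'
  refine ((hσ.endCnAt hV (fieldCnAt_J hn hV)).real_smul hg).congr ?_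
  filter_upwards [(chartAt ℂ x).open_source.mem_nhds (mem_chart_source ℂ x)] with y hy
  rw [hσ.contract_eq g (hne hy), ← Complex.coe_smul, Complex.ofReal_inv]

end FormRegularity

/-! ### The area measure. -/

section Area

variable {X : Type*} [TopologicalSpace X] [ChartedSpace ℂ X] [IsManifold 𝓘(ℂ) ω X]
  [IsManifold 𝓘(ℝ, ℂ) ∞ X]

theorem extendTan_add_smul {x y : X} (hy : y ∈ (chartAt ℂ x).source) (a b : ℝ) (v w : Tan x) :
    extendTan (a • v + b • w) y = a • extendTan v y + b • extendTan w y := by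
  have h (c : Tan x) := extendTan_apply hy (c : ℂ)
  refine (h (a • v + b • w)).trans ?_
  refine ((tangentCoordChange 𝓘(ℝ, ℂ) x y y).map_add _ _).trans ?_
  exact congrArg₂ (· + ·)
    (((tangentCoordChange 𝓘(ℝ, ℂ) x y y).map_smul a (v : ℂ)).trans
      (congrArg (fun t : ℂ ↦ a • t) (h v).symm))
    (((tangentCoordChange 𝓘(ℝ, ℂ) x y y).map_smul b (w : ℂ)).trans
      (congrArg (fun t : ℂ ↦ b • t) (h w).symm))

theorem mfderiv_chart_symm {x : X} {z : ℂ} (hz : z ∈ (chartAt ℂ x).target) (c : ℂ) :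
    mfderiv 𝓘(ℝ, ℂ) 𝓘(ℝ, ℂ) (chartAt ℂ x).symm z c =
      extendTan (tanOf x c) ((chartAt ℂ x).symm z) := by
  have hy : (chartAt ℂ x).symm z ∈ (chartAt ℂ x).source := (chartAt ℂ x).map_target hz
  have e2 := TangentBundle.symmL_trivializationAt_eq_core (I := 𝓘(ℝ, ℂ)) hy
  have hs := TangentBundle.symmL_trivializationAt (I := 𝓘(ℝ, ℂ)) hy
  simp only [mfld_simps, mfderivWithin_univ] at hs
  rw [hs] at e2
  have e3 : chartAt ℂ x ((chartAt ℂ x).symm z) = z := (chartAt ℂ x).right_inv hz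
  rw [e3] at e2
  exact (congrArg (fun L : ℂ →L[ℝ] ℂ ↦ L c) e2).trans (extendTan_apply hy c).symm

variable (g : KahlerMetric X)

/-- The squared length of the first coordinate field of the chart at `x`. -/
def chartLam (x y : X) : ℝ :=
  g.metric.inner y (extendTan (tanOf x 1) y) (extendTan (tanOf x 1) y)

theorem chartLam_pos {x y : X} (hy : y ∈ (chartAt ℂ x).source) : 0 < chartLam g x y :=
  g.inner_self_pos (extendTan_ne_zero hy (one_ne_zero (α := ℂ)))

theorem contMDiffAt_chartLam {x y : X} (hy : y ∈ (chartAt ℂ x).source) {n : ℕ∞ω}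
    (hn : n ≤ (∞ : ℕ∞ω)) : ContMDiffAt 𝓘(ℝ, ℂ) 𝓘(ℝ, ℝ) n (chartLam g x) y :=
  contMDiffAt_inner g hn (fieldCnAt_extendTan hy _ n hn) (fieldCnAt_extendTan hy _ n hn)

theorem extendTan_tangentCoordChange {x x' y : X} (hy : y ∈ (chartAt ℂ x).source)
    (hy' : y ∈ (chartAt ℂ x').source) (c : ℂ) :
    extendTan (tanOf x' (tangentCoordChange 𝓘(ℝ, ℂ) x x' y c)) y = extendTan (tanOf x c) y := by
  refine (extendTan_apply hy' _).trans (Eq.trans ?_ (extendTan_apply hy c).symm)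
  exact tangentCoordChange_comp (I := 𝓘(ℝ, ℂ)) (w := x) (x := x') (y := y) (z := y) (v := c)
    (by simpa [hy'] using hy)

/-- A coordinate change is multiplication by a complex number `c`, and a conformal metric scales by
`|c|²`. -/
theorem chartLam_eq {x x' y : X} (hy : y ∈ (chartAt ℂ x).source)
    (hy' : y ∈ (chartAt ℂ x').source) :
    chartLam g x y =
      Complex.normSq (tangentCoordChange 𝓘(ℝ, ℂ) x x' y 1) * chartLam g x' y := by
  rw [chartLam, ← extendTan_tangentCoordChange hy hy']
  set c := tangentCoordChange 𝓘(ℝ, ℂ) x x' y 1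
  have h1 : tanOf x' c = c.re • tanOf x' 1 + c.im • J x' (tanOf x' 1) := by
    rw [J_one]; exact tan_eq x' (tanOf x' c)
  rw [h1, extendTan_add_smul hy', J_extendTan hy', g.inner_self, chartLam, Complex.normSq_apply]
  ring

/-- A complex linear map of `ℂ` is multiplication by its value at `1`, and the real determinant of
multiplication by `c` is `|c|²`. -/
theorem det_tangentCoordChange {x x' y : X} (hy : y ∈ (chartAt ℂ x).source)
    (hy' : y ∈ (chartAt ℂ x').source) :
    (tangentCoordChange 𝓘(ℝ, ℂ) x x' y).det =
      Complex.normSq (tangentCoordChange 𝓘(ℝ, ℂ) x x' y 1) := by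
  set L := tangentCoordChange 𝓘(ℝ, ℂ) x x' y
  have hI (c : ℂ) : L (Complex.I * c) = Complex.I * L c := tangentCoordChange_I hy hy' c
  have hL : (L : ℂ →ₗ[ℝ] ℂ) = LinearMap.mul ℝ ℂ (L 1) := by
    refine Complex.basisOneI.ext fun i ↦ ?_
    have h2 := hI 1
    fin_cases i
    · simp
    · simp only [mul_one] at h2
      simp [h2, mul_comm]
  rw [ContinuousLinearMap.det, hL, ← LinearMap.det_toMatrix Complex.basisOneI,
    Matrix.det_fin_two]
  simp [LinearMap.toMatrix_apply, Complex.normSq_apply]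

variable [MeasurableSpace X] [BorelSpace X]

theorem aemeasurable_chart_symm (x : X) :
    AEMeasurable (chartAt ℂ x).symm ((volume : Measure ℂ).restrict (chartAt ℂ x).target) :=
  (chartAt ℂ x).continuousOn_symm.aemeasurable (chartAt ℂ x).open_target.measurableSet

/-- The density of the area measure in the chart at `x`. -/
def chartDensity (x : X) (z : ℂ) : ℝ≥0∞ := ENNReal.ofReal (chartLam g x ((chartAt ℂ x).symm z))

theorem chartArea_eq (x : X) : g.chartArea x =
    (((volume : Measure ℂ).restrict (chartAt ℂ x).target).withDensity
      (chartDensity g x)).map (chartAt ℂ x).symm := by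
  refine congrArg (Measure.map (chartAt ℂ x).symm) (withDensity_congr_ae ?_)
  filter_upwards [ae_restrict_mem (chartAt ℂ x).open_target.measurableSet] with z hz
  rw [chartDensity, chartLam, ← mfderiv_chart_symm hz]

theorem chartArea_apply (x : X) {s : Set X} (hs : MeasurableSet s) : g.chartArea x s =
    ∫⁻ z in (chartAt ℂ x).target ∩ (chartAt ℂ x).symm ⁻¹' s, chartDensity g x z := by
  have h := aemeasurable_chart_symm (X := X) x
  rw [chartArea_eq, Measure.map_apply_of_aemeasurable
    (h.mono_ac (withDensity_absolutelyContinuous _ _)) hs, withDensity_apply',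
    Measure.restrict_restrict₀ (h.nullMeasurable hs), Set.inter_comm]

theorem measurableSet_chart_preimage (x : X) {s : Set X} (hs : MeasurableSet s) :
    MeasurableSet ((chartAt ℂ x).target ∩ (chartAt ℂ x).symm ⁻¹' s) := by
  have h1 := (continuousOn_iff_continuous_domRestrict.mp (chartAt ℂ x).continuousOn_symm).measurable hs
  have h2 := (chartAt ℂ x).open_target.measurableSet.subtype_image h1
  convert h2 using 1
  ext z
  simp [Set.domRestrict, and_comm]

/-- Change of variables: the Jacobian `|c|²` of the transition map is exactly the ratio of the two
densities. This makes the supremum defining `area` consistent on overlaps. -/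
theorem chartArea_congr (x x' : X) {s : Set X} (hs : MeasurableSet s)
    (hx : s ⊆ (chartAt ℂ x).source) (hx' : s ⊆ (chartAt ℂ x').source) :
    g.chartArea x' s = g.chartArea x s := by
  rw [chartArea_apply g x hs, chartArea_apply g x' hs]
  set φ := chartAt ℂ x
  set φ' := chartAt ℂ x'
  have himg : φ'.target ∩ φ'.symm ⁻¹' s = (φ' ∘ φ.symm) '' (φ.target ∩ φ.symm ⁻¹' s) := by
    ext w
    constructor
    · rintro ⟨hw, hws⟩
      refine ⟨φ (φ'.symm w), ⟨φ.map_source (hx hws), ?_⟩, ?_⟩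
      · simpa [φ.left_inv (hx hws)] using hws
      · simp [φ.left_inv (hx hws), φ'.right_inv hw]
    · rintro ⟨z, ⟨hz, hzs⟩, rfl⟩
      have : φ.symm z ∈ s := hzs
      exact ⟨φ'.map_source (hx' hzs), by simpa [φ'.left_inv (hx' hzs)] using hzs⟩
  rw [himg, lintegral_image_eq_lintegral_abs_det_fderiv_mul (volume : Measure ℂ)
    (f' := fun z ↦ tangentCoordChange 𝓘(ℝ, ℂ) x x' (φ.symm z))
    (measurableSet_chart_preimage x hs)]
  · refine setLIntegral_congr_fun (measurableSet_chart_preimage x hs) fun z hz ↦ ?_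
    have hy := hx hz.2
    have hy' := hx' hz.2
    simp only [chartDensity, Function.comp_apply]
    rw [φ'.left_inv hy', det_tangentCoordChange hy hy', ← ENNReal.ofReal_mul (abs_nonneg _),
      abs_of_nonneg (Complex.normSq_nonneg _), ← chartLam_eq g hy hy']
  · intro z hz
    have h := hasFDerivWithinAt_tangentCoordChange (I := 𝓘(ℝ, ℂ)) (x := x) (y := x')
      (z := φ.symm z) ⟨by simpa using hx hz.2, by simpa using hx' hz.2⟩
    simp only [mfld_simps] at h
    rw [φ.right_inv hz.1] at h
    exact h.mono (Set.subset_univ _)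
  · intro z hz w hw hzw
    have h1 : φ.symm z = φ.symm w := φ'.injOn (hx' hz.2) (hx' hw.2) hzw
    exact φ.symm.injOn hz.1 hw.1 h1

theorem chartArea_compl (x : X) : g.chartArea x (chartAt ℂ x).sourceᶜ = 0 := by
  rw [chartArea_apply g x (chartAt ℂ x).open_source.measurableSet.compl]
  convert setLIntegral_empty _
  ext z
  simp only [Set.mem_inter_iff, Set.mem_preimage, Set.mem_compl_iff, Set.mem_empty_iff_false,
    iff_false, not_and, not_not]
  exact fun hz ↦ (chartAt ℂ x).map_target hz

theorem area_apply (x : X) {s : Set X} (hs : MeasurableSet s) (hx : s ⊆ (chartAt ℂ x).source) :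
    g.area s = g.chartArea x s := by
  have hS := (chartAt ℂ x).open_source.measurableSet
  refine le_antisymm ?_ (le_iSup g.chartArea x s)
  -- The measure on the right dominates every chart measure: on the source of the chart at `x` by
  -- agreement on overlaps, and elsewhere because it is `⊤` there. It hence dominates the supremum,
  -- and on subsets of the source it is just `chartArea`.
  have h : g.area ≤ g.chartArea x + (⊤ : Measure X).restrict (chartAt ℂ x).sourceᶜ := by
    refine iSup_le fun x' ↦ Measure.le_iff.mpr fun t ht ↦ ?_
    rw [← measure_inter_add_sdiff t hS]
    have h1 : g.chartArea x' (t ∩ (chartAt ℂ x).source) ≤ g.chartArea x t := by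
      rw [← measure_inter_add_sdiff (t ∩ _) (chartAt ℂ x').open_source.measurableSet,
        chartArea_congr g x x' ((ht.inter hS).inter (chartAt ℂ x').open_source.measurableSet)
          (fun y hy ↦ hy.1.2) (fun y hy ↦ hy.2),
        measure_mono_null (fun y hy ↦ hy.2) (chartArea_compl g x'), add_zero]
      exact measure_mono fun y hy ↦ hy.1.1
    rw [Measure.add_apply, Measure.restrict_apply ht]
    exact add_le_add h1 (le_top (a := g.chartArea x') _)
  refine (h s).trans ?_
  rw [Measure.add_apply, Measure.restrict_apply hs]
  have : s ∩ (chartAt ℂ x).sourceᶜ = ∅ := by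
    ext y
    simpa using fun h ↦ hx h
  simp [this]

theorem area_restrict (x : X) : g.area.restrict (chartAt ℂ x).source = g.chartArea x := by
  have hS := (chartAt ℂ x).open_source.measurableSet
  ext s hs
  rw [Measure.restrict_apply hs, area_apply g x (hs.inter hS) Set.inter_subset_right,
    ← measure_inter_add_sdiff s hS, measure_mono_null (s := s \ _) (fun y hy ↦ hy.2)
      (chartArea_compl g x), add_zero]

theorem continuousOn_chartLam (x : X) :
    ContinuousOn (fun z ↦ chartLam g x ((chartAt ℂ x).symm z)) (chartAt ℂ x).target := by
  refine ContinuousOn.comp (g := chartLam g x) (t := (chartAt ℂ x).source) (fun y hy ↦ ?_)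
    (chartAt ℂ x).continuousOn_symm (OpenPartialHomeomorph.mapsTo_symm _)
  exact (contMDiffAt_chartLam g hy (n := 0) (by simp)).continuousAt.continuousWithinAt

/-- The density is continuous, hence bounded on a closed ball inside the chart. On a compact surface
the total area is then finite. -/
instance : IsLocallyFiniteMeasure g.area := by
  refine ⟨fun x ↦ ?_⟩
  set φ := chartAt ℂ x
  obtain ⟨r, hr, hrt⟩ := Metric.nhds_basis_closedBall.mem_iff.mp
    (φ.open_target.mem_nhds (mem_chart_target ℂ x))
  have hU : φ.source ∩ φ ⁻¹' Metric.ball (φ x) r ∈ 𝓝 x :=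
    (φ.isOpen_inter_preimage Metric.isOpen_ball).mem_nhds
      ⟨mem_chart_source ℂ x, Metric.mem_ball_self hr⟩
  refine ⟨_, hU, ?_⟩
  have hm := (φ.isOpen_inter_preimage (Metric.isOpen_ball (x := φ x) (ε := r))).measurableSet
  rw [area_apply g x hm Set.inter_subset_left, chartArea_apply g x hm]
  have hcpt := isCompact_closedBall (φ x) r
  obtain ⟨C, hC⟩ := (hcpt.image_of_continuousOn ((continuousOn_chartLam g x).mono hrt)).bddAbove
  refine lt_of_le_of_lt (lintegral_mono_set (t := Metric.closedBall (φ x) r) ?_) ?_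
  · rintro z ⟨hz, -, hz'⟩
    have : φ (φ.symm z) ∈ Metric.ball (φ x) r := hz'
    rw [φ.right_inv hz] at this
    exact Metric.ball_subset_closedBall this
  · refine lt_of_le_of_lt (setLIntegral_mono' (g := fun _ ↦ ENNReal.ofReal C)
      Metric.isClosed_closedBall.measurableSet fun z hz ↦
      ENNReal.ofReal_le_ofReal (hC ⟨z, hz, rfl⟩)) ?_
    rw [setLIntegral_const]
    exact ENNReal.mul_lt_top ENNReal.ofReal_lt_top hcpt.measure_lt_top

/-- The density is strictly positive. This is what lets a vanishing `L²` norm force a continuous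
form to vanish everywhere. -/
instance : Measure.IsOpenPosMeasure g.area := by
  refine ⟨fun U hU ⟨x, hx⟩ h0 ↦ ?_⟩
  set φ := chartAt ℂ x
  have hV : IsOpen (U ∩ φ.source) := hU.inter φ.open_source
  have h1 : g.area (U ∩ φ.source) = 0 := measure_mono_null Set.inter_subset_left h0
  rw [area_apply g x hV.measurableSet Set.inter_subset_right,
    chartArea_apply g x hV.measurableSet] at h1
  have hW : IsOpen (φ.target ∩ φ.symm ⁻¹' (U ∩ φ.source)) := φ.isOpen_inter_preimage_symm hV
  have hne : φ x ∈ φ.target ∩ φ.symm ⁻¹' (U ∩ φ.source) :=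
    ⟨mem_chart_target ℂ x, by simp [φ, hx]⟩
  have hpos := hW.measure_pos (volume : Measure ℂ) ⟨_, hne⟩
  have hm : AEMeasurable (chartDensity g x)
      (volume.restrict (φ.target ∩ φ.symm ⁻¹' (U ∩ φ.source))) :=
    (((continuousOn_chartLam g x).mono Set.inter_subset_left).aemeasurable
      hW.measurableSet).ennreal_ofReal
  rw [lintegral_eq_zero_iff' hm, EventuallyEq, ae_restrict_iff' hW.measurableSet, ae_iff] at h1
  refine hpos.ne' (measure_mono_null ?_ h1)
  intro z hz hz'
  have := hz' hz
  simp only [chartDensity, Pi.zero_apply, ENNReal.ofReal_eq_zero] at this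
  exact absurd (chartLam_pos g hz.2.2) this.not_gt

end Area

/-! ### Exterior derivatives of scalar 1-forms in a fixed chart. -/

section ScalarStokes

variable {X : Type*} [TopologicalSpace X] [ChartedSpace ℂ X] [IsManifold 𝓘(ℂ) ω X]
  [IsManifold 𝓘(ℝ, ℂ) ∞ X]

/-- A smooth complex valued 1-form. -/
structure IsScalarForm (β : ∀ x : X, Tan x → ℂ) : Prop where
  linear : ∀ x, IsLinearMap ℝ (β x)
  smooth : ∀ (V : ∀ x : X, Tan x) (x : X), FieldCnAt ∞ V x →
    ContMDiffAt 𝓘(ℝ, ℂ) 𝓘(ℝ, ℂ) ∞ (fun y ↦ β y (V y)) x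

/-- The exterior derivative of a scalar 1-form, evaluated on the frame `(1, i)`. -/
def scalarD (β : ∀ x : X, Tan x → ℂ) (x : X) : ℂ :=
  mvfderiv 𝓘(ℝ, ℂ) (fun y ↦ β y (extendTan (tanOf x Complex.I) y)) x (tanOf x 1) -
    mvfderiv 𝓘(ℝ, ℂ) (fun y ↦ β y (extendTan (tanOf x 1) y)) x (tanOf x Complex.I)

/-- The coefficients of a scalar 1-form in the chart at `x`. -/
def chartCoeff (β : ∀ x : X, Tan x → ℂ) (x : X) (c z : ℂ) : ℂ :=
  β ((chartAt ℂ x).symm z) (extendTan (tanOf x c) ((chartAt ℂ x).symm z))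

theorem mvfderiv_eq_fderiv {V : Type*} [NormedAddCommGroup V] [NormedSpace ℝ V] {f : X → V} {x : X}
    (hf : MDifferentiableAt 𝓘(ℝ, ℂ) 𝓘(ℝ, V) f x) (c : ℂ) :
    mvfderiv 𝓘(ℝ, ℂ) f x (tanOf x c) =
      fderiv ℝ (fun z ↦ f ((chartAt ℂ x).symm z)) (chartAt ℂ x x) c := by
  have h0 : fderivWithin ℝ (writtenInExtChartAt 𝓘(ℝ, ℂ) 𝓘(ℝ, V) x f) (Set.range 𝓘(ℝ, ℂ))
      (extChartAt 𝓘(ℝ, ℂ) x x) =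
      fderiv ℝ (fun z ↦ f ((chartAt ℂ x).symm z)) (chartAt ℂ x x) := by
    simp only [mfld_simps, fderivWithin_univ, writtenInExtChartAt]
    rfl
  have h : mfderiv 𝓘(ℝ, ℂ) 𝓘(ℝ, V) f x =
      fderiv ℝ (fun z ↦ f ((chartAt ℂ x).symm z)) (chartAt ℂ x x) := (if_pos hf).trans h0
  exact congrArg (fun L : ℂ →L[ℝ] V ↦ L c) h

theorem contMDiffAt_chart_symm {x : X} {z : ℂ} (hz : z ∈ (chartAt ℂ x).target) :
    ContMDiffAt 𝓘(ℝ, ℂ) 𝓘(ℝ, ℂ) ∞ (chartAt ℂ x).symm z :=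
  (contMDiffOn_chart_symm (I := 𝓘(ℝ, ℂ)) (x := x)).contMDiffAt
    ((chartAt ℂ x).open_target.mem_nhds hz)

theorem IsScalarForm.contDiffAt_chartCoeff {β : ∀ x : X, Tan x → ℂ} (hβ : IsScalarForm β) {x : X}
    {z : ℂ} (hz : z ∈ (chartAt ℂ x).target) (c : ℂ) : ContDiffAt ℝ ∞ (chartCoeff β x c) z := by
  have h := hβ.smooth _ _ (fieldCnAt_extendTan ((chartAt ℂ x).map_target hz) (tanOf x c) ∞ le_rfl)
  exact (ContMDiffAt.comp z h (contMDiffAt_chart_symm hz)).contDiffAt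

theorem contDiffAt_chart_transition {x x' : X} (hx : x ∈ (chartAt ℂ x').source) :
    ContDiffAt ℝ ∞ (fun z ↦ chartAt ℂ x' ((chartAt ℂ x).symm z)) (chartAt ℂ x x) := by
  have h1 : ContMDiffAt 𝓘(ℝ, ℂ) 𝓘(ℝ, ℂ) ∞ (chartAt ℂ x')
      ((chartAt ℂ x).symm (chartAt ℂ x x)) := by
    rw [(chartAt ℂ x).left_inv (mem_chart_source ℂ x)]
    exact (contMDiffOn_chart (I := 𝓘(ℝ, ℂ)) (x := x')).contMDiffAt
      ((chartAt ℂ x').open_source.mem_nhds hx)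
  exact (ContMDiffAt.comp _ h1 (contMDiffAt_chart_symm (mem_chart_target ℂ x))).contDiffAt

theorem fderiv_chart_transition {x x' y : X} (hy : y ∈ (chartAt ℂ x).source)
    (hy' : y ∈ (chartAt ℂ x').source) :
    fderiv ℝ (fun z ↦ chartAt ℂ x' ((chartAt ℂ x).symm z)) (chartAt ℂ x y) =
      tangentCoordChange 𝓘(ℝ, ℂ) x x' y := by
  have h := hasFDerivWithinAt_tangentCoordChange (I := 𝓘(ℝ, ℂ)) (x := x) (y := x')
    (z := y) ⟨by simpa using hy, by simpa using hy'⟩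
  simp only [mfld_simps, hasFDerivWithinAt_univ] at h
  exact h.fderiv

variable (g : KahlerMetric X)

theorem chartLam_self (x : X) : chartLam g x x = g.lam x := by
  have h (v : Tan x) : extendTan v x = v := FiberBundle.extend_apply_self ℂ v
  rw [chartLam, h, KahlerMetric.lam]

theorem clm_apply_eq (L : ℂ →L[ℝ] ℂ) (c : ℂ) : L c = c.re * L 1 + c.im * L Complex.I := by
  calc L c = L (c.re • (1 : ℂ) + c.im • Complex.I) := by congr 1; simp
    _ = _ := by rw [map_add, map_smul, map_smul, Complex.real_smul, Complex.real_smul]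

theorem extendTan_chart {x x' y : X} (hy : y ∈ (chartAt ℂ x).source)
    (hy' : y ∈ (chartAt ℂ x').source) (c : ℂ) :
    extendTan (tanOf x c) y =
      (tangentCoordChange 𝓘(ℝ, ℂ) x x' y c).re • extendTan (tanOf x' 1) y +
      (tangentCoordChange 𝓘(ℝ, ℂ) x x' y c).im • extendTan (tanOf x' Complex.I) y := by
  rw [← extendTan_add_smul hy', ← extendTan_tangentCoordChange hy hy']
  congr 1
  exact tan_eq x' (tanOf x' (tangentCoordChange 𝓘(ℝ, ℂ) x x' y c))

/-- Chain rule for the passage from the chart at `x` to a fixed chart at `x'`. The bilinear map `D`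
is the second derivative of the transition map; its symmetry is recorded because it makes these
terms cancel in the exterior derivative. -/
theorem IsScalarForm.mvfderiv_extend {β : ∀ x : X, Tan x → ℂ} (hβ : IsScalarForm β) {x x' : X}
    (hx : x ∈ (chartAt ℂ x').source) :
    ∃ D : ℂ →L[ℝ] ℂ →L[ℝ] ℂ, (∀ v w, D v w = D w v) ∧ ∀ v w : ℂ,
      mvfderiv 𝓘(ℝ, ℂ) (fun y ↦ β y (extendTan (tanOf x w) y)) x (tanOf x v) =
        fderiv ℝ (chartCoeff β x' 1) (chartAt ℂ x' x) (tangentCoordChange 𝓘(ℝ, ℂ) x x' x v) *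
            (tangentCoordChange 𝓘(ℝ, ℂ) x x' x w).re +
          fderiv ℝ (chartCoeff β x' Complex.I) (chartAt ℂ x' x)
            (tangentCoordChange 𝓘(ℝ, ℂ) x x' x v) *
            (tangentCoordChange 𝓘(ℝ, ℂ) x x' x w).im +
          (chartCoeff β x' 1 (chartAt ℂ x' x) * (D v w).re +
          chartCoeff β x' Complex.I (chartAt ℂ x' x) * (D v w).im) := by
  set φ := chartAt ℂ x with hφ
  set φ' := chartAt ℂ x' with hφ'
  set ψ : ℂ → ℂ := fun z ↦ φ' (φ.symm z) with hψ
  have hxs := mem_chart_source ℂ x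
  have hψs : ContDiffAt ℝ ∞ ψ (φ x) := contDiffAt_chart_transition hx
  have hψx : ψ (φ x) = φ' x := by rw [hψ]; simp only; rw [φ.left_inv hxs]
  have hD2 : ContDiffAt ℝ ∞ (fderiv ℝ ψ) (φ x) := hψs.fderiv_right (by simp)
  have hL : fderiv ℝ ψ (φ x) = tangentCoordChange 𝓘(ℝ, ℂ) x x' x := fderiv_chart_transition hxs hx
  have hT : φ' x ∈ φ'.target := φ'.map_source hx
  refine ⟨fderiv ℝ (fderiv ℝ ψ) (φ x), fun v w ↦ ?_, fun v w ↦ ?_⟩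
  · exact hψs.isSymmSndFDerivAt (by simp; exact ENat.LEInfty.out) v w
  have hmd := (hβ.smooth _ _ (fieldCnAt_extendTan hxs (tanOf x w) ∞ le_rfl)).mdifferentiableAt
    (by simp)
  rw [mvfderiv_eq_fderiv hmd]
  have hev : (fun z ↦ β (φ.symm z) (extendTan (tanOf x w) (φ.symm z))) =ᶠ[𝓝 (φ x)]
      fun z ↦ chartCoeff β x' 1 (ψ z) * ((fderiv ℝ ψ z w).re : ℂ) +
        chartCoeff β x' Complex.I (ψ z) * ((fderiv ℝ ψ z w).im : ℂ) := by
    have hopen : φ.target ∩ φ.symm ⁻¹' φ'.source ∈ 𝓝 (φ x) :=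
      (φ.isOpen_inter_preimage_symm φ'.open_source).mem_nhds
        ⟨mem_chart_target ℂ x, by simpa [φ.left_inv hxs] using hx⟩
    filter_upwards [hopen] with z hz
    have hy := φ.map_target hz.1
    have e := fderiv_chart_transition hy hz.2
    rw [← hφ, φ.right_inv hz.1] at e
    have e' : fderiv ℝ ψ z = tangentCoordChange 𝓘(ℝ, ℂ) x x' (φ.symm z) := e
    have e2 : (chartAt ℂ x').symm (ψ z) = φ.symm z := φ'.left_inv hz.2
    rw [e', extendTan_chart hy hz.2, (hβ.linear _).map_add, (hβ.linear _).map_smul,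
      (hβ.linear _).map_smul]
    have e3 (c : ℂ) : chartCoeff β x' c (ψ z) = β (φ.symm z) (extendTan (tanOf x' c) (φ.symm z)) := by
      rw [chartCoeff, e2]
    simp only [e3, Complex.real_smul]
    ring
  rw [hev.fderiv_eq]
  have h1 (c : ℂ) : HasFDerivAt (fun z ↦ chartCoeff β x' c (ψ z))
      ((fderiv ℝ (chartCoeff β x' c) (φ' x)).comp (fderiv ℝ ψ (φ x))) (φ x) := by
    have := ((hβ.contDiffAt_chartCoeff hT c).differentiableAt (by simp)).hasFDerivAt
    rw [← hψx] at this ⊢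
    exact this.comp _ (hψs.differentiableAt (by simp)).hasFDerivAt
  have h2 : HasFDerivAt (fun z ↦ fderiv ℝ ψ z w) ((ContinuousLinearMap.apply ℝ ℂ w).comp
      (fderiv ℝ (fderiv ℝ ψ) (φ x))) (φ x) :=
    (ContinuousLinearMap.apply ℝ ℂ w).hasFDerivAt.comp _
      (hD2.differentiableAt (by simp)).hasFDerivAt
  have hre := (Complex.ofRealCLM.comp Complex.reCLM).hasFDerivAt.comp (φ x) h2
  have him := (Complex.ofRealCLM.comp Complex.imCLM).hasFDerivAt.comp (φ x) h2
  have h3 := ((h1 1).mul hre).add ((h1 Complex.I).mul him)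
  refine (congrArg (fun L : ℂ →L[ℝ] ℂ ↦ L v) h3.fderiv).trans ?_
  simp only [hψx, hL, Function.comp_apply, ContinuousLinearMap.comp_apply,
    ContinuousLinearMap.apply_apply, _root_.add_apply, _root_.smul_apply, smul_eq_mul,
    Complex.reCLM_apply, Complex.imCLM_apply, Complex.ofRealCLM_apply]
  ring

/-- The exterior derivative transforms by the determinant `|L|²` of the coordinate change, which the
metric factor absorbs. The density `λ⁻¹ dβ(1, i)` can therefore be computed in any chart. -/
theorem IsScalarForm.scalarD_eq {β : ∀ x : X, Tan x → ℂ} (hβ : IsScalarForm β) {x x' : X}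
    (hx : x ∈ (chartAt ℂ x').source) :
    (g.lam x : ℂ)⁻¹ * scalarD β x = (chartLam g x' x : ℂ)⁻¹ *
      (fderiv ℝ (chartCoeff β x' Complex.I) (chartAt ℂ x' x) 1 -
        fderiv ℝ (chartCoeff β x' 1) (chartAt ℂ x' x) Complex.I) := by
  obtain ⟨D, hD, h⟩ := hβ.mvfderiv_extend hx
  have hxs := mem_chart_source ℂ x
  have hI := tangentCoordChange_I hxs hx 1
  have hl := chartLam_eq g hxs hx
  have hpos := g.lam_pos x
  rw [chartLam_self] at hl
  rw [scalarD, h, h, hD Complex.I 1]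
  rw [mul_one] at hI
  rw [hI]
  set L := tangentCoordChange 𝓘(ℝ, ℂ) x x' x 1
  have hpos' : 0 < chartLam g x' x := chartLam_pos g hx
  have hn : Complex.normSq L ≠ 0 := by
    intro h0; rw [h0, zero_mul] at hl; exact hpos.ne' hl
  have hn' : ((Complex.normSq L : ℝ) : ℂ) ≠ 0 := by exact_mod_cast hn
  have hlc : (chartLam g x' x : ℂ) ≠ 0 := by exact_mod_cast hpos'.ne'
  rw [hl, Complex.ofReal_mul, mul_inv, mul_assoc, mul_left_comm]
  congr 1
  rw [inv_mul_eq_iff_eq_mul₀ hn']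
  rw [clm_apply_eq _ (Complex.I * L), clm_apply_eq _ L, clm_apply_eq (fderiv ℝ (chartCoeff β x' Complex.I) _) (Complex.I * L), clm_apply_eq (fderiv ℝ (chartCoeff β x' Complex.I) _) L, Complex.normSq_apply]
  simp only [Complex.mul_re, Complex.mul_im, Complex.I_re, Complex.I_im]
  push_cast
  ring

end ScalarStokes

/-! ### Finite smooth partitions of unity. -/

section Partition

variable {X : Type*} [TopologicalSpace X] [T2Space X] [CompactSpace X] [ChartedSpace ℂ X]
  [IsManifold 𝓘(ℝ, ℂ) ∞ X]

theorem exists_finite_partition (U : X → Set X) (hU : ∀ x, IsOpen (U x)) (hx : ∀ x, x ∈ U x) :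
    ∃ (S : Finset X) (ρ : X → X → ℝ), (∀ i, ContMDiff 𝓘(ℝ, ℂ) 𝓘(ℝ, ℝ) ∞ (ρ i)) ∧
      (∀ i, tsupport (ρ i) ⊆ U i) ∧ (∀ i y, 0 ≤ ρ i y) ∧ ∀ y, ∑ i ∈ S, ρ i y = 1 := by
  obtain ⟨f, hf⟩ := SmoothPartitionOfUnity.exists_isSubordinate 𝓘(ℝ, ℂ) (isClosed_univ (X := X)) U hU
    fun x _ ↦ Set.mem_iUnion_of_mem x (hx x)
  have hfin := f.locallyFinite.finite_nonempty_of_compact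
  refine ⟨hfin.toFinset, fun i ↦ f i, fun i ↦ (f i).contMDiff, hf, fun i y ↦ f.nonneg i y,
    fun y ↦ ?_⟩
  have h := f.sum_eq_one (Set.mem_univ y)
  rw [← h, finsum_eq_sum_of_support_subset]
  intro i hi
  simp only [Set.Finite.coe_toFinset, Set.mem_ofPred_eq]
  exact ⟨y, hi⟩

end Partition

/-! ### Integration in charts and Stokes' theorem. -/

section Integration

variable {X : Type*} [TopologicalSpace X] [ChartedSpace ℂ X] [IsManifold 𝓘(ℂ) ω X]
  [IsManifold 𝓘(ℝ, ℂ) ∞ X] (g : KahlerMetric X) [MeasurableSpace X] [BorelSpace X]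

theorem integrable_of_continuous [CompactSpace X] {f : X → ℂ} (hf : Continuous f) :
    Integrable f g.area := by
  have : IsFiniteMeasure g.area := ⟨isCompact_univ.measure_lt_top⟩
  obtain ⟨C, hC⟩ := (isCompact_range hf).isBounded.exists_norm_le
  exact Integrable.of_bound hf.aestronglyMeasurable C
    (Eventually.of_forall fun x ↦ hC _ ⟨x, rfl⟩)

theorem integral_chart {f : X → ℂ} (hf : Continuous f) (x : X)
    (hs : ∀ y, y ∉ (chartAt ℂ x).source → f y = 0) :
    ∫ y, f y ∂g.area = ∫ z in (chartAt ℂ x).target,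
      chartLam g x ((chartAt ℂ x).symm z) • f ((chartAt ℂ x).symm z) := by
  have h := aemeasurable_chart_symm (X := X) x
  have hT := (chartAt ℂ x).open_target.measurableSet
  rw [← setIntegral_eq_integral_of_forall_compl_eq_zero hs, area_restrict, chartArea_eq,
    integral_map (h.mono_ac (withDensity_absolutelyContinuous _ _)) hf.aestronglyMeasurable,
    integral_withDensity_eq_integral_toReal_smul₀]
  · refine setIntegral_congr_fun hT fun z hz ↦ ?_
    simp only [chartDensity]
    rw [ENNReal.toReal_ofReal (chartLam_pos g ((chartAt ℂ x).map_target hz)).le]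
  · exact ((continuousOn_chartLam g x).aemeasurable hT).ennreal_ofReal
  · exact Eventually.of_forall fun z ↦ ENNReal.ofReal_lt_top

/-- Integration by parts against the constant function `1`. -/
theorem integral_fderiv_eq_zero {f : ℂ → ℂ} (hf : ContDiff ℝ 1 f) (hc : HasCompactSupport f)
    (v : ℂ) : ∫ z, fderiv ℝ f z v = 0 := by
  have hd : Continuous fun z ↦ fderiv ℝ f z v := (hf.continuous_fderiv (by simp)).clm_apply continuous_const
  have hdc : HasCompactSupport fun z ↦ fderiv ℝ f z v := hc.fderiv_apply ℝ v
  have h := integral_mul_fderiv_eq_neg_fderiv_mul_of_integrable (μ := (volume : Measure ℂ))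
    (𝕜 := ℂ) (f := fun _ : ℂ ↦ (1 : ℂ)) (g := f) (v := v) (by simp)
    (by simpa using hd.integrable_of_hasCompactSupport hdc)
    (by simpa using hf.continuous.integrable_of_hasCompactSupport hc)
    (fun x _ ↦ by simp) (fun x _ ↦ hf.differentiable (by simp) x)
  simpa using h

theorem IsScalarForm.continuous_scalarD {β : ∀ x : X, Tan x → ℂ} (hβ : IsScalarForm β) :
    Continuous fun x ↦ (g.lam x : ℂ)⁻¹ * scalarD β x := by
  rw [continuous_iff_continuousAt]
  intro x
  have hx := mem_chart_source ℂ x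
  have hev : (fun y ↦ (g.lam y : ℂ)⁻¹ * scalarD β y) =ᶠ[𝓝 x] fun y ↦ (chartLam g x y : ℂ)⁻¹ *
      (fderiv ℝ (chartCoeff β x Complex.I) (chartAt ℂ x y) 1 -
        fderiv ℝ (chartCoeff β x 1) (chartAt ℂ x y) Complex.I) := by
    filter_upwards [(chartAt ℂ x).open_source.mem_nhds hx] with y hy
    exact hβ.scalarD_eq g hy
  refine ContinuousAt.congr ?_ hev.symm
  have h1 (c : ℂ) : ContinuousAt (fderiv ℝ (chartCoeff β x c)) (chartAt ℂ x x) :=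
    ((hβ.contDiffAt_chartCoeff (mem_chart_target ℂ x) c).fderiv_right (m := 0)
      (by simp)).continuousAt
  have h2 (c v : ℂ) : ContinuousAt (fun y ↦ fderiv ℝ (chartCoeff β x c) (chartAt ℂ x y) v) x :=
    (ContinuousAt.comp (f := chartAt ℂ x) (h1 c)
      ((chartAt ℂ x).continuousAt hx)).clm_apply continuousAt_const
  have h3 : ContinuousAt (fun y ↦ (chartLam g x y : ℂ)) x :=
    Complex.continuous_ofReal.continuousAt.comp
      (contMDiffAt_chartLam g hx (n := 0) (by simp)).continuousAt
  exact (h3.inv₀ (by exact_mod_cast (chartLam_pos g hx).ne')).mul ((h2 _ _).sub (h2 _ _))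

theorem scalarD_eq_zero {β : ∀ x : X, Tan x → ℂ} {x : X} (h : ∀ᶠ y in 𝓝 x, ∀ v, β y v = 0) :
    scalarD β x = 0 := by
  have h0 (w : Tan x) : mvfderiv 𝓘(ℝ, ℂ) (fun y ↦ β y (extendTan w y)) x = 0 := by
    rw [mvfderiv_congr (h := fun _ ↦ (0 : ℂ)) (h.mono fun y hy ↦ hy _), mvfderiv_const]
  rw [scalarD, h0, h0]
  exact sub_zero _

theorem IsScalarForm.smul {β : ∀ x : X, Tan x → ℂ} (hβ : IsScalarForm β) {ρ : X → ℝ}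
    (hρ : ContMDiff 𝓘(ℝ, ℂ) 𝓘(ℝ, ℝ) ∞ ρ) : IsScalarForm fun x v ↦ (ρ x : ℂ) * β x v := by
  refine ⟨fun x ↦ ⟨fun v w ↦ ?_, fun c v ↦ ?_⟩, fun V x hV ↦ contMDiffAt_mul_complex
    (Complex.ofRealCLM.contDiff.contMDiff.contMDiffAt.comp x hρ.contMDiffAt) (hβ.smooth V x hV)⟩
  · rw [(hβ.linear x).map_add, mul_add]
  · rw [(hβ.linear x).map_smul, mul_smul_comm]

theorem IsScalarForm.scalarD_sum {ι : Type*} (S : Finset ι) {β : ι → ∀ x : X, Tan x → ℂ}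
    (hβ : ∀ i, IsScalarForm (β i)) (x : X) :
    scalarD (fun x v ↦ ∑ i ∈ S, β i x v) x = ∑ i ∈ S, scalarD (β i) x := by
  have h (w : Tan x) (v : Tan x) := mvfderiv_sum_fun S
    (f := fun i y ↦ β i y (extendTan w y)) (fun i ↦ (hβ i).smooth _ _
    (fieldCnAt_extendTan (mem_chart_source ℂ x) w ∞ le_rfl)) v
  simp only [scalarD, h, Finset.sum_sub_distrib]

theorem IsScalarForm.integral_scalarD_of_tsupport [T2Space X] [CompactSpace X]
    {β : ∀ x : X, Tan x → ℂ} (hβ : IsScalarForm β) (x : X) {K : Set X} (hK : IsClosed K)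
    (hKx : K ⊆ (chartAt ℂ x).source) (hβK : ∀ y, y ∉ K → ∀ v, β y v = 0) :
    ∫ y, (g.lam y : ℂ)⁻¹ * scalarD β y ∂g.area = 0 := by
  set φ := chartAt ℂ x with hφ
  have hev : ∀ y, y ∉ K → ∀ᶠ y' in 𝓝 y, ∀ v, β y' v = 0 := fun y hy ↦
    (hK.isOpen_compl.mem_nhds hy : Kᶜ ∈ 𝓝 y) |> fun h ↦ by filter_upwards [h] using hβK
  rw [integral_chart g (hβ.continuous_scalarD g) x fun y hy ↦ by
    rw [scalarD_eq_zero (hev y fun h ↦ hy (hKx h)), mul_zero]]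
  -- The chart coefficients, extended by zero to the plane. They stay `C¹` because the image of `K`
  -- is compact inside the chart domain. The factor `λ` of the area measure cancels the `λ⁻¹` of the
  -- integrand, so a sum of plain partial derivatives remains.
  let p (c : ℂ) : ℂ → ℂ := φ.target.indicator (chartCoeff β x c)
  have hC : IsCompact (φ '' K) := hK.isCompact.image_of_continuousOn (φ.continuousOn.mono hKx)
  have hCT : φ '' K ⊆ φ.target := by
    rintro _ ⟨y, hy, rfl⟩
    exact φ.map_source (hKx hy)
  have hpe (c : ℂ) {z : ℂ} (hz : z ∈ φ.target) : p c =ᶠ[𝓝 z] chartCoeff β x c := by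
    filter_upwards [φ.open_target.mem_nhds hz] with w hw
    exact Set.indicator_of_mem hw _
  have hp0 (c : ℂ) {z : ℂ} (hz : z ∉ φ '' K) : p c z = 0 := by
    by_cases hzT : z ∈ φ.target
    · simp only [p, Set.indicator_of_mem hzT, chartCoeff]
      exact hβK _ (fun h ↦ hz ⟨_, h, φ.right_inv hzT⟩) _
    · exact Set.indicator_of_notMem hzT _
  have hps (c : ℂ) : ContDiff ℝ 1 (p c) := by
    rw [contDiff_iff_contDiffAt]
    intro z
    by_cases hz : z ∈ φ.target
    · exact (((hβ.contDiffAt_chartCoeff hz c).of_le (by simp)).congr_of_eventuallyEq (hpe c hz))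
    · refine (contDiffAt_const (c := (0 : ℂ))).congr_of_eventuallyEq ?_
      filter_upwards [hC.isClosed.isOpen_compl.mem_nhds fun h ↦ hz (hCT h)] with w hw
      exact hp0 c hw
  have hpc (c : ℂ) : HasCompactSupport (p c) := HasCompactSupport.intro hC fun z hz ↦ hp0 c hz
  have hint (c v : ℂ) : Integrable fun z ↦ fderiv ℝ (p c) z v :=
    (((hps c).continuous_fderiv (by simp)).clm_apply
      continuous_const).integrable_of_hasCompactSupport ((hpc c).fderiv_apply ℝ v)
  have hfin : ∫ z, (fderiv ℝ (p Complex.I) z 1 - fderiv ℝ (p 1) z Complex.I) = 0 := by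
    rw [integral_sub (hint _ _) (hint _ _), integral_fderiv_eq_zero (hps _) (hpc _),
      integral_fderiv_eq_zero (hps _) (hpc _), sub_zero]
  refine Eq.trans ?_
    ((setIntegral_eq_integral_of_forall_compl_eq_zero (s := φ.target) ?_).trans hfin)
  · refine setIntegral_congr_fun φ.open_target.measurableSet fun z hz ↦ ?_
    have hy := φ.map_target hz
    have hpos : (chartLam g x (φ.symm z) : ℂ) ≠ 0 := by exact_mod_cast (chartLam_pos g hy).ne'
    rw [hβ.scalarD_eq g hy, Complex.real_smul, mul_inv_cancel_left₀ hpos, ← hφ, φ.right_inv hz,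
      (hpe _ hz).fderiv_eq, (hpe _ hz).fderiv_eq]
  · intro z hz
    have h0 (c : ℂ) : fderiv ℝ (p c) z = 0 := by
      have : p c =ᶠ[𝓝 z] fun _ ↦ 0 := by
        filter_upwards [hC.isClosed.isOpen_compl.mem_nhds fun h ↦ hz (hCT h)] with w hw
        exact hp0 c hw
      rw [this.fderiv_eq]; exact fderiv_const_apply 0
    simp [h0]

/-- Stokes' theorem on a closed surface. -/
theorem IsScalarForm.integral_scalarD [T2Space X] [CompactSpace X]
    {β : ∀ x : X, Tan x → ℂ} (hβ : IsScalarForm β) :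
    ∫ y, (g.lam y : ℂ)⁻¹ * scalarD β y ∂g.area = 0 := by
  -- Writing `β` as the sum of the forms `ρ_i β` reduces to forms supported in a single chart.
  obtain ⟨S, ρ, hρ, hsupp, -, h1⟩ := exists_finite_partition
    (fun x : X ↦ (chartAt ℂ x).source) (fun x ↦ (chartAt ℂ x).open_source) (mem_chart_source ℂ)
  have hβi (i : X) := hβ.smul (hρ i)
  have e : β = fun x v ↦ ∑ i ∈ S, (ρ i x : ℂ) * β x v := by
    funext x v
    rw [← Finset.sum_mul, ← Complex.ofReal_sum, h1, Complex.ofReal_one, one_mul]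
  have e2 (y : X) : (g.lam y : ℂ)⁻¹ * scalarD β y =
      ∑ i ∈ S, (g.lam y : ℂ)⁻¹ * scalarD (fun x v ↦ (ρ i x : ℂ) * β x v) y := by
    conv_lhs => rw [e]
    rw [scalarD_sum S hβi, Finset.mul_sum]
  simp only [e2]
  rw [integral_finsetSum _ fun i _ ↦ integrable_of_continuous g ((hβi i).continuous_scalarD g)]
  refine Finset.sum_eq_zero fun i _ ↦ ?_
  refine (hβi i).integral_scalarD_of_tsupport g i (isClosed_tsupport (ρ i)) (hsupp i)
    fun y hy v ↦ ?_
  rw [image_eq_zero_of_notMem_tsupport hy, Complex.ofReal_zero, zero_mul]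

end Integration

/-! ### Pointwise inner products of forms. -/

section Pairings

variable {X : Type*} [TopologicalSpace X] [ChartedSpace ℂ X]
  [IsManifold 𝓘(ℝ, ℂ) ∞ X]
  {E : X → Type*} [∀ x, NormedAddCommGroup (E x)] [∀ x, InnerProductSpace ℂ (E x)]
  [∀ x, FiniteDimensional ℂ (E x)] (g : KahlerMetric X)

/-- The pointwise inner product of 1-forms. -/
def ptw1 (a b : Form1 E) (x : X) : ℂ :=
  (g.lam x : ℂ)⁻¹ * (hs (a x (tanOf x 1)) (b x (tanOf x 1)) +
    hs (a x (tanOf x Complex.I)) (b x (tanOf x Complex.I)))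

theorem pair2_eq [MeasurableSpace X] (σ τ : Form2 E) :
    pair2 g σ τ = ∫ x, hs (contract g σ x) (contract g τ x) ∂g.area := by
  refine integral_congr_ae (Eventually.of_forall fun x ↦ ?_)
  simp only [contract, hs_smul_left, hs_smul_right, ← Complex.ofReal_inv, Complex.conj_ofReal]
  ring

theorem hs_real_smul_left {x : X} (r : ℝ) (u v : Module.End ℂ (E x)) :
    hs (r • u) v = r * hs u v := by
  rw [← Complex.coe_smul, hs_smul_left]

theorem hs_real_smul_right {x : X} (r : ℝ) (u v : Module.End ℂ (E x)) :
    hs u (r • v) = r * hs u v := by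
  rw [← Complex.coe_smul, hs_smul_right, Complex.conj_ofReal]

/-- The pointwise product does not depend on the conformal frame `(v, Jv)`. This allows it to be
computed near a point in one chart, although its definition uses the preferred chart at each point.
-/
theorem ptw1_conformal {a b : Form1 E} {x : X} (ha : IsLinearMap ℝ (a x))
    (hb : IsLinearMap ℝ (b x)) {v : Tan x} (hv : v ≠ 0) :
    ptw1 g a b x = ((g.metric.inner x v v : ℝ) : ℂ)⁻¹ *
      (hs (a x v) (b x v) + hs (a x (J x v)) (b x (J x v))) := by
  obtain ⟨p, q, hpq⟩ : ∃ p q : ℝ, v = p • tanOf x 1 + q • J x (tanOf x 1) :=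
    exists_tan_eq (one_ne_zero (α := ℂ)) v
  have hJ : J x v = p • J x (tanOf x 1) - q • tanOf x 1 := by
    rw [hpq, J_add, J_smul, J_smul, J_J, smul_neg, sub_eq_add_neg]
  have hg : g.metric.inner x v v = (p ^ 2 + q ^ 2) * g.lam x := by
    rw [hpq, g.inner_self]; rfl
  have hpos := g.inner_self_pos hv
  rw [hg] at hpos
  have hn : ((p : ℂ) ^ 2 + (q : ℂ) ^ 2) ≠ 0 := by
    have := ((pos_iff_pos_of_mul_pos hpos).mpr (g.lam_pos x)).ne'
    exact_mod_cast this
  have hl : (g.lam x : ℂ) ≠ 0 := by exact_mod_cast (g.lam_pos x).ne'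
  have ea : a x (J x v) = p • a x (tanOf x Complex.I) - q • a x (tanOf x 1) := by
    rw [hJ, J_one, sub_eq_add_neg, ← neg_smul, ha.map_add, ha.map_smul, ha.map_smul, neg_smul,
      sub_eq_add_neg]
  have eb : b x (J x v) = p • b x (tanOf x Complex.I) - q • b x (tanOf x 1) := by
    rw [hJ, J_one, sub_eq_add_neg, ← neg_smul, hb.map_add, hb.map_smul, hb.map_smul, neg_smul,
      sub_eq_add_neg]
  have ea' : a x v = p • a x (tanOf x 1) + q • a x (tanOf x Complex.I) := by
    rw [hpq, J_one, ha.map_add, ha.map_smul, ha.map_smul]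
  have eb' : b x v = p • b x (tanOf x 1) + q • b x (tanOf x Complex.I) := by
    rw [hpq, J_one, hb.map_add, hb.map_smul, hb.map_smul]
  rw [hg, ea, eb, ea', eb', ptw1]
  simp only [hs_add_left, hs_add_right, hs_sub_left, hs_sub_right, hs_real_smul_left,
    hs_real_smul_right]
  push_cast
  field_simp
  ring

theorem ptw1_add_left (a b c : Form1 E) (x : X) :
    ptw1 g (a + b) c x = ptw1 g a c x + ptw1 g b c x := by
  simp only [ptw1, Pi.add_apply, hs_add_left]; ring

theorem ptw1_smul_left (r : ℂ) (a c : Form1 E) (x : X) :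
    ptw1 g (r • a) c x = r * ptw1 g a c x := by
  simp only [ptw1, Pi.smul_apply, hs_smul_left]; ring

theorem ptw1_conj_symm (a b : Form1 E) (x : X) :
    starRingEnd ℂ (ptw1 g a b x) = ptw1 g b a x := by
  simp only [ptw1, map_mul, map_add, hs_conj_symm, ← Complex.ofReal_inv, Complex.conj_ofReal]

theorem ptw1_self_nonneg (a : Form1 E) (x : X) : 0 ≤ (ptw1 g a a x).re := by
  rw [ptw1, ← Complex.ofReal_inv, Complex.re_ofReal_mul, Complex.add_re]
  exact mul_nonneg (inv_nonneg.mpr (g.lam_pos x).le)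
    (add_nonneg (hs_self_nonneg _) (hs_self_nonneg _))

theorem ptw1_self_ofReal (a : Form1 E) (x : X) : (((ptw1 g a a x).re : ℝ) : ℂ) = ptw1 g a a x := by
  rw [ptw1, ← Complex.ofReal_inv, Complex.re_ofReal_mul, Complex.add_re, Complex.ofReal_mul,
    Complex.ofReal_add, hs_self_ofReal, hs_self_ofReal]

theorem eq_zero_of_ptw1_self {a : Form1 E} {x : X} (ha : IsLinearMap ℝ (a x))
    (h : (ptw1 g a a x).re = 0) (v : Tan x) : a x v = 0 := by
  rw [ptw1, ← Complex.ofReal_inv, Complex.re_ofReal_mul, Complex.add_re, mul_eq_zero,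
    inv_eq_zero] at h
  have h2 := h.resolve_left (g.lam_pos x).ne'
  have h3 := hs_self_nonneg (a x (tanOf x 1))
  have h4 := hs_self_nonneg (a x (tanOf x Complex.I))
  have e1 := hs_self_eq_zero (u := a x (tanOf x 1)) (by linarith)
  have e2 := hs_self_eq_zero (u := a x (tanOf x Complex.I)) (by linarith)
  rw [tan_eq x v, ha.map_add, ha.map_smul, ha.map_smul, e1, e2, smul_zero, smul_zero, add_zero]

/-- The projection to type `(1,0)` is self-adjoint: precomposition with `J` is skew for the
pointwise product, and so is multiplication by `i`. -/
theorem ptw1_part10 {a b : Form1 E} {x : X} (ha : IsLinearMap ℝ (a x))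
    (hb : IsLinearMap ℝ (b x)) : ptw1 g (part10 a) b x = ptw1 g a (part10 b) x := by
  simp only [ptw1, part10, J_one, J_I, ha.map_neg, hb.map_neg, hs_smul_left, hs_smul_right,
    hs_sub_left, hs_sub_right, hs_neg_left, hs_neg_right, smul_neg, map_div₀, map_one, map_ofNat,
    Complex.conj_I]
  ring

end Pairings

/-! ### The `L²` pairings of continuous forms. -/

section ContinuousPairings

variable {X : Type*} [TopologicalSpace X] [ChartedSpace ℂ X] [IsManifold 𝓘(ℂ) ω X]
  [IsManifold 𝓘(ℝ, ℂ) ∞ X]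
  {F : Type*} [NormedAddCommGroup F] [NormedSpace ℂ F] [FiniteDimensional ℂ F]
  {E : X → Type*} [TopologicalSpace (TotalSpace F E)]
  [∀ x, NormedAddCommGroup (E x)] [∀ x, InnerProductSpace ℂ (E x)]
  [∀ x, FiniteDimensional ℂ (E x)]
  [FiberBundle F E] [VectorBundle ℝ F E] [VectorBundle ℂ F E]
  [ContMDiffVectorBundle ∞ F E 𝓘(ℝ, ℂ)] (g : KahlerMetric X)

theorem continuous_hs (hE : IsSmoothHermitian E F) {u v : Form0 E} (hu : IsForm0 F 0 u)
    (hv : IsForm0 F 0 v) : Continuous fun x ↦ hs (u x) (v x) :=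
  continuous_iff_continuousAt.mpr fun x ↦
    ((isForm0_iff.mp hu x).hs hE (by simp) (isForm0_iff.mp hv x)).continuousAt

theorem continuous_ptw1 (hE : IsSmoothHermitian E F) {a b : Form1 E} (ha : IsForm1 F 0 a)
    (hb : IsForm1 F 0 b) : Continuous (ptw1 g a b) := by
  rw [continuous_iff_continuousAt]
  intro x
  have hx := mem_chart_source ℂ x
  have hV := fieldCnAt_extendTan hx (tanOf x 1) 0 (by simp)
  have hJV := fieldCnAt_J (by simp) hV
  have h1 := ((ha.endCnAt hV).hs hE (by simp) (hb.endCnAt hV)).continuousAt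
  have h2 := ((ha.endCnAt hJV).hs hE (by simp) (hb.endCnAt hJV)).continuousAt
  have h3 : ContinuousAt (fun y ↦ (chartLam g x y : ℂ)) x :=
    Complex.continuous_ofReal.continuousAt.comp
      (contMDiffAt_chartLam g hx (n := 0) (by simp)).continuousAt
  refine ((h3.inv₀ (by exact_mod_cast (chartLam_pos g hx).ne')).mul (h1.add h2)).congr ?_
  filter_upwards [(chartAt ℂ x).open_source.mem_nhds hx] with y hy
  exact (ptw1_conformal g (ha.1 y) (hb.1 y)
    (extendTan_ne_zero hy (one_ne_zero (α := ℂ)))).symm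

variable [MeasurableSpace X] [BorelSpace X] [CompactSpace X]

theorem integrable_ptw1 (hE : IsSmoothHermitian E F) {a b : Form1 E} (ha : IsForm1 F 0 a)
    (hb : IsForm1 F 0 b) : Integrable (ptw1 g a b) g.area :=
  integrable_of_continuous g (continuous_ptw1 g hE ha hb)

theorem pair1_conj_symm (a b : Form1 E) : starRingEnd ℂ (pair1 g a b) = pair1 g b a := by
  rw [pair1, ← integral_conj]
  exact integral_congr_ae (Eventually.of_forall fun x ↦ ptw1_conj_symm g a b x)

theorem pair1_smul_left (r : ℂ) (a b : Form1 E) : pair1 g (r • a) b = r * pair1 g a b := by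
  rw [pair1, pair1, ← integral_const_mul]
  exact integral_congr_ae (Eventually.of_forall fun x ↦ ptw1_smul_left g r a b x)

theorem pair1_smul_right (r : ℂ) (a b : Form1 E) :
    pair1 g a (r • b) = starRingEnd ℂ r * pair1 g a b := by
  rw [← pair1_conj_symm, pair1_smul_left, map_mul, pair1_conj_symm]

theorem pair1_add_left (hE : IsSmoothHermitian E F) {a b c : Form1 E} (ha : IsForm1 F 0 a)
    (hb : IsForm1 F 0 b) (hc : IsForm1 F 0 c) :
    pair1 g (a + b) c = pair1 g a c + pair1 g b c := by
  refine (integral_congr_ae (Eventually.of_forall fun x ↦ ptw1_add_left g a b c x)).trans ?_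
  exact integral_add (integrable_ptw1 g hE ha hc) (integrable_ptw1 g hE hb hc)

theorem pair1_add_right (hE : IsSmoothHermitian E F) {a b c : Form1 E} (ha : IsForm1 F 0 a)
    (hb : IsForm1 F 0 b) (hc : IsForm1 F 0 c) :
    pair1 g c (a + b) = pair1 g c a + pair1 g c b := by
  rw [← pair1_conj_symm, pair1_add_left g hE ha hb hc, map_add, pair1_conj_symm, pair1_conj_symm]

theorem pair1_neg_right (a b : Form1 E) : pair1 g a (-b) = -pair1 g a b := by
  rw [← neg_one_smul ℂ b, pair1_smul_right, map_neg, map_one, neg_one_mul]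

theorem pair1_sub_right (hE : IsSmoothHermitian E F) {a b c : Form1 E} (ha : IsForm1 F 0 a)
    (hb : IsForm1 F 0 b) (hc : IsForm1 F 0 c) :
    pair1 g c (a - b) = pair1 g c a - pair1 g c b := by
  rw [sub_eq_add_neg, pair1_add_right g hE ha hb.neg hc, pair1_neg_right, sub_eq_add_neg]

theorem pair1_self_eq (a : Form1 E) :
    pair1 g a a = ((∫ x, (ptw1 g a a x).re ∂g.area : ℝ) : ℂ) := by
  rw [← integral_complex_ofReal]
  exact integral_congr_ae (Eventually.of_forall fun x ↦ (ptw1_self_ofReal g a x).symm)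

theorem pair1_self_nonneg (a : Form1 E) : 0 ≤ (pair1 g a a).re := by
  rw [pair1_self_eq, Complex.ofReal_re]
  exact integral_nonneg fun x ↦ ptw1_self_nonneg g a x

/-- The function vanishes almost everywhere, hence everywhere, since the area of a nonempty open set
is positive. -/
theorem eq_zero_of_integral_nonneg {f : X → ℝ} (hf : Continuous f) (h0 : ∀ x, 0 ≤ f x)
    (h : ∫ x, f x ∂g.area = 0) : f = 0 := by
  have hi : Integrable f g.area := by
    have := (integrable_of_continuous g (Complex.continuous_ofReal.comp hf)).re
    simpa using this
  rw [integral_eq_zero_iff_of_nonneg h0 hi] at h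
  exact (hf.ae_eq_iff_eq g.area continuous_const).mp h

theorem eq_zero_of_pair1_self (hE : IsSmoothHermitian E F) {a : Form1 E} (ha : IsForm1 F 0 a)
    (h : (pair1 g a a).re = 0) : a = 0 := by
  rw [pair1_self_eq, Complex.ofReal_re] at h
  have h2 := eq_zero_of_integral_nonneg g
    (Complex.continuous_re.comp (continuous_ptw1 g hE ha ha)) (ptw1_self_nonneg g a) h
  funext x v
  exact eq_zero_of_ptw1_self g (ha.1 x) (congrFun h2 x) v

theorem integrable_hs (hE : IsSmoothHermitian E F) {u v : Form0 E} (hu : IsForm0 F 0 u)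
    (hv : IsForm0 F 0 v) : Integrable (fun x ↦ hs (u x) (v x)) g.area :=
  integrable_of_continuous g (continuous_hs hE hu hv)

theorem pair2_add_left (hE : IsSmoothHermitian E F) {σ σ' τ : Form2 E} (hσ : IsForm2 F 0 σ)
    (hσ' : IsForm2 F 0 σ') (hτ : IsForm2 F 0 τ) :
    pair2 g (σ + σ') τ = pair2 g σ τ + pair2 g σ' τ := by
  simp only [pair2_eq]
  rw [← integral_add (integrable_hs g hE (hσ.contract g (by simp)) (hτ.contract g (by simp)))
    (integrable_hs g hE (hσ'.contract g (by simp)) (hτ.contract g (by simp)))]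
  refine integral_congr_ae (Eventually.of_forall fun x ↦ ?_)
  simp only [contract, Pi.add_apply, smul_add, hs_add_left]

theorem pair2_smul_left (r : ℂ) (σ τ : Form2 E) : pair2 g (r • σ) τ = r * pair2 g σ τ := by
  rw [pair2, pair2, ← integral_const_mul]
  refine integral_congr_ae (Eventually.of_forall fun x ↦ ?_)
  simp only [Pi.smul_apply, hs_smul_left]
  ring

theorem pair2_neg_left (σ τ : Form2 E) : pair2 g (-σ) τ = -pair2 g σ τ := by
  rw [← neg_one_smul ℂ σ, pair2_smul_left, neg_one_mul]

theorem pair2_sub_left (hE : IsSmoothHermitian E F) {σ σ' τ : Form2 E} (hσ : IsForm2 F 0 σ)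
    (hσ' : IsForm2 F 0 σ') (hτ : IsForm2 F 0 τ) :
    pair2 g (σ - σ') τ = pair2 g σ τ - pair2 g σ' τ := by
  have hn : IsForm2 F 0 (-σ') := by simpa using hσ'.const_smul (-1)
  rw [sub_eq_add_neg, pair2_add_left g hE hσ hn hτ, pair2_neg_left, sub_eq_add_neg]

theorem eq_zero_of_pair2_self (hE : IsSmoothHermitian E F) {σ : Form2 E} (hσ : IsForm2 F 0 σ)
    (h : (pair2 g σ σ).re = 0) : σ = 0 := by
  have hc := hσ.contract g (by simp)
  have h1 : pair2 g σ σ = ((∫ x, (hs (contract g σ x) (contract g σ x)).re ∂g.area : ℝ) : ℂ) := by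
    rw [pair2_eq, ← integral_complex_ofReal]
    exact integral_congr_ae (Eventually.of_forall fun x ↦ (hs_self_ofReal _).symm)
  rw [h1, Complex.ofReal_re] at h
  have h2 := eq_zero_of_integral_nonneg g (Complex.continuous_re.comp (continuous_hs hE hc hc))
    (fun x ↦ hs_self_nonneg _) h
  refine hσ.eq_zero fun x ↦ ?_
  have h3 := hs_self_eq_zero (congrFun h2 x)
  simpa [contract, (g.lam_pos x).ne'] using h3

end ContinuousPairings

/-! ### Formal adjoints of `d_A`, `∂̄_A` and `D''`. -/

section IntegrationByParts

variable {X : Type*} [TopologicalSpace X] [ChartedSpace ℂ X] [IsManifold 𝓘(ℂ) ω X]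
  [IsManifold 𝓘(ℝ, ℂ) ∞ X]
  {F : Type*} [NormedAddCommGroup F] [NormedSpace ℂ F] [FiniteDimensional ℂ F]
  {E : X → Type*} [TopologicalSpace (TotalSpace F E)]
  [∀ x, NormedAddCommGroup (E x)] [∀ x, InnerProductSpace ℂ (E x)]
  [∀ x, FiniteDimensional ℂ (E x)]
  [FiberBundle F E] [VectorBundle ℝ F E] [VectorBundle ℂ F E]
  [ContMDiffVectorBundle ∞ F E 𝓘(ℝ, ℂ)] (g : KahlerMetric X)
  (A : UnitaryConnection F E)

theorem extendTan_self {x : X} (v : Tan x) : extendTan v x = v :=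
  FiberBundle.extend_apply_self ℂ v

theorem extCov_eq {c : Form1 E} {x : X} (hc : IsLinearMap ℝ (c x)) (v w : Tan x) :
    extCov A c x v w = covEnd A (fun y ↦ c y (extendTan w y)) x v -
      covEnd A (fun y ↦ c y (extendTan v y)) x w := by
  rw [extCov, mlieBracket_extendTan, hc.map_zero, sub_zero]

theorem isScalarForm_hs (hE : IsSmoothHermitian E F) {f : Form0 E} {c : Form1 E}
    (hf : IsForm0 F ∞ f) (hc : IsForm1 F ∞ c) : IsScalarForm fun x v ↦ hs (f x) (c x v) := by
  refine ⟨fun x ↦ ⟨fun v w ↦ ?_, fun r v ↦ ?_⟩, fun V x hV ↦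
    (isForm0_iff.mp hf x).hs hE le_rfl (hc.endCnAt hV)⟩
  · rw [(hc.1 x).map_add, hs_add_right]
  · rw [(hc.1 x).map_smul, hs_real_smul_right, Complex.real_smul]

/-- The covariant derivative precomposed with the complex structure. -/
def covJ (f : Form0 E) : Form1 E := fun x v ↦ covEnd A f x (J x v)

theorem isForm1_covJ (hE : IsSmoothHermitian E F) {f : Form0 E} (hf : IsForm0 F ∞ f) :
    IsForm1 F ∞ (covJ A f) := (isForm1_covEnd A hE hf).comp_J le_rfl

/-- The Leibniz rule for `⟨f, c⟩`. Since `J` sends `1` to `i` and `i` to `-1`, the antisymmetrized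
terms with `∇f` become the pointwise product of `∇f ∘ J` with `c`. -/
theorem hs_extCov (hE : IsSmoothHermitian E F) {f : Form0 E} {c : Form1 E}
    (hf : IsForm0 F ∞ f) (hc : IsForm1 F ∞ c) (x : X) :
    (g.lam x : ℂ)⁻¹ * hs (f x) (extCov A c x (tanOf x 1) (tanOf x Complex.I)) =
      (g.lam x : ℂ)⁻¹ * scalarD (fun x v ↦ hs (f x) (c x v)) x + ptw1 g (covJ A f) c x := by
  have hx := mem_chart_source ℂ x
  have h (w v : Tan x) := mvfderiv_hs A hE (isForm0_iff.mp hf x)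
    (hc.endCnAt_extend le_rfl hx w) v
  have hneg : covEnd A f x (-tanOf x 1) = -covEnd A f x (tanOf x 1) :=
    (covEnd_isLinearMap A f hE (isForm0_iff.mp hf x)).map_neg _
  rw [extCov_eq A (hc.1 x), scalarD, h, h, ptw1]
  simp only [covJ, J_one, J_I, hneg, extendTan_self, hs_sub_right, hs_neg_left]
  ring

theorem pair2_eq_contract [MeasurableSpace X] (σ τ : Form2 E) :
    pair2 g σ τ = ∫ x, (g.lam x : ℂ)⁻¹ *
      hs (contract g σ x) (τ x (tanOf x 1) (tanOf x Complex.I)) ∂g.area := by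
  refine integral_congr_ae (Eventually.of_forall fun x ↦ ?_)
  simp only [contract, hs_smul_left]
  ring

variable [MeasurableSpace X] [BorelSpace X] [CompactSpace X] [T2Space X]

/-- Continuity is read off the two terms on the right of the Leibniz rule, with no separate
regularity statement for `d_A c`. -/
theorem continuous_hs_extCov (hE : IsSmoothHermitian E F) {f : Form0 E} {c : Form1 E}
    (hf : IsForm0 F ∞ f) (hc : IsForm1 F ∞ c) : Continuous fun x ↦
    (g.lam x : ℂ)⁻¹ * hs (f x) (extCov A c x (tanOf x 1) (tanOf x Complex.I)) := by
  simp only [hs_extCov g A hE hf hc]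
  exact ((isScalarForm_hs hE hf hc).continuous_scalarD g).add
    (continuous_ptw1 g hE ((isForm1_covJ A hE hf).of_le hE (by simp)) (hc.of_le hE (by simp)))

/-- The formal adjoint of the exterior covariant derivative. -/
theorem pair2_extCov (hE : IsSmoothHermitian E F) {σ : Form2 E} {c : Form1 E}
    (hσ : IsForm2 F ∞ σ) (hc : IsForm1 F ∞ c) :
    pair2 g σ (extCov A c) = pair1 g (covJ A (contract g σ)) c := by
  have hf := hσ.contract g le_rfl
  have hs' := isScalarForm_hs hE hf hc
  rw [pair2_eq_contract]
  simp only [hs_extCov g A hE hf hc]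
  rw [integral_add (integrable_of_continuous g (hs'.continuous_scalarD g))
    (integrable_ptw1 g hE ((isForm1_covJ A hE hf).of_le hE (by simp)) (hc.of_le hE (by simp))),
    hs'.integral_scalarD g, zero_add]
  rfl

theorem pair1_part10 {a b : Form1 E} (ha : ∀ x, IsLinearMap ℝ (a x))
    (hb : ∀ x, IsLinearMap ℝ (b x)) : pair1 g (part10 a) b = pair1 g a (part10 b) :=
  integral_congr_ae (Eventually.of_forall fun x ↦ ptw1_part10 g (ha x) (hb x))

theorem pair2_dbar1 (hE : IsSmoothHermitian E F) {σ : Form2 E} {c : Form1 E}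
    (hσ : IsForm2 F ∞ σ) (hc : IsForm1 F ∞ c) :
    pair2 g σ (dbar1 A c) = pair1 g (part10 (covJ A (contract g σ))) c := by
  rw [dbar1, pair2_extCov g A hE hσ (hc.part10 le_rfl), pair1_part10 g _ hc.1]
  exact (isForm1_covJ A hE (hσ.contract g le_rfl)).1

variable (P : HitchinPair F E)

/-- The zeroth order part of the adjoint of `D''`. -/
def higgsAdj (f : Form0 E) : Form1 E := fun x v ↦ -⁅LinearMap.adjoint (P.Φ x (J x v)), f x⁆

/-- The formal adjoint of `D''` on 2-forms. -/
def dstar (σ : Form2 E) : Form1 E :=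
  part10 (covJ P.A (contract g σ)) + higgsAdj P (contract g σ)

theorem isForm1_higgsAdj (hE : IsSmoothHermitian E F) {n : ℕ∞ω} (hn : n ≤ (∞ : ℕ∞ω)) {f : Form0 E}
    (hf : IsForm0 F n f) : IsForm1 F n (higgsAdj P f) :=
  ((((P.smooth.of_le hE hn).comp_J hn).adjoint hE hn).lie_right hf).neg

theorem isForm1_dstar (hE : IsSmoothHermitian E F) {σ : Form2 E} (hσ : IsForm2 F ∞ σ) :
    IsForm1 F ∞ (dstar g P σ) :=
  ((isForm1_covJ P.A hE (hσ.contract g le_rfl)).part10 le_rfl).add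
    (isForm1_higgsAdj P hE le_rfl (hσ.contract g le_rfl))

/-- Bracketing is moved across the trace pairing; this identifies the zeroth order part `higgsAdj`
of the adjoint. -/
theorem hs_bracket_right {f : Form0 E} {a b : Form1 E} (x : X) (v w : Tan x) :
    hs (f x) (bracket a b x v w) = hs ⁅LinearMap.adjoint (a x v), f x⁆ (b x w) -
      hs ⁅LinearMap.adjoint (a x w), f x⁆ (b x v) := by
  have h (a b t : Module.End ℂ (E x)) : hs t ⁅a, b⁆ = hs ⁅LinearMap.adjoint a, t⁆ b := by
    rw [← hs_conj_symm, hs_lie_right, hs_conj_symm]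
  rw [bracket, hs_sub_right, h, h]

theorem ptw1_higgsAdj (f : Form0 E) (c : Form1 E) (x : X) :
    (g.lam x : ℂ)⁻¹ * hs (f x) (bracket P.Φ c x (tanOf x 1) (tanOf x Complex.I)) =
      ptw1 g (higgsAdj P f) c x := by
  rw [hs_bracket_right, ptw1]
  simp only [higgsAdj, J_one, J_I, (P.smooth.1 x).map_neg, map_neg, end_neg_lie, hs_neg_left,
    neg_neg]
  ring

theorem pair2_bracket_higgs (f : Form2 E) (c : Form1 E) :
    pair2 g f (bracket P.Φ c) = pair1 g (higgsAdj P (contract g f)) c := by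
  rw [pair2_eq_contract]
  exact integral_congr_ae (Eventually.of_forall fun x ↦ ptw1_higgsAdj g P _ c x)

theorem pair2_D1 (hE : IsSmoothHermitian E F) {σ : Form2 E} {c : Form1 E}
    (hσ : IsForm2 F ∞ σ) (hc : IsForm1 F ∞ c) :
    pair2 g σ (D1 P c) = pair1 g (dstar g P σ) c := by
  have hf := hσ.contract g le_rfl
  have h1 : pair2 g σ (D1 P c) = pair2 g σ (dbar1 P.A c) + pair2 g σ (bracket P.Φ c) := by
    simp only [pair2_eq_contract]
    rw [← integral_add]
    · refine integral_congr_ae (Eventually.of_forall fun x ↦ ?_)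
      simp only [D1, Pi.add_apply, hs_add_right, mul_add]
    · exact integrable_of_continuous g (continuous_hs_extCov g P.A hE hf (hc.part10 le_rfl))
    · simp only [ptw1_higgsAdj]
      exact integrable_ptw1 g hE ((isForm1_higgsAdj P hE le_rfl hf).of_le hE (by simp))
        (hc.of_le hE (by simp))
  rw [h1, pair2_dbar1 g P.A hE hσ hc, pair2_bracket_higgs, dstar, pair1_add_left g hE]
  · exact ((isForm1_covJ P.A hE hf).part10 le_rfl).of_le hE (by simp)
  · exact (isForm1_higgsAdj P hE le_rfl hf).of_le hE (by simp)
  · exact hc.of_le hE (by simp)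

/-- Test the weak equation against `dstar g P h` itself: its squared `L²` norm is zero. -/
theorem dstar_eq_zero (hE : IsSmoothHermitian E F) {h : Form2 E} (hh : h ∈ H2 P g) :
    dstar g P h = 0 := by
  have hd := isForm1_dstar g P hE hh.1
  have h0 := hh.2 _ hd
  rw [pair2_D1 g P hE hh.1 hd] at h0
  exact eq_zero_of_pair1_self g hE (hd.of_le hE (by simp)) (by rw [h0]; rfl)

end IntegrationByParts

/-! ### Commuting second derivatives and `d_A ∇u = [F_A, u]`. -/

section Curvature

variable {X : Type*} [TopologicalSpace X] [ChartedSpace ℂ X] [IsManifold 𝓘(ℂ) ω X]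
  [IsManifold 𝓘(ℝ, ℂ) ∞ X]

theorem mvfderiv_extendTan {f : X → ℂ} {x y : X} (hy : y ∈ (chartAt ℂ x).source)
    (hf : MDifferentiableAt 𝓘(ℝ, ℂ) 𝓘(ℝ, ℂ) f y) (c : ℂ) :
    mvfderiv 𝓘(ℝ, ℂ) f y (extendTan (tanOf x c) y) =
      fderiv ℝ (fun z ↦ f ((chartAt ℂ x).symm z)) (chartAt ℂ x y) c := by
  have hz := (chartAt ℂ x).map_source hy
  have hl := (chartAt ℂ x).left_inv hy
  have h1 := mfderiv_chart_symm hz c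
  have hf' : MDifferentiableAt 𝓘(ℝ, ℂ) 𝓘(ℝ, ℂ) f ((chartAt ℂ x).symm (chartAt ℂ x y)) := by
    rwa [hl]
  have h2 := mfderiv_comp (chartAt ℂ x y) hf' ((contMDiffAt_chart_symm hz).mdifferentiableAt (by simp))
  rw [mfderiv_eq_fderiv] at h2
  have h3 : mvfderiv 𝓘(ℝ, ℂ) f ((chartAt ℂ x).symm (chartAt ℂ x y))
      (extendTan (tanOf x c) ((chartAt ℂ x).symm (chartAt ℂ x y))) =
      fderiv ℝ (fun z ↦ f ((chartAt ℂ x).symm z)) (chartAt ℂ x y) c := by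
    rw [← h1]
    exact (congrArg (fun L : ℂ →L[ℝ] ℂ ↦ L c) h2).symm
  rwa [hl] at h3

theorem eventually_mvfderiv_extendTan {f : X → ℂ} {x : X}
    (hf : ∀ᶠ y in 𝓝 x, ContMDiffAt 𝓘(ℝ, ℂ) 𝓘(ℝ, ℂ) ∞ f y) (c : ℂ) :
    (fun y ↦ mvfderiv 𝓘(ℝ, ℂ) f y (extendTan (tanOf x c) y)) =ᶠ[𝓝 x] fun y ↦
      fderiv ℝ (fun z ↦ f ((chartAt ℂ x).symm z)) (chartAt ℂ x y) c := by
  filter_upwards [hf, (chartAt ℂ x).open_source.mem_nhds (mem_chart_source ℂ x)] with y h1 hy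
  exact mvfderiv_extendTan hy (h1.mdifferentiableAt (by simp)) c

theorem contDiffAt_comp_chart_symm {f : X → ℂ} {x : X}
    (hf : ContMDiffAt 𝓘(ℝ, ℂ) 𝓘(ℝ, ℂ) ∞ f x) :
    ContDiffAt ℝ ∞ (fun z ↦ f ((chartAt ℂ x).symm z)) (chartAt ℂ x x) := by
  have h1 : ContMDiffAt 𝓘(ℝ, ℂ) 𝓘(ℝ, ℂ) ∞ f ((chartAt ℂ x).symm (chartAt ℂ x x)) := by
    rwa [(chartAt ℂ x).left_inv (mem_chart_source ℂ x)]
  exact (ContMDiffAt.comp _ h1 (contMDiffAt_chart_symm (mem_chart_target ℂ x))).contDiffAt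

/-- Near `x` the derivative along a coordinate field is a partial derivative in the fixed chart at
`x`. -/
theorem contMDiffAt_mvfderiv_extendTan {f : X → ℂ} {x : X}
    (hf : ∀ᶠ y in 𝓝 x, ContMDiffAt 𝓘(ℝ, ℂ) 𝓘(ℝ, ℂ) ∞ f y) (w : Tan x) :
    ContMDiffAt 𝓘(ℝ, ℂ) 𝓘(ℝ, ℂ) ∞ (fun y ↦ mvfderiv 𝓘(ℝ, ℂ) f y (extendTan w y)) x := by
  refine ContMDiffAt.congr_of_eventuallyEq ?_ (eventually_mvfderiv_extendTan hf (w : ℂ))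
  have h1 : ContDiffAt ℝ ∞ (fun z ↦ fderiv ℝ (fun z ↦ f ((chartAt ℂ x).symm z)) z (w : ℂ))
      (chartAt ℂ x x) :=
    ((contDiffAt_comp_chart_symm hf.self_of_nhds).fderiv_right (by simp)).clm_apply contDiffAt_const
  exact ContMDiffAt.comp x h1.contMDiffAt (contMDiffAt_of_mem_maximalAtlas
    (IsManifold.chart_mem_maximalAtlas x) (mem_chart_source ℂ x))

/-- Second derivatives along coordinate fields commute. -/
theorem mvfderiv_mvfderiv_comm {f : X → ℂ} {x : X}
    (hf : ∀ᶠ y in 𝓝 x, ContMDiffAt 𝓘(ℝ, ℂ) 𝓘(ℝ, ℂ) ∞ f y) (v w : Tan x) :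
    mvfderiv 𝓘(ℝ, ℂ) (fun y ↦ mvfderiv 𝓘(ℝ, ℂ) f y (extendTan w y)) x v =
      mvfderiv 𝓘(ℝ, ℂ) (fun y ↦ mvfderiv 𝓘(ℝ, ℂ) f y (extendTan v y)) x w := by
  have hs := contDiffAt_comp_chart_symm hf.self_of_nhds
  set q : ℂ → ℂ := fun z ↦ f ((chartAt ℂ x).symm z)
  have hD : DifferentiableAt ℝ (fderiv ℝ q) (chartAt ℂ x x) :=
    (hs.fderiv_right (m := ∞) (by simp)).differentiableAt (by simp)
  have key (a b : ℂ) : mvfderiv 𝓘(ℝ, ℂ)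
      (fun y ↦ mvfderiv 𝓘(ℝ, ℂ) f y (extendTan (tanOf x b) y)) x (tanOf x a) =
      fderiv ℝ (fderiv ℝ q) (chartAt ℂ x x) a b := by
    rw [mvfderiv_eq_fderiv ((contMDiffAt_mvfderiv_extendTan hf _).mdifferentiableAt (by simp))]
    have hev : (fun z ↦ mvfderiv 𝓘(ℝ, ℂ) f ((chartAt ℂ x).symm z)
        (extendTan (tanOf x b) ((chartAt ℂ x).symm z))) =ᶠ[𝓝 (chartAt ℂ x x)]
        fun z ↦ fderiv ℝ q z b := by
      have hc : ContinuousAt (chartAt ℂ x).symm (chartAt ℂ x x) :=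
        (chartAt ℂ x).continuousAt_symm (mem_chart_target ℂ x)
      have ht := hc.tendsto
      rw [(chartAt ℂ x).left_inv (mem_chart_source ℂ x)] at ht
      filter_upwards [ht.eventually (eventually_mvfderiv_extendTan hf b),
        (chartAt ℂ x).open_target.mem_nhds (mem_chart_target ℂ x)] with z hz hzt
      rw [hz, (chartAt ℂ x).right_inv hzt]
    rw [hev.fderiv_eq]
    have h := (ContinuousLinearMap.apply ℝ ℂ b).hasFDerivAt.comp _ hD.hasFDerivAt
    exact congrArg (fun L : ℂ →L[ℝ] ℂ ↦ L a) h.fderiv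
  refine (key v w).trans (Eq.trans ?_ (key w v).symm)
  exact hs.isSymmSndFDerivAt (by simp; exact ENat.LEInfty.out) (v : ℂ) (w : ℂ)

variable
  {F : Type*} [NormedAddCommGroup F] [NormedSpace ℂ F] [FiniteDimensional ℂ F]
  {E : X → Type*} [TopologicalSpace (TotalSpace F E)]
  [∀ x, NormedAddCommGroup (E x)] [∀ x, InnerProductSpace ℂ (E x)]
  [∀ x, FiniteDimensional ℂ (E x)]
  [FiberBundle F E] [VectorBundle ℝ F E] [VectorBundle ℂ F E]
  [ContMDiffVectorBundle ∞ F E 𝓘(ℝ, ℂ)] (A : UnitaryConnection F E)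

/-- The commutator of second covariant derivatives along coordinate fields. -/
def covComm (s : ∀ y, E y) (x : X) (v w : Tan x) : E x :=
  A.cov (fun y ↦ A.cov s y (extendTan w y)) x v - A.cov (fun y ↦ A.cov s y (extendTan v y)) x w

theorem curvature_eq (x : X) (v w : Tan x) (e : E x) :
    curvature A x v w e = covComm A (FiberBundle.extend F e) x v w := by
  rw [curvature, mlieBracket_extendTan, map_zero, sub_zero, covComm]

theorem secCnAt_cov_extendTan {x : X} {s : ∀ y, E y} (hs : ∀ᶠ y in 𝓝 x, SecCnAt F ∞ s y)
    (w : Tan x) : SecCnAt F ∞ (fun y ↦ A.cov s y (extendTan w y)) x :=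
  A.secCnAt_cov hs (fieldCnAt_extendTan (mem_chart_source ℂ x) w ∞ le_rfl)

/-- Tensoriality of the curvature. In `∇_v ∇_w (f s)` the mixed first-order terms are symmetric in
`v` and `w`, and the second derivatives of `f` commute, so only `f` times the commutator survives.
Sections have to be smooth near `x`, since two derivatives are taken. -/
theorem exists_curvature (hE : IsSmoothHermitian E F) (x : X) (v w : Tan x) :
    ∃ R : Module.End ℂ (E x), ∀ s : ∀ y, E y, (∀ᶠ y in 𝓝 x, SecCnAt F ∞ s y) →
      covComm A s x v w = R (s x) := by
  refine exists_linearMap_of_tensorial hE le_rfl (fun s ↦ covComm A s x v w) ?_ ?_ ?_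
  · intro s t hs h
    have h' (u : Tan x) : ∀ᶠ y in 𝓝 x, A.cov t y (extendTan u y) = A.cov s y (extendTan u y) := by
      filter_upwards [hs, h.eventually_nhds] with y h1 h2
      rw [A.cov_congr h1 h2]
    simp only [covComm]
    rw [A.cov_congr (secCnAt_cov_extendTan A hs w) (h' w),
      A.cov_congr (secCnAt_cov_extendTan A hs v) (h' v)]
  · intro s t hs ht
    have h' (u : Tan x) : ∀ᶠ y in 𝓝 x, A.cov (fun y ↦ s y + t y) y (extendTan u y) =
        A.cov s y (extendTan u y) + A.cov t y (extendTan u y) := by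
      filter_upwards [hs, ht] with y h1 h2
      rw [A.cov_add h1 h2, _root_.add_apply]
    have hadd (u : Tan x) := (secCnAt_cov_extendTan A hs u).add (secCnAt_cov_extendTan A ht u)
    simp only [covComm]
    rw [A.cov_congr (hadd w) (h' w), A.cov_congr (hadd v) (h' v),
      A.cov_add (secCnAt_cov_extendTan A hs w) (secCnAt_cov_extendTan A ht w),
      A.cov_add (secCnAt_cov_extendTan A hs v) (secCnAt_cov_extendTan A ht v),
      _root_.add_apply, _root_.add_apply]
    abel
  · intro f s hf hs
    have hf0 := hf.self_of_nhds
    have hs0 := hs.self_of_nhds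
    have h' (u : Tan x) : ∀ᶠ y in 𝓝 x, A.cov (fun y ↦ f y • s y) y (extendTan u y) =
        f y • A.cov s y (extendTan u y) + mvfderiv 𝓘(ℝ, ℂ) f y (extendTan u y) • s y := by
      filter_upwards [hf, hs] with y h1 h2
      rw [A.cov_smul h1 h2]
    have hd (u : Tan x) := contMDiffAt_mvfderiv_extendTan hf u
    have h1 (u : Tan x) := (secCnAt_cov_extendTan A hs u).smul hf0
    have h2 (u : Tan x) := hs0.smul (hd u)
    have hc (u u' : Tan x) : A.cov (fun y ↦ A.cov (fun y ↦ f y • s y) y (extendTan u y)) x u' =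
        f x • A.cov (fun y ↦ A.cov s y (extendTan u y)) x u' +
          mvfderiv 𝓘(ℝ, ℂ) f x u' • A.cov s x u +
        (mvfderiv 𝓘(ℝ, ℂ) f x u • A.cov s x u' +
          mvfderiv 𝓘(ℝ, ℂ) (fun y ↦ mvfderiv 𝓘(ℝ, ℂ) f y (extendTan u y)) x u' • s x) := by
      rw [A.cov_congr ((h1 u).add (h2 u)) (h' u), A.cov_add (h1 u) (h2 u), _root_.add_apply,
        A.cov_smul hf0 (secCnAt_cov_extendTan A hs u), A.cov_smul (hd u) hs0, extendTan_self]
    simp only [covComm]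
    rw [hc, hc, mvfderiv_mvfderiv_comm hf w v, smul_sub]
    abel

/-- Evaluated on a section `s`, the second derivatives of `u` give the curvature of `u s` minus `u`
applied to the curvature of `s`. -/
theorem extCov_covEnd (hE : IsSmoothHermitian E F) {u : Form0 E} (hu : IsForm0 F ∞ u) {x : X}
    {v w : Tan x} {R : Module.End ℂ (E x)} (hR : ∀ e, curvature A x v w e = R e) :
    extCov A (covEnd A u) x v w = ⁅R, u x⁆ := by
  have hu' (y : X) := isForm0_iff.mp hu y
  have hx := mem_chart_source ℂ x
  obtain ⟨R', hR'⟩ := exists_curvature A hE x v w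
  have hext (e : E x) : ∀ᶠ y in 𝓝 x, SecCnAt F ∞ (FiberBundle.extend F e) y := by
    filter_upwards [(trivializationAt F E x).open_baseSet.mem_nhds
      (FiberBundle.mem_baseSet_trivializationAt' x)] with y hy
    exact secCnAt_extend_of_mem e hy
  have hRR : R = R' := LinearMap.ext fun e ↦ by
    rw [← hR, curvature_eq, hR' _ (hext e), FiberBundle.extend_apply_self]
  subst hRR
  rw [extCov_eq A (covEnd_isLinearMap A u hE (hu' x))]
  refine LinearMap.ext fun e ↦ ?_
  have hs := hext e
  set s := FiberBundle.extend F e with hsdef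
  have hse : s x = e := FiberBundle.extend_apply_self F e
  have hus : ∀ᶠ y in 𝓝 x, SecCnAt F ∞ (fun z ↦ u z (s z)) y := hs.mono fun y hy ↦ hu' y s hy
  -- The terms `(∇_p u)(∇_q s)` and `(∇_q u)(∇_p s)` enter symmetrically and cancel on
  -- antisymmetrization.
  have key (p q : Tan x) : covEnd A (fun y ↦ covEnd A u y (extendTan q y)) x p e =
      A.cov (fun y ↦ A.cov (fun z ↦ u z (s z)) y (extendTan q y)) x p -
        covEnd A u x p (A.cov s x q) - u x (A.cov (fun y ↦ A.cov s y (extendTan q y)) x p) -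
        covEnd A u x q (A.cov s x p) := by
    have hcq := (isForm1_covEnd A hE hu).endCnAt (fieldCnAt_extendTan hx q ∞ le_rfl)
    have h1 := covEnd_apply A hE hcq hs.self_of_nhds p
    rw [hse] at h1
    have hsq := secCnAt_cov_extendTan A hs q
    have huq := secCnAt_cov_extendTan A hus q
    have hev : ∀ᶠ y in 𝓝 x, covEnd A u y (extendTan q y) (s y) =
        A.cov (fun z ↦ u z (s z)) y (extendTan q y) - u y (A.cov s y (extendTan q y)) :=
      hs.mono fun y hy ↦ covEnd_apply A hE (hu' y) hy _
    have h2 := covEnd_apply A hE (hu' x) hsq p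
    simp only [extendTan_self] at h1 h2
    rw [h1, A.cov_congr (huq.sub (hu' x _ hsq)) hev, A.cov_sub huq (hu' x _ hsq), h2]
    abel
  rw [LinearMap.sub_apply, key, key, Ring.lie_def, LinearMap.sub_apply, Module.End.mul_apply,
    Module.End.mul_apply]
  have e1 := hR' _ hus
  have e2 := hR' _ hs
  rw [hse] at e1 e2
  rw [← e1, ← e2, covComm, covComm, map_sub]
  abel

end Curvature

/-! ### Harmonic 2-forms are parallel and commute with `Φ`. -/

section Weitzenbock

variable {X : Type*} [TopologicalSpace X] [ChartedSpace ℂ X] [IsManifold 𝓘(ℂ) ω X]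
  [IsManifold 𝓘(ℝ, ℂ) ∞ X]
  {F : Type*} [NormedAddCommGroup F] [NormedSpace ℂ F] [FiniteDimensional ℂ F]
  {E : X → Type*} [TopologicalSpace (TotalSpace F E)]
  [∀ x, NormedAddCommGroup (E x)] [∀ x, InnerProductSpace ℂ (E x)]
  [∀ x, FiniteDimensional ℂ (E x)]
  [FiberBundle F E] [VectorBundle ℝ F E] [VectorBundle ℂ F E]
  [ContMDiffVectorBundle ∞ F E 𝓘(ℝ, ℂ)] (g : KahlerMetric X) (P : HitchinPair F E)

theorem part10_J {a : Form1 E} {x : X} (ha : IsLinearMap ℝ (a x)) (v : Tan x) :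
    part10 a x (J x v) = Complex.I • part10 a x v := by
  simp only [part10, J_J, ha.map_neg]
  have hI : Complex.I * Complex.I = -1 := Complex.I_mul_I
  rw [smul_comm Complex.I, smul_sub Complex.I, smul_smul, hI]
  module

theorem HitchinPair.higgs_J (x : X) (v : Tan x) : P.Φ x (J x v) = Complex.I • P.Φ x v := by
  have h := part10_J (P.smooth.1 x) v
  rwa [P.type10] at h

theorem HitchinPair.adjoint_higgs_J (x : X) (v : Tan x) :
    LinearMap.adjoint (P.Φ x (J x v)) = -(Complex.I • LinearMap.adjoint (P.Φ x v)) := by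
  rw [P.higgs_J, map_smulₛₗ, Complex.conj_I, neg_smul]

theorem higgsAdj_J (f : Form0 E) (x : X) (v : Tan x) :
    higgsAdj P f x (J x v) = -(Complex.I • higgsAdj P f x v) := by
  simp only [higgsAdj]
  rw [P.adjoint_higgs_J x (J x v), end_neg_lie, end_smul_lie, smul_neg]

variable [MeasurableSpace X] [BorelSpace X] [CompactSpace X] [T2Space X]

/-- A harmonic 2-form is annihilated by both parts of the adjoint of `D''`. -/
theorem harmonic_parts (hE : IsSmoothHermitian E F) {h : Form2 E} (hh : h ∈ H2 P g) (x : X)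
    (v : Tan x) : part10 (covJ P.A (contract g h)) x v = 0 ∧ higgsAdj P (contract g h) x v = 0 := by
  have h0 := dstar_eq_zero g P hE hh
  have h1 (u : Tan x) : part10 (covJ P.A (contract g h)) x u + higgsAdj P (contract g h) x u = 0 :=
    congrFun (congrFun h0 x) u
  have hl := (isForm1_covJ P.A hE (hh.1.contract g le_rfl)).1 x
  -- Passing from `v` to `Jv` multiplies the `(1,0)`-part by `i` and the `(0,1)`-part by `-i`. A
  -- vanishing sum at both vectors forces each part to vanish.
  have h2 := h1 (J x v)
  rw [part10_J hl, higgsAdj_J, ← sub_eq_add_neg, ← smul_sub, smul_eq_zero] at h2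
  have h3 := sub_eq_zero.mp (h2.resolve_left Complex.I_ne_zero)
  have h4 := h1 v
  rw [h3, ← two_smul ℂ, smul_eq_zero] at h4
  have h5 := h4.resolve_left two_ne_zero
  exact ⟨h3.trans h5, h5⟩

theorem harmonic_adjoint_higgs (hE : IsSmoothHermitian E F) {h : Form2 E} (hh : h ∈ H2 P g) (x : X)
    (v : Tan x) : ⁅LinearMap.adjoint (P.Φ x v), contract g h x⁆ = 0 := by
  have h1 := (harmonic_parts g P hE hh x (J x v)).2
  simp only [higgsAdj, J_J, (P.smooth.1 x).map_neg, map_neg, end_neg_lie, neg_neg] at h1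
  exact h1

/-- The equation `∂̄_A^* h = 0` says that `∇Λh` is of type `(0,1)`. -/
theorem harmonic_covEnd_J (hE : IsSmoothHermitian E F) {h : Form2 E} (hh : h ∈ H2 P g) (x : X)
    (v : Tan x) : covEnd P.A (contract g h) x (J x v) =
      -(Complex.I • covEnd P.A (contract g h) x v) := by
  have h1 := (harmonic_parts g P hE hh x v).1
  have hl := (isForm1_covEnd P.A hE (hh.1.contract g le_rfl)).1 x
  simp only [part10, covJ, J_J, hl.map_neg, smul_neg, sub_neg_eq_add, smul_eq_zero] at h1
  exact eq_neg_of_add_eq_zero_left (h1.resolve_left (by norm_num))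

/-- The curvature of a Hitchin pair as an endomorphism. -/
theorem HitchinPair.curvature_apply (x : X) (v w : Tan x) (e : E x) :
    curvature P.A x v w e =
      (-bracket P.Φ (fun y t ↦ LinearMap.adjoint (P.Φ y t)) x v w) e :=
  eq_neg_of_add_eq_zero_left (P.hitchin x v w e)

/-- On the frame `(1, i)` Hitchin's equation gives the curvature `2i[p, p^*]` with `p = Φ(1)`. As
`[p^*, t] = 0`, the Jacobi identity leaves `-2i[p^*, [p, t]]`, and moving `p^*` across the pairing
produces the square of `[p, t]`. The sign is decisive for the vanishing theorem. -/
theorem hs_lie_curvature {x : X} (t : Module.End ℂ (E x))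
    (ht : ⁅LinearMap.adjoint (P.Φ x (tanOf x 1)), t⁆ = 0) :
    hs t ⁅-bracket P.Φ (fun y t ↦ LinearMap.adjoint (P.Φ y t)) x (tanOf x 1) (tanOf x Complex.I),
      t⁆ = 2 * Complex.I * hs ⁅P.Φ x (tanOf x 1), t⁆ ⁅P.Φ x (tanOf x 1), t⁆ := by
  set p := P.Φ x (tanOf x 1)
  have e1 : P.Φ x (tanOf x Complex.I) = Complex.I • p := by rw [← J_one, P.higgs_J]
  have e2 : LinearMap.adjoint (P.Φ x (tanOf x Complex.I)) = -(Complex.I • LinearMap.adjoint p) := by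
    rw [← J_one, P.adjoint_higgs_J]
  have e3 : -bracket P.Φ (fun y t ↦ LinearMap.adjoint (P.Φ y t)) x (tanOf x 1)
      (tanOf x Complex.I) = (2 * Complex.I) • ⁅p, LinearMap.adjoint p⁆ := by
    simp only [bracket]
    rw [e2, e1, end_lie_neg, end_lie_smul, end_smul_lie]
    module
  have jac : ⁅⁅p, LinearMap.adjoint p⁆, t⁆ =
      ⁅p, ⁅LinearMap.adjoint p, t⁆⁆ - ⁅LinearMap.adjoint p, ⁅p, t⁆⁆ := by
    simp only [Ring.lie_def]
    noncomm_ring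
  have hz : ⁅p, (0 : Module.End ℂ (E x))⁆ = 0 := by simp [Ring.lie_def]
  rw [e3, end_smul_lie, jac, ht, hz, zero_sub, hs_smul_right, hs_neg_right, ← hs_conj_symm,
    hs_lie_right, LinearMap.adjoint_adjoint, hs_conj_symm]
  simp [Complex.conj_ofNat]

/-- A harmonic 2-form is parallel and commutes with the Higgs field. -/
theorem harmonic_parallel (hE : IsSmoothHermitian E F) {h : Form2 E} (hh : h ∈ H2 P g) :
    (∀ x v, covEnd P.A (contract g h) x v = 0) ∧ ∀ x v, ⁅P.Φ x v, contract g h x⁆ = 0 := by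
  have ht := hh.1.contract g le_rfl
  have hc := isForm1_covEnd P.A hE ht
  have hc0 : IsForm1 F 0 (covEnd P.A (contract g h)) := hc.of_le hE (by simp)
  have hb : IsForm1 F ∞ (fun x v ↦ ⁅P.Φ x v, contract g h x⁆) := P.smooth.lie_right ht
  have hb0 := hb.of_le hE (n := 0) (by simp)
  -- Integration by parts with `c = ∇t`, where `t = Λh`: `⟨h, d_A ∇t⟩ = ⟨∇t ∘ J, ∇t⟩`.
  have hibp := pair2_extCov g P.A hE hh.1 hc
  rw [pair2_eq_contract] at hibp
  -- The left side is `i‖[Φ, t]‖²`; the factor `2` of the curvature formula is taken up by the two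
  -- equal terms for the frame vectors `1` and `i`.
  have e1 (x : X) : (g.lam x : ℂ)⁻¹ * hs (contract g h x)
      (extCov P.A (covEnd P.A (contract g h)) x (tanOf x 1) (tanOf x Complex.I)) =
      Complex.I * ptw1 g (fun x v ↦ ⁅P.Φ x v, contract g h x⁆)
        (fun x v ↦ ⁅P.Φ x v, contract g h x⁆) x := by
    rw [extCov_covEnd P.A hE ht (P.curvature_apply x _ _),
      hs_lie_curvature P _ (harmonic_adjoint_higgs g P hE hh x _), ptw1]
    have : ⁅P.Φ x (tanOf x Complex.I), contract g h x⁆ =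
        Complex.I • ⁅P.Φ x (tanOf x 1), contract g h x⁆ := by
      rw [← J_one, P.higgs_J, end_smul_lie]
    simp only [this, hs_smul_left, hs_smul_right, Complex.conj_I]
    linear_combination (-(Complex.I * (g.lam x : ℂ)⁻¹ * hs ⁅P.Φ x (tanOf x 1), contract g h x⁆
      ⁅P.Φ x (tanOf x 1), contract g h x⁆)) * (-Complex.I_mul_I)
  -- As `∇t` is of type `(0,1)`, the right side is `-i‖∇t‖²`.
  have e2 : pair1 g (covJ P.A (contract g h)) (covEnd P.A (contract g h)) =
      -(Complex.I * pair1 g (covEnd P.A (contract g h)) (covEnd P.A (contract g h))) := by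
    have : covJ P.A (contract g h) = (-Complex.I) • covEnd P.A (contract g h) := by
      funext x v
      rw [covJ, harmonic_covEnd_J g P hE hh, Pi.smul_apply, Pi.smul_apply, neg_smul]
    rw [this, pair1_smul_left, neg_mul]
  simp only [e1] at hibp
  rw [integral_const_mul, e2] at hibp
  -- Comparing the two sides gives a vanishing sum of two nonnegative numbers.
  have e3 : pair1 g (fun x v ↦ ⁅P.Φ x v, contract g h x⁆) (fun x v ↦ ⁅P.Φ x v, contract g h x⁆) +
      pair1 g (covEnd P.A (contract g h)) (covEnd P.A (contract g h)) = 0 := by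
    have h3 : Complex.I * (pair1 g (fun x v ↦ ⁅P.Φ x v, contract g h x⁆)
      (fun x v ↦ ⁅P.Φ x v, contract g h x⁆) +
      pair1 g (covEnd P.A (contract g h)) (covEnd P.A (contract g h))) = 0 := by
      rw [mul_add]
      exact add_eq_zero_iff_eq_neg.mpr hibp
    exact (mul_eq_zero.mp h3).resolve_left Complex.I_ne_zero
  have p1 := pair1_self_nonneg g (fun x v ↦ ⁅P.Φ x v, contract g h x⁆ : Form1 E)
  have p2 := pair1_self_nonneg g (covEnd P.A (contract g h) : Form1 E)
  have e4 := congrArg Complex.re e3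
  rw [Complex.add_re, Complex.zero_re] at e4
  have z1 := eq_zero_of_pair1_self g hE hb0 (by linarith)
  have z2 := eq_zero_of_pair1_self g hE hc0 (by linarith)
  exact ⟨fun x v ↦ congrFun (congrFun z2 x) v, fun x v ↦ congrFun (congrFun z1 x) v⟩

end Weitzenbock

/-! ### The identity that makes `(D'')^*`-exact terms invisible to harmonic forms. -/

section KeyIdentity

variable {X : Type*} [TopologicalSpace X] [ChartedSpace ℂ X] [IsManifold 𝓘(ℂ) ω X]
  [IsManifold 𝓘(ℝ, ℂ) ∞ X]
  {F : Type*} [NormedAddCommGroup F] [NormedSpace ℂ F] [FiniteDimensional ℂ F]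
  {E : X → Type*} [TopologicalSpace (TotalSpace F E)]
  [∀ x, NormedAddCommGroup (E x)] [∀ x, InnerProductSpace ℂ (E x)]
  [∀ x, FiniteDimensional ℂ (E x)]
  [FiberBundle F E] [VectorBundle ℝ F E] [VectorBundle ℂ F E]
  [ContMDiffVectorBundle ∞ F E 𝓘(ℝ, ℂ)] (g : KahlerMetric X) (P : HitchinPair F E)

theorem part01_J {a : Form1 E} {x : X} (ha : IsLinearMap ℝ (a x)) (v : Tan x) :
    part01 a x (J x v) = -(Complex.I • part01 a x v) := by
  simp only [part01, J_J, ha.map_neg]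
  have hI : Complex.I * Complex.I = -1 := Complex.I_mul_I
  rw [smul_comm Complex.I, smul_add Complex.I, smul_smul, hI]
  module

theorem part10_add_part01 (a : Form1 E) : part10 a + part01 a = a := by
  funext x v
  simp only [Pi.add_apply, part10, part01]
  module

theorem part10_part01 {a : Form1 E} (ha : ∀ x, IsLinearMap ℝ (a x)) : part10 (part01 a) = 0 := by
  funext x v
  rw [part10, part01_J (ha x), smul_neg, smul_smul, Complex.I_mul_I]
  simp

theorem part10_of_J {a : Form1 E} (ha : ∀ x v, a x (J x v) = Complex.I • a x v) :
    part10 a = a := by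
  funext x v
  rw [part10, ha, smul_smul, Complex.I_mul_I]
  module

theorem bracket_symm (a b : Form1 E) : bracket a b = bracket b a := by
  funext x v w
  simp only [bracket]
  rw [← end_lie_skew (b x v), ← end_lie_skew (b x w)]
  abel

/-- On a surface, brackets of two forms of the same type vanish; the two mixed brackets coincide by
symmetry. -/
theorem bracket_self_one_I {a : Form1 E} {x : X} (ha : IsLinearMap ℝ (a x)) :
    bracket a a x (tanOf x 1) (tanOf x Complex.I) =
      (2 : ℂ) • bracket (part01 a) (part10 a) x (tanOf x 1) (tanOf x Complex.I) := by
  have h10 := part10_J ha (tanOf x 1)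
  have h01 := part01_J ha (tanOf x 1)
  rw [J_one] at h10 h01
  have e (v : Tan x) : a x v = part10 a x v + part01 a x v :=
    (congrFun (congrFun (part10_add_part01 a) x) v).symm
  simp only [bracket]
  rw [e (tanOf x 1), e (tanOf x Complex.I), h10, h01]
  simp only [Ring.lie_def, mul_add, add_mul, mul_neg, neg_mul, mul_smul_comm, smul_mul_assoc]
  module

theorem isForm1_D0 (hE : IsSmoothHermitian E F) {u : Form0 E} (hu : IsForm0 F ∞ u) :
    IsForm1 F ∞ (D0 P u) :=
  ((isForm1_covEnd P.A hE hu).part01 le_rfl).add (P.smooth.lie_right hu)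

/-- `D'' ∘ D'' = 0`. -/
theorem D1_D0 (hE : IsSmoothHermitian E F) {u : Form0 E} (hu : IsForm0 F ∞ u) (x : X) :
    D1 P (D0 P u) x (tanOf x 1) (tanOf x Complex.I) = 0 := by
  have hcu := isForm1_covEnd P.A hE hu
  have hbr := P.smooth.lie_right hu
  -- The `(1,0)`-part of `D''u` is `[Φ, u]`, and it is the only part that `∂̄_A` sees.
  have h10 : part10 (D0 P u) = fun x v ↦ ⁅P.Φ x v, u x⁆ := by
    have e1 : part10 (fun x v ↦ ⁅P.Φ x v, u x⁆ : Form1 E) = fun x v ↦ ⁅P.Φ x v, u x⁆ :=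
      part10_of_J fun x v ↦ by rw [P.higgs_J, end_smul_lie]
    have e2 : part10 (D0 P u) = part10 (part01 (covEnd P.A u)) +
        part10 (fun x v ↦ ⁅P.Φ x v, u x⁆ : Form1 E) := by
      funext x v
      simp only [part10, D0, dbar0, Pi.add_apply]
      module
    rw [e2, e1, part10_part01 hcu.1, zero_add]
  have hx := mem_chart_source ℂ x
  have hΦ0 : part10 P.Φ = P.Φ := P.type10
  have hol : extCov P.A P.Φ x (tanOf x 1) (tanOf x Complex.I) = 0 := by
    have := congrFun (congrFun (congrFun P.holomorphic x) (tanOf x 1)) (tanOf x Complex.I)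
    rwa [dbar1, hΦ0] at this
  rw [extCov_eq P.A (P.smooth.1 x)] at hol
  have hlie (v w : Tan x) := covEnd_lie P.A hE (P.smooth.endCnAt_extend le_rfl hx w)
    (isForm0_iff.mp hu x) v
  have hl := part01_J (hcu.1 x) (tanOf x 1)
  have hp := part10_J (hcu.1 x) (tanOf x 1)
  have e (v : Tan x) : covEnd P.A u x v = part10 (covEnd P.A u) x v + part01 (covEnd P.A u) x v :=
    (congrFun (congrFun (part10_add_part01 (covEnd P.A u)) x) v).symm
  have hΦ := P.higgs_J x (tanOf x 1)
  rw [J_one] at hl hp hΦ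
  -- The Leibniz rule together with `∂̄_A Φ = 0`. What remains cancels against `[Φ, ∂̄_A u]`, while
  -- `[Φ, [Φ, u]]` vanishes for type reasons.
  have h1 : dbar1 P.A (D0 P u) x (tanOf x 1) (tanOf x Complex.I) =
      ⁅P.Φ x (tanOf x Complex.I), covEnd P.A u x (tanOf x 1)⁆ -
        ⁅P.Φ x (tanOf x 1), covEnd P.A u x (tanOf x Complex.I)⁆ := by
    rw [dbar1, h10, extCov_eq P.A (hbr.1 x), hlie, hlie, extendTan_self, extendTan_self,
      sub_eq_zero.mp hol]
    abel
  rw [D1, Pi.add_apply, Pi.add_apply, Pi.add_apply, h1, e (tanOf x 1), e (tanOf x Complex.I), hp,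
    hl, hΦ]
  simp only [bracket, D0, dbar0]
  rw [hl, hΦ]
  simp only [Ring.lie_def, mul_add, add_mul, mul_neg, neg_mul, mul_smul_comm, smul_mul_assoc,
    mul_sub, sub_mul]
  module

variable [MeasurableSpace X] [BorelSpace X] [CompactSpace X] [T2Space X]

theorem pair2_eq_contract_right (σ τ : Form2 E) :
    pair2 g σ τ = ∫ x, (g.lam x : ℂ)⁻¹ *
      hs (σ x (tanOf x 1) (tanOf x Complex.I)) (contract g τ x) ∂g.area := by
  refine integral_congr_ae (Eventually.of_forall fun x ↦ ?_)
  simp only [contract, hs_smul_right, ← Complex.ofReal_inv, Complex.conj_ofReal]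
  ring

/-- Write `t = Λh` and `f = Λξ`. At `Jv` the form `(D'')^* ξ` is `-(∇f)^{1,0}(v) + [Φ^*(v), f]`, and
taking adjoints turns it into `-(∇f^*)^{0,1}(v) + [f^*, Φ(v)]`. Bracketing with `t` passes through
the derivative because `∇t = 0`, and through `Φ` by the Jacobi identity because `[Φ, t] = 0`. The
outcome is `-D''[t, f^*]`. -/
theorem contract_dstar_adjoint (hE : IsSmoothHermitian E F) {h ξ : Form2 E} (hh : h ∈ H2 P g)
    (hξ : IsForm2 F ∞ ξ) (x : X) (v : Tan x) :
    ⁅contract g h x, LinearMap.adjoint (dstar g P ξ x (J x v))⁆ =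
      -D0 P (fun y ↦ ⁅contract g h y, LinearMap.adjoint (contract g ξ y)⁆) x v := by
  obtain ⟨hpar, hcomm⟩ := harmonic_parallel g P hE hh
  have ht := isForm0_iff.mp (hh.1.contract g le_rfl) x
  have hf := isForm0_iff.mp (hξ.contract g le_rfl) x
  have hc (w : Tan x) : covEnd P.A (fun y ↦ ⁅contract g h y, LinearMap.adjoint (contract g ξ y)⁆)
      x w = ⁅contract g h x, LinearMap.adjoint (covEnd P.A (contract g ξ) x w)⁆ := by
    rw [covEnd_lie P.A hE ht (hf.adjoint hE le_rfl), hpar, covEnd_adjoint P.A hE hf]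
    simp [Ring.lie_def]
  have hcl := (isForm1_covEnd P.A hE (hξ.contract g le_rfl)).1 x
  have h1 : dstar g P ξ x (J x v) = -part10 (covEnd P.A (contract g ξ)) x v +
      ⁅LinearMap.adjoint (P.Φ x v), contract g ξ x⁆ := by
    rw [dstar, Pi.add_apply, Pi.add_apply]
    congr 1
    · simp only [part10, covJ, J_J, J_neg, hcl.map_neg]
      module
    · simp only [higgsAdj, J_J, (P.smooth.1 x).map_neg, map_neg, end_neg_lie, neg_neg]
  have h2 : LinearMap.adjoint (part10 (covEnd P.A (contract g ξ)) x v) = (1 / 2 : ℂ) •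
      (LinearMap.adjoint (covEnd P.A (contract g ξ) x v) +
        Complex.I • LinearMap.adjoint (covEnd P.A (contract g ξ) x (J x v))) := by
    simp only [part10, map_smulₛₗ, map_sub, map_div₀, map_one, map_ofNat, Complex.conj_I, neg_smul,
      sub_neg_eq_add]
  have hcomm' := hcomm x v
  simp only [D0, dbar0, part01, hc]
  rw [h1, map_add, map_neg, h2, adjoint_lie, LinearMap.adjoint_adjoint]
  generalize contract g h x = t at *
  generalize LinearMap.adjoint (covEnd P.A (contract g ξ) x v) = p
  generalize LinearMap.adjoint (covEnd P.A (contract g ξ) x (J x v)) = q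
  generalize LinearMap.adjoint (contract g ξ x) = f
  generalize P.Φ x v = φ at *
  have jac : ⁅t, ⁅f, φ⁆⁆ = -⁅φ, ⁅t, f⁆⁆ - ⁅f, ⁅φ, t⁆⁆ := by
    simp only [Ring.lie_def]
    noncomm_ring
  have hz : ⁅f, (0 : Module.End ℂ (E x))⁆ = 0 := by simp [Ring.lie_def]
  rw [end_lie_add, jac, hcomm', hz, end_lie_neg, end_lie_smul, end_lie_add, end_lie_smul]
  abel

/-- The form representing the functional `b ↦ ⟨[c, b], h⟩`. -/
def cupForm (h : Form2 E) (c : Form1 E) : Form1 E := fun x v ↦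
  -⁅LinearMap.adjoint (c x (J x v)), contract g h x⁆

theorem isForm1_cupForm (hE : IsSmoothHermitian E F) {n : ℕ∞ω} (hn : n ≤ (∞ : ℕ∞ω)) {h : Form2 E}
    {c : Form1 E} (hh : IsForm2 F n h) (hc : IsForm1 F n c) : IsForm1 F n (cupForm g h c) :=
  (((hc.comp_J hn).adjoint hE hn).lie_right (hh.contract g hn)).neg

/-- This puts the pairing into the form `⟨b, m⟩`, linear in `b` with `m` continuous, to which the
limit argument for weak adjoints applies. -/
theorem pair2_bracket_eq {h : Form2 E} {b c : Form1 E} (hc : ∀ x, IsLinearMap ℝ (c x)) :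
    pair2 g (bracket c b) h = pair1 g b (cupForm g h c) := by
  rw [pair2_eq_contract_right]
  refine integral_congr_ae (Eventually.of_forall fun x ↦ ?_)
  simp only [bracket, hs_sub_left, hs_lie_right, cupForm, J_one, J_I, (hc x).map_neg, map_neg,
    end_neg_lie, neg_neg, hs_neg_right]
  ring

/-- Moving `(D'')^* ξ` across the trace pairing leaves `c` paired with a `D''`-exact form, which
coclosedness annihilates. -/
theorem pair2_bracket_dstar (hE : IsSmoothHermitian E F) {h ξ : Form2 E} {c : Form1 E}
    (hh : h ∈ H2 P g) (hξ : IsForm2 F ∞ ξ) (hc : Coclosed1 P g c) :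
    pair2 g (bracket c (dstar g P ξ)) h = 0 := by
  have hu : IsForm0 F ∞ (fun y ↦ ⁅contract g h y, LinearMap.adjoint (contract g ξ y)⁆) :=
    isForm0_iff.mpr fun x ↦ (isForm0_iff.mp (hh.1.contract g le_rfl) x).lie
      ((isForm0_iff.mp (hξ.contract g le_rfl) x).adjoint hE le_rfl)
  have hd := (isForm1_dstar g P hE hξ).1
  have e : pair2 g (bracket c (dstar g P ξ)) h =
      pair1 g c (-D0 P (fun y ↦ ⁅contract g h y, LinearMap.adjoint (contract g ξ y)⁆)) := by
    rw [pair2_eq_contract_right]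
    refine integral_congr_ae (Eventually.of_forall fun x ↦ ?_)
    simp only [Pi.neg_apply]
    rw [← contract_dstar_adjoint g P hE hh hξ, ← contract_dstar_adjoint g P hE hh hξ]
    simp only [bracket, hs_sub_left, hs_lie_left, J_one, J_I, (hd x).map_neg, map_neg,
      end_lie_neg, hs_neg_right]
    ring
  rw [e, pair1_neg_right, hc _ hu, neg_zero]

end KeyIdentity

/-! ### Global extension and uniform approximation by smooth forms. -/

section Density

variable {X : Type*} [TopologicalSpace X] [ChartedSpace ℂ X] [IsManifold 𝓘(ℂ) ω X]
  [IsManifold 𝓘(ℝ, ℂ) ∞ X]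
  {F : Type*} [NormedAddCommGroup F] [NormedSpace ℂ F] [FiniteDimensional ℂ F]
  {E : X → Type*} [TopologicalSpace (TotalSpace F E)]
  [∀ x, NormedAddCommGroup (E x)] [∀ x, InnerProductSpace ℂ (E x)]
  [∀ x, FiniteDimensional ℂ (E x)]
  [FiberBundle F E] [VectorBundle ℝ F E] [VectorBundle ℂ F E]
  [ContMDiffVectorBundle ∞ F E 𝓘(ℝ, ℂ)]

/-- A smooth section of `End E` near a point extends to a global one. -/
theorem exists_isForm0_eq [T2Space X] {u : Form0 E} {x : X} {n : ℕ∞ω} (hn : n ≤ (∞ : ℕ∞ω))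
    (hu : ∀ᶠ y in 𝓝 x, EndCnAt F n u y) :
    ∃ f : Form0 E, IsForm0 F n f ∧ ∀ᶠ y in 𝓝 x, f y = u y := by
  obtain ⟨U, hUu, hU, hx⟩ := eventually_nhds_iff.mp hu
  obtain ⟨ρ, -, hρ⟩ := (SmoothBumpFunction.nhds_basis_tsupport (I := 𝓘(ℝ, ℂ)) x).mem_iff.mp
    (hU.mem_nhds hx)
  refine ⟨fun y ↦ ρ y • u y, isForm0_iff.mpr fun y ↦ ?_, ?_⟩
  · by_cases hy : y ∈ tsupport ρ
    · exact (hUu y (hρ hy)).real_smul (ρ.contMDiff.contMDiffAt.of_le hn)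
    · refine EndCnAt.zero.congr ?_
      filter_upwards [(isClosed_tsupport ρ).isOpen_compl.mem_nhds hy] with z hz
      rw [image_eq_zero_of_notMem_tsupport hz, zero_smul]
  · filter_upwards [ρ.eventuallyEq_one] with y hy
    simp [hy]

/-- The endomorphism `v ↦ ⟨e, v⟩ e'`. -/
def rankOne {x : X} (e e' : E x) : Module.End ℂ (E x) :=
  (innerSL ℂ e).toLinearMap.smulRight e'

theorem rankOne_apply {x : X} (e e' v : E x) : rankOne e e' v = ⟪e, v⟫_ℂ • e' := rfl

theorem endCnAt_rankOne (hE : IsSmoothHermitian E F) {e e' : ∀ y, E y} {x : X} {n : ℕ∞ω}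
    (hn : n ≤ (∞ : ℕ∞ω)) (he : SecCnAt F n e x) (he' : SecCnAt F n e' x) :
    EndCnAt F n (fun y ↦ rankOne (e y) (e' y)) x := fun _ hs ↦ he'.smul (he.inner hE hn hs)

theorem hs_rankOne {x : X} (e e' : E x) (u : Module.End ℂ (E x)) :
    hs u (rankOne e e') = ⟪e', u e⟫_ℂ := by
  rw [hs_eq_sum (stdOrthonormalBasis ℂ (E x))]
  simp only [rankOne_apply, inner_smul_left, inner_conj_symm]
  conv_rhs => rw [← (stdOrthonormalBasis ℂ (E x)).sum_repr' e]
  simp only [map_sum, map_smul, inner_sum, inner_smul_right]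

/-- A section of `End E` is continuous as soon as its inner products with smooth sections are. -/
theorem isForm0_of_continuous_hs [T2Space X] (hE : IsSmoothHermitian E F) {u : Form0 E}
    (hu : ∀ f : Form0 E, IsForm0 F ∞ f → Continuous fun x ↦ hs (f x) (u x)) :
    IsForm0 F 0 u := by
  rw [isForm0_iff]
  intro x
  obtain ⟨U, hx, m, e, he⟩ := exists_isFrame hE x
  refine he.endCnAt hx hE (by simp) fun i j ↦ ?_
  -- Pairing `u` with the rank-one endomorphism sending `e_j` to `e_i` gives the matrix coefficient
  -- `⟨e_i, u e_j⟩`; a cutoff makes that endomorphism a global smooth section.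
  obtain ⟨f, hf, hfe⟩ := exists_isForm0_eq (F := F) (x := x)
    (u := fun y ↦ rankOne (e j y) (e i y)) le_rfl (by
      filter_upwards [he.isOpen.mem_nhds hx] with y hy
      exact endCnAt_rankOne hE le_rfl (he.smooth y hy j) (he.smooth y hy i))
  have hc : ContMDiff 𝓘(ℝ, ℂ) 𝓘(ℝ, ℂ) 0 (fun y ↦ hs (f y) (u y)) :=
    contMDiff_zero_iff.mpr (hu f hf)
  refine (contMDiffAt_conj hc.contMDiffAt).congr_of_eventuallyEq ?_
  filter_upwards [hfe] with y hy
  rw [hs_conj_symm, hy, hs_rankOne]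

theorem exists_isForm0_value [T2Space X] (hE : IsSmoothHermitian E F) (x : X)
    (u : Module.End ℂ (E x)) : ∃ f : Form0 E, IsForm0 F ∞ f ∧ f x = u := by
  -- The sum of the rank-one maps `e_k ↦ u e_k`, with all vectors extended to local sections; at `x`
  -- it is `u`.
  let w : Form0 E := fun y ↦ ∑ k, rankOne
    (FiberBundle.extend F (stdOrthonormalBasis ℂ (E x) k) y)
    (FiberBundle.extend F (u (stdOrthonormalBasis ℂ (E x) k)) y)
  obtain ⟨f, hf, hfe⟩ := exists_isForm0_eq (F := F) (u := w) (x := x) le_rfl (by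
    filter_upwards [(trivializationAt F E x).open_baseSet.mem_nhds
      (FiberBundle.mem_baseSet_trivializationAt' x)] with y hy
    exact EndCnAt.sum fun k _ ↦ endCnAt_rankOne hE le_rfl (secCnAt_extend_of_mem _ hy)
      (secCnAt_extend_of_mem _ hy))
  refine ⟨f, hf, hfe.self_of_nhds.trans ?_⟩
  refine (stdOrthonormalBasis ℂ (E x)).toBasis.ext fun i ↦ ?_
  simp only [w, FiberBundle.extend_apply_self, LinearMap.sum_apply, rankOne_apply,
    OrthonormalBasis.coe_toBasis, orthonormal_iff_ite.mp (stdOrthonormalBasis ℂ (E x)).orthonormal,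
    ite_smul, one_smul, zero_smul]
  simp

/-- A smooth 1-form with prescribed value at a point. -/
theorem exists_isForm1_value [T2Space X] (hE : IsSmoothHermitian E F) (x : X)
    {a : Tan x → Module.End ℂ (E x)} (ha : IsLinearMap ℝ a) :
    ∃ c : Form1 E, IsForm1 F ∞ c ∧ c x = a := by
  obtain ⟨f, hf, hfx⟩ := exists_isForm0_value hE x (a (tanOf x 1))
  obtain ⟨f', hf', hfx'⟩ := exists_isForm0_value hE x (a (tanOf x Complex.I))
  let ρ : SmoothBumpFunction 𝓘(ℝ, ℂ) x := Classical.arbitrary _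
  let L (y : X) (v : Tan y) : ℂ := tangentCoordChange 𝓘(ℝ, ℂ) y x y v
  refine ⟨fun y v ↦ ρ y • ((L y v).re • f y + (L y v).im • f' y), ?_, ?_⟩
  · refine isForm1_of_field (fun y ↦ ⟨fun v w ↦ ?_, fun r v ↦ ?_⟩) fun V y hV ↦ ?_
    · have : L y (v + w) = L y v + L y w := map_add (tangentCoordChange 𝓘(ℝ, ℂ) y x y) v w
      rw [this, Complex.add_re, Complex.add_im]
      module
    · have : L y (r • v) = r • L y v := map_smul (tangentCoordChange 𝓘(ℝ, ℂ) y x y) r v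
      rw [this, Complex.real_smul, Complex.re_ofReal_mul, Complex.im_ofReal_mul]
      module
    · by_cases hy : y ∈ tsupport ρ
      · have hys : y ∈ (chartAt ℂ x).source := ρ.tsupport_subset_chartAt_source hy
        have hL : ContMDiffAt 𝓘(ℝ, ℂ) 𝓘(ℝ, ℂ) ∞ (fun z ↦ L z (V z)) y := by
          have h := ((trivializationAt ℂ (TangentSpace 𝓘(ℝ, ℂ)) x).contMDiffAt_section_iff
            (IB := 𝓘(ℝ, ℂ)) (s := V) hys).mp hV
          exact h
        have hre : ContMDiffAt 𝓘(ℝ, ℂ) 𝓘(ℝ, ℝ) ∞ (fun z ↦ (L z (V z)).re) y :=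
          Complex.reCLM.contDiff.contMDiff.contMDiffAt.comp y hL
        have him : ContMDiffAt 𝓘(ℝ, ℂ) 𝓘(ℝ, ℝ) ∞ (fun z ↦ (L z (V z)).im) y :=
          Complex.imCLM.contDiff.contMDiff.contMDiffAt.comp y hL
        exact (((isForm0_iff.mp hf y).real_smul hre).add
          ((isForm0_iff.mp hf' y).real_smul him)).real_smul ρ.contMDiff.contMDiffAt
      · refine EndCnAt.zero.congr ?_
        filter_upwards [(isClosed_tsupport ρ).isOpen_compl.mem_nhds hy] with z hz
        rw [image_eq_zero_of_notMem_tsupport hz, zero_smul]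
  · funext v
    have hL : L x v = v := tangentCoordChange_self (I := 𝓘(ℝ, ℂ)) (x := x) (z := x) (v := v)
      (mem_extChartAt_source x)
    simp only [hL, hfx, hfx', ρ.eq_one, one_smul]
    conv_rhs => rw [tan_eq x v, ha.map_add, ha.map_smul, ha.map_smul]

variable (g : KahlerMetric X)

theorem ptw1_zero_left (b : Form1 E) (x : X) : ptw1 g 0 b x = 0 := by
  simp [ptw1]

theorem ptw1_sum_left {ι : Type*} (S : Finset ι) (r : ι → ℂ) (d : ι → Form1 E) (b : Form1 E)
    (x : X) : ptw1 g (∑ i ∈ S, r i • d i) b x = ∑ i ∈ S, r i * ptw1 g (d i) b x := by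
  classical
  induction S using Finset.induction_on with
  | empty => simp [ptw1_zero_left]
  | insert i S hi ih => rw [Finset.sum_insert hi, Finset.sum_insert hi, ptw1_add_left, ih,
      ptw1_smul_left]

/-- Convexity of the pointwise squared norm. -/
theorem ptw1_convex {ι : Type*} (S : Finset ι) (r : ι → ℝ) (hr : ∀ i, 0 ≤ r i)
    (h1 : ∑ i ∈ S, r i = 1) (d : ι → Form1 E) (x : X) :
    (ptw1 g (∑ i ∈ S, (r i : ℂ) • d i) (∑ i ∈ S, (r i : ℂ) • d i) x).re ≤
      ∑ i ∈ S, r i * (ptw1 g (d i) (d i) x).re := by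
  set D := ∑ i ∈ S, (r i : ℂ) • d i with hD
  -- Expanding `|d_i - D|² ≥ 0`; averaging over `i` with the weights `r_i` gives the convexity
  -- inequality.
  have h2 (i : ι) : 2 * (ptw1 g (d i) D x).re ≤ (ptw1 g (d i) (d i) x).re + (ptw1 g D D x).re := by
    have h := ptw1_self_nonneg g (d i + (-1 : ℂ) • D) x
    have e1 : ptw1 g D (d i) x = starRingEnd ℂ (ptw1 g (d i) D x) := (ptw1_conj_symm g _ _ x).symm
    have e2 (a : Form1 E) : ptw1 g a (d i + (-1 : ℂ) • D) x = ptw1 g a (d i) x - ptw1 g a D x := by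
      rw [← ptw1_conj_symm, ptw1_add_left, ptw1_smul_left, map_add, map_mul, ptw1_conj_symm,
        ptw1_conj_symm]
      simp [sub_eq_add_neg]
    rw [ptw1_add_left, ptw1_smul_left, e2, e2, e1] at h
    simp only [Complex.add_re, Complex.sub_re, Complex.mul_re, Complex.sub_im, Complex.conj_re,
      Complex.neg_re, Complex.one_re, Complex.neg_im, Complex.one_im] at h
    linarith
  have h3 : (ptw1 g D D x).re = ∑ i ∈ S, r i * (ptw1 g (d i) D x).re := by
    conv_lhs => rw [hD, ptw1_sum_left, Complex.re_sum]
    exact Finset.sum_congr rfl fun i _ ↦ Complex.re_ofReal_mul _ _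
  have h4 : 2 * (ptw1 g D D x).re ≤ ∑ i ∈ S, r i * (ptw1 g (d i) (d i) x).re +
      (ptw1 g D D x).re := by
    calc 2 * (ptw1 g D D x).re = ∑ i ∈ S, r i * (2 * (ptw1 g (d i) D x).re) := by
          rw [h3, Finset.mul_sum]; exact Finset.sum_congr rfl fun i _ ↦ by ring
      _ ≤ ∑ i ∈ S, r i * ((ptw1 g (d i) (d i) x).re + (ptw1 g D D x).re) :=
          Finset.sum_le_sum fun i _ ↦ mul_le_mul_of_nonneg_left (h2 i) (hr i)
      _ = _ := by simp only [mul_add, Finset.sum_add_distrib, ← Finset.sum_mul, h1, one_mul]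
  linarith

/-- Smooth 1-forms are uniformly dense in continuous 1-forms. -/
theorem exists_smooth_ptw1_lt [T2Space X] [CompactSpace X] (hE : IsSmoothHermitian E F)
    {a : Form1 E} (ha : IsForm1 F 0 a) {ε : ℝ} (hε : 0 < ε) :
    ∃ c : Form1 E, IsForm1 F ∞ c ∧ ∀ x, (ptw1 g (a - c) (a - c) x).re ≤ ε := by
  choose c hc hcx using fun x : X ↦ exists_isForm1_value hE x (ha.1 x)
  have hcont (x : X) : Continuous fun y ↦ (ptw1 g (a - c x) (a - c x) y).re :=
    Complex.continuous_re.comp (continuous_ptw1 g hE (ha.sub ((hc x).of_le hE (by simp)))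
      (ha.sub ((hc x).of_le hE (by simp))))
  -- A smooth form with the value of `a` at one point is within `ε` of `a` on a neighbourhood, in
  -- squared norm. A partition of unity subordinate to these neighbourhoods glues the forms, and
  -- convexity preserves the bound.
  obtain ⟨S, ρ, hρ, hsupp, h0, h1⟩ := exists_finite_partition
    (fun x ↦ {y | (ptw1 g (a - c x) (a - c x) y).re < ε})
    (fun x ↦ isOpen_lt (hcont x) continuous_const) (fun x ↦ by
      have e (v : Tan x) : (a - c x) x v = 0 := by
        rw [Pi.sub_apply, hcx, sub_self]; rfl
      change (ptw1 g (a - c x) (a - c x) x).re < ε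
      rw [ptw1, e, e]
      simpa using hε)
  refine ⟨∑ i ∈ S, fun x v ↦ (ρ i x : ℂ) • c i x v, IsForm1.sum fun i _ ↦ (hc i).smul_fun fun x ↦
    Complex.ofRealCLM.contDiff.contMDiff.contMDiffAt.comp x (hρ i).contMDiffAt, fun x ↦ ?_⟩
  set C : Form1 E := ∑ i ∈ S, fun x v ↦ (ρ i x : ℂ) • c i x v
  have hval : (a - C) x = (∑ i ∈ S, (ρ i x : ℂ) • (a - c i)) x := by
    funext v
    have e1 : C x v = ∑ i ∈ S, (ρ i x : ℂ) • c i x v := by simp [C, Finset.sum_apply]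
    have e2 : (∑ i ∈ S, (ρ i x : ℂ) • (a - c i)) x v =
        ∑ i ∈ S, (ρ i x : ℂ) • (a x v - c i x v) := by simp [Finset.sum_apply]
    have e3 : ∑ i ∈ S, (ρ i x : ℂ) • a x v = a x v := by
      rw [← Finset.sum_smul, ← Complex.ofReal_sum, h1, Complex.ofReal_one, one_smul]
    rw [e2, Pi.sub_apply, Pi.sub_apply, e1]
    simp only [smul_sub, Finset.sum_sub_distrib, e3]
  have hq : ptw1 g (a - C) (a - C) x = ptw1 g (∑ i ∈ S, (ρ i x : ℂ) • (a - c i))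
      (∑ i ∈ S, (ρ i x : ℂ) • (a - c i)) x := by
    simp only [ptw1, hval]
  rw [hq]
  refine (ptw1_convex g S (fun i ↦ ρ i x) (fun i ↦ h0 i x) (h1 x) _ x).trans ?_
  calc ∑ i ∈ S, ρ i x * (ptw1 g (a - c i) (a - c i) x).re ≤ ∑ i ∈ S, ρ i x * ε := by
        refine Finset.sum_le_sum fun i _ ↦ ?_
        by_cases hx : x ∈ tsupport (ρ i)
        · exact mul_le_mul_of_nonneg_left (le_of_lt (hsupp i hx)) (h0 i x)
        · rw [image_eq_zero_of_notMem_tsupport hx, zero_mul, zero_mul]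
    _ = ε := by rw [← Finset.sum_mul, h1, one_mul]

end Density

/-! ### Cauchy–Schwarz, norm inequalities and `L²` density. -/

section Norms

variable {X : Type*} [TopologicalSpace X] [ChartedSpace ℂ X] [IsManifold 𝓘(ℂ) ω X]
  [IsManifold 𝓘(ℝ, ℂ) ∞ X]
  {F : Type*} [NormedAddCommGroup F] [NormedSpace ℂ F] [FiniteDimensional ℂ F]
  {E : X → Type*} [TopologicalSpace (TotalSpace F E)]
  [∀ x, NormedAddCommGroup (E x)] [∀ x, InnerProductSpace ℂ (E x)]
  [∀ x, FiniteDimensional ℂ (E x)]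
  [FiberBundle F E] [VectorBundle ℝ F E] [VectorBundle ℂ F E]
  [ContMDiffVectorBundle ∞ F E 𝓘(ℝ, ℂ)] (g : KahlerMetric X)

theorem norm_apply_sq_le_hs {x : X} (a : Module.End ℂ (E x)) (v : E x) :
    ‖a v‖ ^ 2 ≤ (hs a a).re * ‖v‖ ^ 2 := by
  let e := stdOrthonormalBasis ℂ (E x)
  have h1 : (hs a a).re = ∑ i, ‖a (e i)‖ ^ 2 := by
    rw [hs_eq_sum e, Complex.re_sum]
    refine Finset.sum_congr rfl fun i _ ↦ ?_
    rw [inner_self_eq_norm_sq_to_K]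
    norm_cast
  have h2 : ‖a v‖ ≤ ∑ i, ‖a (e i)‖ * ‖⟪e i, v⟫_ℂ‖ := by
    conv_lhs => rw [← e.sum_repr' v]
    rw [map_sum]
    refine (norm_sum_le _ _).trans (Finset.sum_le_sum fun i _ ↦ ?_)
    rw [map_smul, norm_smul, mul_comm]
  calc ‖a v‖ ^ 2 ≤ (∑ i, ‖a (e i)‖ * ‖⟪e i, v⟫_ℂ‖) ^ 2 := by gcongr
    _ ≤ (∑ i, ‖a (e i)‖ ^ 2) * ∑ i, ‖⟪e i, v⟫_ℂ‖ ^ 2 := Finset.sum_mul_sq_le_sq_mul_sq _ _ _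
    _ = (hs a a).re * ‖v‖ ^ 2 := by rw [h1, e.sum_sq_norm_inner_right]

theorem hs_mul_self_le {x : X} (a b : Module.End ℂ (E x)) :
    (hs (a * b) (a * b)).re ≤ (hs a a).re * (hs b b).re := by
  have h1 (a : Module.End ℂ (E x)) :
      (hs a a).re = ∑ i, ‖a (stdOrthonormalBasis ℂ (E x) i)‖ ^ 2 := by
    rw [hs_eq_sum (stdOrthonormalBasis ℂ (E x)), Complex.re_sum]
    refine Finset.sum_congr rfl fun i _ ↦ ?_
    rw [inner_self_eq_norm_sq_to_K]
    norm_cast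
  rw [h1 (a * b), h1 b, Finset.mul_sum]
  exact Finset.sum_le_sum fun i _ ↦ norm_apply_sq_le_hs a _

theorem hs_lie_self_le {x : X} (a b : Module.End ℂ (E x)) :
    (hs ⁅a, b⁆ ⁅a, b⁆).re ≤ 4 * ((hs a a).re * (hs b b).re) := by
  have h := hs_add_self_le (a * b) (-(b * a))
  rw [← sub_eq_add_neg, ← Ring.lie_def] at h
  simp only [hs_neg_left, hs_neg_right, neg_neg] at h
  have h1 := hs_mul_self_le a b
  have h2 := hs_mul_self_le b a
  linarith

variable [MeasurableSpace X] [BorelSpace X] [CompactSpace X] [T2Space X]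

/-- The continuous 1-forms. -/
def contForm1 (hE : IsSmoothHermitian E F) : Submodule ℂ (Form1 E) where
  carrier := {a | IsForm1 F 0 a}
  add_mem' := IsForm1.add
  zero_mem' := IsForm1.zero
  smul_mem' r _ ha := ha.const_smul r

/-- The `L²` inner product on continuous 1-forms. -/
@[reducible] def l2Core (hE : IsSmoothHermitian E F) : PreInnerProductSpace.Core ℂ (contForm1 (F := F) hE) where
  -- The arguments are swapped because `pair1` is linear in its first argument, whereas an inner
  -- product core is conjugate-linear there.
  inner a b := pair1 g b.1 a.1
  conj_inner_symm a b := pair1_conj_symm g a.1 b.1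
  re_inner_nonneg a := pair1_self_nonneg g a.1
  add_left a b c := pair1_add_right g hE a.2 b.2 c.2
  smul_left a b r := pair1_smul_right g r b.1 a.1

theorem norm_pair1_le (hE : IsSmoothHermitian E F) {a b : Form1 E} (ha : IsForm1 F 0 a)
    (hb : IsForm1 F 0 b) : ‖pair1 g a b‖ ≤ norm1 g a * norm1 g b := by
  let := l2Core (F := F) g hE
  have h := @InnerProductSpace.Core.norm_inner_le_norm ℂ (contForm1 (F := F) hE) _ _ _ this
    ⟨b, hb⟩ ⟨a, ha⟩
  rw [mul_comm]
  exact h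

theorem norm1_add_le (hE : IsSmoothHermitian E F) {a b : Form1 E} (ha : IsForm1 F 0 a)
    (hb : IsForm1 F 0 b) : norm1 g (a + b) ≤ norm1 g a + norm1 g b := by
  let := l2Core (F := F) g hE
  let := @InnerProductSpace.Core.toSeminormedAddCommGroup ℂ (contForm1 (F := F) hE) _ _ _ this
  exact norm_add_le (⟨a, ha⟩ : contForm1 (F := F) hE) ⟨b, hb⟩

theorem norm1_nonneg (a : Form1 E) : 0 ≤ norm1 g a := Real.sqrt_nonneg _

theorem norm1_sq (a : Form1 E) : norm1 g a ^ 2 = (pair1 g a a).re :=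
  Real.sq_sqrt (pair1_self_nonneg g a)

instance : IsFiniteMeasure g.area := ⟨isCompact_univ.measure_lt_top⟩

/-- Smooth 1-forms are `L²`-dense in continuous 1-forms. -/
theorem exists_smooth_norm1_lt (hE : IsSmoothHermitian E F) {a : Form1 E} (ha : IsForm1 F 0 a)
    {ε : ℝ} (hε : 0 < ε) : ∃ c : Form1 E, IsForm1 F ∞ c ∧ norm1 g (a - c) < ε := by
  set V := g.area.real Set.univ
  have hV : 0 ≤ V := measureReal_nonneg
  -- Dividing by `V + 1` instead of the total area `V` keeps the integral strictly below `ε²`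
  -- without requiring `V ≠ 0`.
  obtain ⟨c, hc, hle⟩ := exists_smooth_ptw1_lt g hE ha (ε := ε ^ 2 / (V + 1)) (by positivity)
  refine ⟨c, hc, ?_⟩
  have hac := ha.sub (hc.of_le hE (by simp))
  have h : (pair1 g (a - c) (a - c)).re ≤ ε ^ 2 / (V + 1) * V := by
    rw [pair1_self_eq, Complex.ofReal_re]
    calc ∫ x, (ptw1 g (a - c) (a - c) x).re ∂g.area ≤ ∫ x, ε ^ 2 / (V + 1) ∂g.area :=
          integral_mono (integrable_ptw1 g hE hac hac).re (integrable_const _) hle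
      _ = ε ^ 2 / (V + 1) * V := by rw [integral_const, smul_eq_mul, mul_comm]
  rw [norm1, Real.sqrt_lt' hε]
  refine h.trans_lt ?_
  rw [div_mul_eq_mul_div, div_lt_iff₀ (by positivity)]
  nlinarith [pow_pos hε 2]

/-- Smooth forms are dense, so `‖b‖² = ⟨b, b - c⟩` is at most `ε‖b‖` for every `ε > 0`. It shows in
particular that a weak adjoint is determined by its values on smooth forms. -/
theorem eq_zero_of_pair1_smooth (hE : IsSmoothHermitian E F) {b : Form1 E} (hb : IsForm1 F 0 b)
    (h : ∀ c, IsForm1 F ∞ c → pair1 g b c = 0) : b = 0 := by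
  refine eq_zero_of_pair1_self g hE hb ?_
  rw [← norm1_sq]
  refine pow_eq_zero_iff two_ne_zero |>.mpr (le_antisymm ?_ (norm1_nonneg g b))
  refine le_of_forall_pos_lt_add fun ε hε ↦ ?_
  obtain ⟨c, hc, hlt⟩ := exists_smooth_norm1_lt g hE hb hε
  have hc0 := hc.of_le hE (n := 0) (by simp)
  have h1 : norm1 g b ^ 2 ≤ norm1 g b * norm1 g (b - c) := by
    rw [norm1_sq]
    have : pair1 g b b = pair1 g b (b - c) := by rw [pair1_sub_right g hE hb hc0 hb, h c hc, sub_zero]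
    rw [this]
    exact (Complex.re_le_norm _).trans (norm_pair1_le g hE hb (hb.sub hc0))
  rcases (norm1_nonneg g b).eq_or_lt with h0 | h0
  · rw [← h0]; linarith
  · rw [sq] at h1
    linarith [le_of_mul_le_mul_left h1 h0]

end Norms

/-! ### Local bound of `(D'')^*` by first covariant derivatives. -/

section LocalBound

variable {X : Type*} [TopologicalSpace X] [ChartedSpace ℂ X] [IsManifold 𝓘(ℂ) ω X]
  [IsManifold 𝓘(ℝ, ℂ) ∞ X]
  {F : Type*} [NormedAddCommGroup F] [NormedSpace ℂ F] [FiniteDimensional ℂ F]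
  {E : X → Type*} [TopologicalSpace (TotalSpace F E)]
  [∀ x, NormedAddCommGroup (E x)] [∀ x, InnerProductSpace ℂ (E x)]
  [∀ x, FiniteDimensional ℂ (E x)]
  [FiberBundle F E] [VectorBundle ℝ F E] [VectorBundle ℂ F E]
  [ContMDiffVectorBundle ∞ F E 𝓘(ℝ, ℂ)] (g : KahlerMetric X) (P : HitchinPair F E)
  [MeasurableSpace X] [BorelSpace X] [CompactSpace X] [T2Space X]

theorem hs_smul_self_re {x : X} (r : ℂ) (u : Module.End ℂ (E x)) :
    (hs (r • u) (r • u)).re = ‖r‖ ^ 2 * (hs u u).re := by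
  rw [hs_smul_left, hs_smul_right, ← mul_assoc, Complex.mul_conj, Complex.re_ofReal_mul,
    Complex.normSq_eq_norm_sq]

theorem hs_neg_self {x : X} (u : Module.End ℂ (E x)) : hs (-u) (-u) = hs u u := by
  rw [hs_neg_left, hs_neg_right, neg_neg]

theorem ptw1_re (a : Form1 E) (x : X) : (ptw1 g a a x).re = (g.lam x)⁻¹ *
    ((hs (a x (tanOf x 1)) (a x (tanOf x 1))).re +
      (hs (a x (tanOf x Complex.I)) (a x (tanOf x Complex.I))).re) := by
  rw [ptw1, ← Complex.ofReal_inv, Complex.re_ofReal_mul, Complex.add_re]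

theorem ptw1_add_self_le (a b : Form1 E) (x : X) :
    (ptw1 g (a + b) (a + b) x).re ≤ 2 * ((ptw1 g a a x).re + (ptw1 g b b x).re) := by
  simp only [ptw1_re, Pi.add_apply]
  have h1 := hs_add_self_le (a x (tanOf x 1)) (b x (tanOf x 1))
  have h2 := hs_add_self_le (a x (tanOf x Complex.I)) (b x (tanOf x Complex.I))
  have h3 := inv_pos.mpr (g.lam_pos x)
  have h4 := mul_le_mul_of_nonneg_left (add_le_add h1 h2) h3.le
  refine h4.trans (le_of_eq ?_)
  ring

theorem ptw1_part10_self_le {a : Form1 E} {x : X} (ha : IsLinearMap ℝ (a x)) :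
    (ptw1 g (part10 a) (part10 a) x).re ≤ (ptw1 g a a x).re := by
  have h (u v : Module.End ℂ (E x)) : (hs ((1 / 2 : ℂ) • (u - Complex.I • v))
      ((1 / 2 : ℂ) • (u - Complex.I • v))).re ≤ 1 / 2 * ((hs u u).re + (hs v v).re) := by
    have h1 := hs_add_self_le u (-(Complex.I • v))
    rw [hs_neg_self, hs_smul_self_re, Complex.norm_I, ← sub_eq_add_neg] at h1
    rw [hs_smul_self_re]
    norm_num
    linarith
  simp only [ptw1_re]
  refine mul_le_mul_of_nonneg_left ?_ (inv_pos.mpr (g.lam_pos x)).le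
  have h1 := h (a x (tanOf x 1)) (a x (tanOf x Complex.I))
  have h2 := h (a x (tanOf x Complex.I)) (a x (-tanOf x 1))
  rw [ha.map_neg, hs_neg_self, ← ha.map_neg] at h2
  simp only [part10, J_one, J_I]
  linarith

theorem ptw1_self_conformal {a : Form1 E} {x : X} (ha : IsLinearMap ℝ (a x)) {v : Tan x}
    (hv : v ≠ 0) : (ptw1 g a a x).re = (g.metric.inner x v v)⁻¹ *
      ((hs (a x v) (a x v)).re + (hs (a x (J x v)) (a x (J x v))).re) := by
  rw [ptw1_conformal g ha ha hv, ← Complex.ofReal_inv, Complex.re_ofReal_mul, Complex.add_re]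

/-- In terms of a local conformal frame, `(D'')^* ξ` is bounded by the first derivatives of `ξ`. -/
theorem ptw1_dstar_le (hE : IsSmoothHermitian E F) {ξ : Form2 E} (hξ : IsForm2 F ∞ ξ)
    {u : Form0 E} {r : X → ℝ} {x : X} {v : Tan x} (hv : v ≠ 0)
    (hvr : (g.metric.inner x v v)⁻¹ = r x) (hr : ContMDiffAt 𝓘(ℝ, ℂ) 𝓘(ℝ, ℝ) ∞ r x)
    (hu : EndCnAt F ∞ u x) (hru : ∀ᶠ y in 𝓝 x, contract g ξ y = (r y : ℂ) • u y) :
    (ptw1 g (dstar g P ξ) (dstar g P ξ) x).re ≤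
      4 * r x ^ 3 * ((hs (covEnd P.A u x v) (covEnd P.A u x v)).re +
        (hs (covEnd P.A u x (J x v)) (covEnd P.A u x (J x v))).re) +
      (4 * r x * (‖mvfderiv 𝓘(ℝ, ℂ) (fun y ↦ (r y : ℂ)) x v‖ ^ 2 +
        ‖mvfderiv 𝓘(ℝ, ℂ) (fun y ↦ (r y : ℂ)) x (J x v)‖ ^ 2) +
      8 * r x ^ 3 * ((hs (LinearMap.adjoint (P.Φ x v)) (LinearMap.adjoint (P.Φ x v))).re +
        (hs (LinearMap.adjoint (P.Φ x (J x v))) (LinearMap.adjoint (P.Φ x (J x v)))).re)) *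
        (hs (u x) (u x)).re := by
  have hf := hξ.contract g le_rfl
  have hrc : ContMDiffAt 𝓘(ℝ, ℂ) 𝓘(ℝ, ℂ) ∞ (fun y ↦ (r y : ℂ)) x :=
    Complex.ofRealCLM.contDiff.contMDiff.contMDiffAt.comp x hr
  have hr0 : 0 ≤ r x := hvr ▸ inv_nonneg.mpr (g.inner_self_pos hv).le
  have hn : ‖(r x : ℂ)‖ = r x := by rw [Complex.norm_real, Real.norm_of_nonneg hr0]
  have hcov (w : Tan x) : (hs (covEnd P.A (contract g ξ) x w) (covEnd P.A (contract g ξ) x w)).re ≤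
      2 * (r x ^ 2 * (hs (covEnd P.A u x w) (covEnd P.A u x w)).re +
        ‖mvfderiv 𝓘(ℝ, ℂ) (fun y ↦ (r y : ℂ)) x w‖ ^ 2 * (hs (u x) (u x)).re) := by
    -- Near `x` the contraction is the conformal factor `r` times `u`; its derivative has one term
    -- with `∇u` and one with `dr`.
    have e : covEnd P.A (contract g ξ) x w = (r x : ℂ) • covEnd P.A u x w +
        mvfderiv 𝓘(ℝ, ℂ) (fun y ↦ (r y : ℂ)) x w • u x := by
      rw [covEnd_congr P.A hE (hu.smul hrc) hru, covEnd_smul P.A hE hrc hu]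
    rw [e]
    refine (hs_add_self_le _ _).trans (le_of_eq ?_)
    rw [hs_smul_self_re, hs_smul_self_re, hn]
  have hfx : contract g ξ x = (r x : ℂ) • u x := hru.self_of_nhds
  have hΦ (w : Tan x) : (hs ⁅LinearMap.adjoint (P.Φ x w), contract g ξ x⁆
      ⁅LinearMap.adjoint (P.Φ x w), contract g ξ x⁆).re ≤
      4 * ((hs (LinearMap.adjoint (P.Φ x w)) (LinearMap.adjoint (P.Φ x w))).re *
        (r x ^ 2 * (hs (u x) (u x)).re)) := by
    refine (hs_lie_self_le _ _).trans (le_of_eq ?_)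
    rw [hfx, hs_smul_self_re, hn]
  have hcl := (isForm1_covEnd P.A hE hf).1 x
  have h1 : (ptw1 g (part10 (covJ P.A (contract g ξ))) (part10 (covJ P.A (contract g ξ))) x).re ≤
      r x * (2 * (r x ^ 2 * (hs (covEnd P.A u x v) (covEnd P.A u x v)).re +
        ‖mvfderiv 𝓘(ℝ, ℂ) (fun y ↦ (r y : ℂ)) x v‖ ^ 2 * (hs (u x) (u x)).re) +
      2 * (r x ^ 2 * (hs (covEnd P.A u x (J x v)) (covEnd P.A u x (J x v))).re +
        ‖mvfderiv 𝓘(ℝ, ℂ) (fun y ↦ (r y : ℂ)) x (J x v)‖ ^ 2 * (hs (u x) (u x)).re)) := by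
    have hl := (isForm1_covJ P.A hE hf).1 x
    refine (ptw1_part10_self_le g hl).trans ?_
    rw [ptw1_self_conformal g hl hv, hvr]
    refine mul_le_mul_of_nonneg_left ?_ hr0
    simp only [covJ, J_J, hcl.map_neg, hs_neg_self]
    rw [add_comm]
    exact add_le_add (hcov _) (hcov _)
  have h2 : (ptw1 g (higgsAdj P (contract g ξ)) (higgsAdj P (contract g ξ)) x).re ≤
      r x * (4 * ((hs (LinearMap.adjoint (P.Φ x v)) (LinearMap.adjoint (P.Φ x v))).re *
        (r x ^ 2 * (hs (u x) (u x)).re)) +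
      4 * ((hs (LinearMap.adjoint (P.Φ x (J x v))) (LinearMap.adjoint (P.Φ x (J x v)))).re *
        (r x ^ 2 * (hs (u x) (u x)).re))) := by
    rw [ptw1_self_conformal g ((isForm1_higgsAdj P hE le_rfl hf).1 x) hv, hvr]
    refine mul_le_mul_of_nonneg_left ?_ hr0
    simp only [higgsAdj, J_J, (P.smooth.1 x).map_neg, map_neg, end_neg_lie, hs_neg_self, neg_neg]
    rw [add_comm]
    exact add_le_add (hΦ _) (hΦ _)
  -- The constants: one factor `2` from this sum and another from the Leibniz rule give `4`, while
  -- `2` times the commutator constant `4` gives `8`. The powers of `r` come from the frame length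
  -- and from `Λξ = r u`.
  refine (ptw1_add_self_le g _ _ x).trans ?_
  refine (mul_le_mul_of_nonneg_left (add_le_add h1 h2) zero_le_two).trans (le_of_eq ?_)
  ring

/-- A smooth frame near a point, made of two global vector fields, in which 2-forms are given by
their value on the frame. -/
theorem exists_conformal_frame (x₀ : X) : ∃ V W : ∀ y : X, Tan y,
    IsSmoothField V ∧ IsSmoothField W ∧ ∃ U : Set X, IsOpen U ∧ x₀ ∈ U ∧
      U ⊆ (chartAt ℂ x₀).source ∧ ∀ y ∈ U, V y = extendTan (tanOf x₀ 1) y ∧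
        W y = J y (V y) ∧ W y = extendTan (tanOf x₀ Complex.I) y := by
  obtain ⟨V, hV, hVe⟩ := exists_smoothField_eq x₀ (tanOf x₀ 1)
  obtain ⟨W, hW, hWe⟩ := exists_smoothField_eq x₀ (tanOf x₀ Complex.I)
  obtain ⟨U, hU, hUo, hxU⟩ := eventually_nhds_iff.mp
    ((hVe.and hWe).and ((chartAt ℂ x₀).open_source.mem_nhds (mem_chart_source ℂ x₀)))
  refine ⟨V, W, hV, hW, U, hUo, hxU, fun y hy ↦ (hU y hy).2, fun y hy ↦ ⟨(hU y hy).1.1, ?_,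
    (hU y hy).1.2⟩⟩
  rw [(hU y hy).1.1, (hU y hy).1.2, ← J_extendTan (hU y hy).2, J_one]

theorem contract_frame {n : ℕ∞ω} {σ : Form2 E} (hσ : IsForm2 F n σ) {x₀ y : X}
    (hy : y ∈ (chartAt ℂ x₀).source) {V W : ∀ y : X, Tan y}
    (hV : V y = extendTan (tanOf x₀ 1) y) (hW : W y = J y (V y)) :
    contract g σ y = (((chartLam g x₀ y)⁻¹ : ℝ) : ℂ) • σ y (V y) (W y) := by
  have hne : V y ≠ 0 := hV ▸ extendTan_ne_zero hy (one_ne_zero (α := ℂ))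
  rw [hσ.contract_eq g hne, hW, Complex.ofReal_inv]
  rw [hV]
  rfl

theorem exists_ptw1_dstar_le (hE : IsSmoothHermitian E F) (x₀ : X) :
    ∃ V W : ∀ y : X, Tan y, IsSmoothField V ∧ IsSmoothField W ∧ ∃ C : ℝ, 0 ≤ C ∧
      ∀ᶠ x in 𝓝 x₀, ∀ ξ : Form2 E, IsForm2 F ∞ ξ →
        (ptw1 g (dstar g P ξ) (dstar g P ξ) x).re ≤
          C * ((hs (ξ x (V x) (W x)) (ξ x (V x) (W x))).re +
            (hs (covEnd P.A (fun y ↦ ξ y (V y) (W y)) x (V x))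
              (covEnd P.A (fun y ↦ ξ y (V y) (W y)) x (V x))).re +
            (hs (covEnd P.A (fun y ↦ ξ y (V y) (W y)) x (W x))
              (covEnd P.A (fun y ↦ ξ y (V y) (W y)) x (W x))).re) := by
  obtain ⟨V, W, hV, hW, U, hUo, hxU, hUs, hU⟩ := exists_conformal_frame x₀
  set r : X → ℝ := fun y ↦ (chartLam g x₀ y)⁻¹ with hr
  have hrs {y : X} (hy : y ∈ (chartAt ℂ x₀).source) : ContMDiffAt 𝓘(ℝ, ℂ) 𝓘(ℝ, ℝ) ∞ r y :=
    (contDiffAt_inv ℝ (chartLam_pos g hy).ne').contMDiffAt.comp y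
      (contMDiffAt_chartLam g hy le_rfl)
  have hx₀ := mem_chart_source ℂ x₀
  have hrc : ∀ᶠ y in 𝓝 x₀, ContMDiffAt 𝓘(ℝ, ℂ) 𝓘(ℝ, ℂ) ∞ (fun y ↦ (r y : ℂ)) y := by
    filter_upwards [(chartAt ℂ x₀).open_source.mem_nhds hx₀] with y hy
    exact Complex.ofRealCLM.contDiff.contMDiff.contMDiffAt.comp y (hrs hy)
  have hc0 := (hrs hx₀).continuousAt
  have hd (w : Tan x₀) := (contMDiffAt_mvfderiv_extendTan hrc w).continuousAt.norm
  have hp (w : Tan x₀) : ContinuousAt (fun y ↦ (hs (LinearMap.adjoint (P.Φ y (extendTan w y)))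
      (LinearMap.adjoint (P.Φ y (extendTan w y)))).re) x₀ := by
    have h1 := (P.smooth.endCnAt_extend le_rfl hx₀ w).adjoint hE le_rfl
    exact Complex.continuous_re.continuousAt.comp (h1.hs hE le_rfl h1).continuousAt
  set α : X → ℝ := fun y ↦ 4 * r y ^ 3
  set β : X → ℝ := fun y ↦ 4 * r y *
    (‖mvfderiv 𝓘(ℝ, ℂ) (fun y ↦ (r y : ℂ)) y (extendTan (tanOf x₀ 1) y)‖ ^ 2 +
      ‖mvfderiv 𝓘(ℝ, ℂ) (fun y ↦ (r y : ℂ)) y (extendTan (tanOf x₀ Complex.I) y)‖ ^ 2) +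
    8 * r y ^ 3 * ((hs (LinearMap.adjoint (P.Φ y (extendTan (tanOf x₀ 1) y)))
      (LinearMap.adjoint (P.Φ y (extendTan (tanOf x₀ 1) y)))).re +
      (hs (LinearMap.adjoint (P.Φ y (extendTan (tanOf x₀ Complex.I) y)))
      (LinearMap.adjoint (P.Φ y (extendTan (tanOf x₀ Complex.I) y)))).re)
  have hα : ContinuousAt α x₀ := continuousAt_const.mul (hc0.pow 3)
  have hβ : ContinuousAt β x₀ := ((continuousAt_const.mul hc0).mul
    (((hd _).pow 2).add ((hd _).pow 2))).add
      ((continuousAt_const.mul (hc0.pow 3)).mul ((hp _).add (hp _)))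
  -- The coefficients `α` and `β` are continuous at `x₀`, hence bounded nearby by their values there
  -- plus `1`, and the resulting constant serves all `ξ` at once.
  refine ⟨V, W, hV, hW, max (α x₀ + 1) (β x₀ + 1) ⊔ 0, le_max_right _ _, ?_⟩
  filter_upwards [hUo.mem_nhds hxU, hα.eventually_le_const (lt_add_one _),
    hβ.eventually_le_const (lt_add_one _)] with x hx hαx hβx ξ hξ
  obtain ⟨e1, e2, e3⟩ := hU x hx
  have hu : EndCnAt F ∞ (fun y ↦ ξ y (V y) (W y)) x := hξ.endCnAt (hV x) (hW x)
  have h := ptw1_dstar_le g P hE hξ (u := fun y ↦ ξ y (V y) (W y)) (r := r) (x := x) (v := V x)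
    (e1 ▸ extendTan_ne_zero (hUs hx) (one_ne_zero (α := ℂ))) (by rw [e1]; rfl) (hrs (hUs hx)) hu
    (by
      filter_upwards [hUo.mem_nhds hx] with y hy
      exact contract_frame g hξ (hUs hy) (hU y hy).1 (hU y hy).2.1)
  rw [← e2] at h
  have h1 := hs_self_nonneg (ξ x (V x) (W x))
  have h2 := hs_self_nonneg (covEnd P.A (fun y ↦ ξ y (V y) (W y)) x (V x))
  have h3 := hs_self_nonneg (covEnd P.A (fun y ↦ ξ y (V y) (W y)) x (W x))
  set C := max (α x₀ + 1) (β x₀ + 1) ⊔ 0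
  have hαC : α x ≤ C := hαx.trans ((le_max_left _ _).trans (le_max_left _ _))
  have hβC : β x ≤ C := hβx.trans ((le_max_right _ _).trans (le_max_left _ _))
  have hβe : β x = 4 * r x * (‖mvfderiv 𝓘(ℝ, ℂ) (fun y ↦ (r y : ℂ)) x (V x)‖ ^ 2 +
        ‖mvfderiv 𝓘(ℝ, ℂ) (fun y ↦ (r y : ℂ)) x (W x)‖ ^ 2) +
      8 * r x ^ 3 * ((hs (LinearMap.adjoint (P.Φ x (V x))) (LinearMap.adjoint (P.Φ x (V x)))).re +
        (hs (LinearMap.adjoint (P.Φ x (W x))) (LinearMap.adjoint (P.Φ x (W x)))).re) := by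
    rw [e1, e3]
  rw [← hβe] at h
  refine h.trans ?_
  have h4 := mul_le_mul_of_nonneg_right hαC (add_nonneg h2 h3)
  have h5 := mul_le_mul_of_nonneg_right hβC h1
  calc _ ≤ _ := add_le_add h4 h5
    _ = _ := by ring

end LocalBound

/-! ### Bounds and limits along Sobolev-Cauchy sequences. -/

section SobolevLimits

variable {X : Type*} [TopologicalSpace X] [ChartedSpace ℂ X] [IsManifold 𝓘(ℂ) ω X]
  [IsManifold 𝓘(ℝ, ℂ) ∞ X]
  {F : Type*} [NormedAddCommGroup F] [NormedSpace ℂ F] [FiniteDimensional ℂ F]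
  {E : X → Type*} [TopologicalSpace (TotalSpace F E)]
  [∀ x, NormedAddCommGroup (E x)] [∀ x, InnerProductSpace ℂ (E x)]
  [∀ x, FiniteDimensional ℂ (E x)]
  [FiberBundle F E] [VectorBundle ℝ F E] [VectorBundle ℂ F E]
  [ContMDiffVectorBundle ∞ F E 𝓘(ℝ, ℂ)] (g : KahlerMetric X) (P : HitchinPair F E)
  [MeasurableSpace X] [BorelSpace X] [CompactSpace X] [T2Space X]

theorem IsForm0.of_le (hE : IsSmoothHermitian E F) {n : ℕ∞ω} (hn : n ≤ (∞ : ℕ∞ω)) {u : Form0 E}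
    (hu : IsForm0 F ∞ u) : IsForm0 F n u :=
  isForm0_iff.mpr fun x ↦ (isForm0_iff.mp hu x).of_le hE hn

theorem IsForm0.sub {n : ℕ∞ω} {u v : Form0 E} (hu : IsForm0 F n u) (hv : IsForm0 F n v) :
    IsForm0 F n (u - v) :=
  isForm0_iff.mpr fun x ↦ (isForm0_iff.mp hu x).sub (isForm0_iff.mp hv x)

theorem measurable_hs_self (hE : IsSmoothHermitian E F) {u : Form0 E} (hu : IsForm0 F 0 u) :
    Measurable fun x ↦ ENNReal.ofReal (hs (u x) (u x)).re :=
  (Complex.continuous_re.comp (continuous_hs hE hu hu)).measurable.ennreal_ofReal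

theorem sqL2_eq (hE : IsSmoothHermitian E F) {u : Form0 E} (hu : IsForm0 F 0 u) :
    sqL2 g u = ENNReal.ofReal (pair0 g u u).re := by
  have h : pair0 g u u = ((∫ x, (hs (u x) (u x)).re ∂g.area : ℝ) : ℂ) := by
    rw [← integral_complex_ofReal]
    exact integral_congr_ae (Eventually.of_forall fun x ↦ (hs_self_ofReal _).symm)
  rw [h, Complex.ofReal_re]
  exact (ofReal_integral_eq_lintegral_ofReal
    (integrable_hs g hE hu hu).re (Eventually.of_forall fun x ↦ hs_self_nonneg _)).symm

theorem sqL2_ne_top (hE : IsSmoothHermitian E F) {u : Form0 E} (hu : IsForm0 F 0 u) :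
    sqL2 g u ≠ ⊤ := by
  rw [sqL2_eq g hE hu]
  exact ENNReal.ofReal_ne_top

theorem sqL2_add_le (hE : IsSmoothHermitian E F) {u v : Form0 E} (hu : IsForm0 F 0 u)
    (hv : IsForm0 F 0 v) : sqL2 g (u + v) ≤ 2 * (sqL2 g u + sqL2 g v) := by
  rw [sqL2, sqL2, sqL2, ← lintegral_add_left (measurable_hs_self hE hu), ← lintegral_const_mul' _ _
    ENNReal.ofNat_ne_top]
  refine lintegral_mono fun x ↦ ?_
  rw [← ENNReal.ofReal_add (hs_self_nonneg _) (hs_self_nonneg _), ← ENNReal.ofReal_ofNat,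
    ← ENNReal.ofReal_mul (by norm_num)]
  exact ENNReal.ofReal_le_ofReal (hs_add_self_le _ _)

/-- A Cauchy sequence is bounded. The factor `2` appears because squared norms satisfy the triangle
inequality only up to this constant. -/
theorem exists_sqL2_le_of_cauchy (hE : IsSmoothHermitian E F) {f : ℕ → Form0 E}
    (hf : ∀ n, IsForm0 F 0 (f n))
    (h : Tendsto (fun p : ℕ × ℕ ↦ sqL2 g (f p.1 - f p.2)) atTop (𝓝 0)) :
    ∃ C : ℝ≥0∞, C ≠ ⊤ ∧ ∀ᶠ n in atTop, sqL2 g (f n) ≤ C := by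
  obtain ⟨⟨N, M⟩, hN⟩ := (h.eventually_le_const (show (0 : ℝ≥0∞) < 1 by norm_num)).exists_forall_of_atTop
  refine ⟨2 * (1 + sqL2 g (f M)), ENNReal.mul_ne_top (by norm_num)
    (ENNReal.add_ne_top.mpr ⟨by norm_num, sqL2_ne_top g hE (hf M)⟩), ?_⟩
  filter_upwards [eventually_ge_atTop N] with n hn
  have e : f n = (f n - f M) + f M := (sub_add_cancel _ _).symm
  rw [e]
  refine (sqL2_add_le g hE ((hf n).sub (hf M)) (hf M)).trans ?_
  gcongr
  exact hN (n, M) ⟨hn, le_rfl⟩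

theorem exists_sqL2_covEnd_le (A : UnitaryConnection F E) (hE : IsSmoothHermitian E F) {k : ℕ}
    (hk : 1 ≤ k) {f : ℕ → Form0 E} (hf : ∀ n, IsForm0 F ∞ (f n)) (h : SobCauchy A g k f)
    {V : ∀ x : X, Tan x} (hV : IsSmoothField V) :
    ∃ C : ℝ≥0∞, C ≠ ⊤ ∧ ∀ᶠ n in atTop, sqL2 g (fun x ↦ covEnd A (f n) x (V x)) ≤ C := by
  have hs' (n : ℕ) := isForm0_iff.mp (hf n)
  refine exists_sqL2_le_of_cauchy g hE (f := fun n x ↦ covEnd A (f n) x (V x)) (fun n ↦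
    (isForm0_iff.mpr fun x ↦ (isForm1_covEnd A hE (hf n)).endCnAt (hV x)).of_le hE (by simp)) ?_
  refine (h [V] ⟨by simpa using hk, by simpa using hV⟩).congr fun p ↦ ?_
  congr 1
  funext x
  exact covEnd_sub A hE (hs' p.1 x) (hs' p.2 x) (V x)

theorem exists_sqL2_le (A : UnitaryConnection F E) (hE : IsSmoothHermitian E F) {k : ℕ}
    {f : ℕ → Form0 E} (hf : ∀ n, IsForm0 F ∞ (f n)) (h : SobCauchy A g k f) :
    ∃ C : ℝ≥0∞, C ≠ ⊤ ∧ ∀ᶠ n in atTop, sqL2 g (f n) ≤ C :=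
  exists_sqL2_le_of_cauchy g hE (fun n ↦ (hf n).of_le hE (by simp)) (h [] ⟨by simp, by simp⟩)

/-- Along a Sobolev-Cauchy sequence of smooth 2-forms, `(D'')^*` stays bounded in `L²`. -/
theorem exists_norm1_dstar_le (hE : IsSmoothHermitian E F) {k : ℕ} (hk : 1 ≤ k)
    {ξ : ℕ → Form2 E} (hξ : ∀ n, IsForm2 F ∞ (ξ n))
    (h : ∀ V W : (∀ x : X, Tan x), IsSmoothField V → IsSmoothField W →
      SobCauchy P.A g k (fun n x ↦ ξ n x (V x) (W x))) :
    ∃ C : ℝ, ∀ᶠ n in atTop, norm1 g (dstar g P (ξ n)) ≤ C := by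
  let q (n : ℕ) (x : X) : ℝ≥0∞ := ENNReal.ofReal (ptw1 g (dstar g P (ξ n)) (dstar g P (ξ n)) x).re
  have key : ∃ C : ℝ≥0∞, C ≠ ⊤ ∧ ∀ᶠ n in atTop, ∫⁻ x in Set.univ, q n x ∂g.area ≤ C := by
    -- The bound is local and additive over sets, so compactness reduces it to a neighbourhood of
    -- each point, where finitely many words of length at most one suffice.
    refine isCompact_univ.induction_on
      (p := fun S ↦ ∃ C : ℝ≥0∞, C ≠ ⊤ ∧ ∀ᶠ n in atTop, ∫⁻ x in S, q n x ∂g.area ≤ C)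
      ⟨0, by simp, by simp⟩ ?_ ?_ ?_
    · rintro S T hST ⟨C, hC, hle⟩
      exact ⟨C, hC, hle.mono fun n hn ↦ (lintegral_mono_set hST).trans hn⟩
    · rintro S T ⟨C, hC, hle⟩ ⟨C', hC', hle'⟩
      refine ⟨C + C', ENNReal.add_ne_top.mpr ⟨hC, hC'⟩, ?_⟩
      filter_upwards [hle, hle'] with n h1 h2
      exact (lintegral_union_le _ _ _).trans (add_le_add h1 h2)
    · intro x₀ _
      obtain ⟨V, W, hV, hW, C, hC, hev⟩ := exists_ptw1_dstar_le g P hE x₀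
      obtain ⟨U, hU, hUo, hxU⟩ := eventually_nhds_iff.mp hev
      have hs' (n : ℕ) : IsForm0 F ∞ (fun x ↦ ξ n x (V x) (W x)) :=
        isForm0_iff.mpr fun x ↦ (hξ n).endCnAt (hV x) (hW x)
      have hd (n : ℕ) {T : ∀ x : X, Tan x} (hT : IsSmoothField T) :
          IsForm0 F 0 (fun x ↦ covEnd P.A (fun y ↦ ξ n y (V y) (W y)) x (T x)) :=
        (isForm0_iff.mpr fun x ↦ (isForm1_covEnd P.A hE (hs' n)).endCnAt (hT x)).of_le hE (by simp)
      have hS := h V W hV hW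
      obtain ⟨C₁, h₁, hC₁⟩ := exists_sqL2_le g P.A hE hs' hS
      obtain ⟨C₂, h₂, hC₂⟩ := exists_sqL2_covEnd_le g P.A hE hk hs' hS hV
      obtain ⟨C₃, h₃, hC₃⟩ := exists_sqL2_covEnd_le g P.A hE hk hs' hS hW
      refine ⟨U, mem_nhdsWithin_of_mem_nhds (hUo.mem_nhds hxU),
        ENNReal.ofReal C * (C₁ + C₂ + C₃), ENNReal.mul_ne_top ENNReal.ofReal_ne_top
          (by simp [h₁, h₂, h₃]), ?_⟩
      filter_upwards [hC₁, hC₂, hC₃] with n hn₁ hn₂ hn₃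
      refine le_trans ?_ (mul_le_mul_right (add_le_add (add_le_add hn₁ hn₂) hn₃) _)
      have m₁ := measurable_hs_self hE ((hs' n).of_le hE (n := 0) (by simp))
      have m₃ := measurable_hs_self hE (hd n hW)
      rw [sqL2, sqL2, sqL2, ← lintegral_add_left m₁, ← lintegral_add_right _ m₃,
        ← lintegral_const_mul' _ _ ENNReal.ofReal_ne_top]
      refine (setLIntegral_mono' hUo.measurableSet fun x hx ↦ ?_).trans (setLIntegral_le_lintegral U _)
      rw [← ENNReal.ofReal_add (hs_self_nonneg _) (hs_self_nonneg _),
        ← ENNReal.ofReal_add (add_nonneg (hs_self_nonneg _) (hs_self_nonneg _)) (hs_self_nonneg _),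
        ← ENNReal.ofReal_mul hC]
      exact ENNReal.ofReal_le_ofReal (hU x hx (ξ n) (hξ n))
  obtain ⟨C, hC, hle⟩ := key
  refine ⟨Real.sqrt C.toReal, hle.mono fun n hn ↦ Real.sqrt_le_sqrt ?_⟩
  have hd := (isForm1_dstar g P hE (hξ n)).of_le hE (n := 0) (by simp)
  rw [pair1_self_eq, Complex.ofReal_re, integral_eq_lintegral_of_nonneg_ae
    (Eventually.of_forall fun x ↦ ptw1_self_nonneg g _ x) (integrable_ptw1 g hE hd hd).re.1]
  rw [setLIntegral_univ] at hn
  exact ENNReal.toReal_mono hC hn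

/-- The continuous sections of `End E`. -/
def contForm0 (hE : IsSmoothHermitian E F) : Submodule ℂ (Form0 E) where
  carrier := {u | IsForm0 F 0 u}
  add_mem' hu hv := isForm0_iff.mpr fun x ↦ (isForm0_iff.mp hu x).add (isForm0_iff.mp hv x)
  zero_mem' := isForm0_iff.mpr fun _ ↦ EndCnAt.zero
  smul_mem' r _ hu := isForm0_iff.mpr fun x ↦ (isForm0_iff.mp hu x).const_smul r

theorem pair0_conj_symm (u v : Form0 E) : starRingEnd ℂ (pair0 g u v) = pair0 g v u := by
  rw [pair0, ← integral_conj]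
  exact integral_congr_ae (Eventually.of_forall fun x ↦ hs_conj_symm _ _)

/-- The `L²` inner product on continuous sections of `End E`. -/
@[reducible] def l2Core0 (hE : IsSmoothHermitian E F) :
    PreInnerProductSpace.Core ℂ (contForm0 (F := F) hE) where
  inner u v := pair0 g v.1 u.1
  conj_inner_symm u v := pair0_conj_symm g u.1 v.1
  re_inner_nonneg u := by
    change 0 ≤ (pair0 g u.1 u.1).re
    rw [pair0, ← Complex.reCLM_apply, ← Complex.reCLM.integral_comp_comm
      (integrable_hs g hE u.2 u.2)]
    exact integral_nonneg fun x ↦ hs_self_nonneg _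
  add_left u v w := by
    change pair0 g w.1 (u.1 + v.1) = pair0 g w.1 u.1 + pair0 g w.1 v.1
    rw [pair0, pair0, pair0, ← integral_add (integrable_hs g hE w.2 u.2) (integrable_hs g hE w.2 v.2)]
    exact integral_congr_ae (Eventually.of_forall fun x ↦ hs_add_right _ _ _)
  smul_left u v r := by
    change pair0 g v.1 (r • u.1) = starRingEnd ℂ r * pair0 g v.1 u.1
    rw [pair0, pair0, ← integral_const_mul]
    exact integral_congr_ae (Eventually.of_forall fun x ↦ hs_smul_right _ _ _)

theorem norm_pair0_le (hE : IsSmoothHermitian E F) {u v : Form0 E} (hu : IsForm0 F 0 u)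
    (hv : IsForm0 F 0 v) :
    ‖pair0 g u v‖ ≤ Real.sqrt (pair0 g u u).re * Real.sqrt (pair0 g v v).re := by
  let := l2Core0 (F := F) g hE
  have h := @InnerProductSpace.Core.norm_inner_le_norm ℂ (contForm0 (F := F) hE) _ _ _ this
    ⟨v, hv⟩ ⟨u, hu⟩
  rw [mul_comm]
  exact h

/-- `L²` convergence of 2-forms, tested on smooth frames. -/
theorem tendsto_sqL2_contract (hE : IsSmoothHermitian E F) {ξ : ℕ → Form2 E} {σ : Form2 E}
    (hξ : ∀ n, IsForm2 F 0 (ξ n)) (hσ : IsForm2 F 0 σ)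
    (h : ∀ V W : (∀ x : X, Tan x), IsSmoothField V → IsSmoothField W →
      Tendsto (fun n ↦ sqL2 g (fun x ↦ ξ n x (V x) (W x) - σ x (V x) (W x))) atTop (𝓝 0)) :
    Tendsto (fun n ↦ sqL2 g (contract g (ξ n) - contract g σ)) atTop (𝓝 0) := by
  let d (n : ℕ) (x : X) : Module.End ℂ (E x) := contract g (ξ n) x - contract g σ x
  let q (n : ℕ) (x : X) : ℝ≥0∞ := ENNReal.ofReal (hs (d n x) (d n x)).re
  have key : Tendsto (fun n ↦ ∫⁻ x in Set.univ, q n x ∂g.area) atTop (𝓝 0) := by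
    refine isCompact_univ.induction_on
      (p := fun S ↦ Tendsto (fun n ↦ ∫⁻ x in S, q n x ∂g.area) atTop (𝓝 0)) (by simp) ?_ ?_ ?_
    · exact fun S T hST hT ↦ tendsto_of_tendsto_of_tendsto_of_le_of_le tendsto_const_nhds hT
        (fun _ ↦ zero_le) fun n ↦ lintegral_mono_set hST
    · intro S T hS hT
      refine tendsto_of_tendsto_of_tendsto_of_le_of_le tendsto_const_nhds
        (by simpa using hS.add hT) (fun _ ↦ zero_le) fun n ↦ lintegral_union_le _ _ _
    · intro x₀ _
      obtain ⟨V, W, hV, hW, U, hUo, hxU, hUs, hU⟩ := exists_conformal_frame x₀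
      have hx₀ := mem_chart_source ℂ x₀
      have hc : ContinuousAt (fun y ↦ (chartLam g x₀ y)⁻¹ ^ 2) x₀ :=
        ((contMDiffAt_chartLam g hx₀ (n := 0) (by simp)).continuousAt.inv₀
          (chartLam_pos g hx₀).ne').pow 2
      -- In the frame `(V, W)` contraction is multiplication by `λ⁻¹`, so squared norms acquire the
      -- factor `λ⁻²`, bounded near `x₀` by this constant.
      set C := (chartLam g x₀ x₀)⁻¹ ^ 2 + 1
      have hC : 0 ≤ C := by positivity
      obtain ⟨U', hU', hUo', hxU'⟩ := eventually_nhds_iff.mp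
        (hc.eventually_le_const (lt_add_one _))
      refine ⟨U ∩ U', mem_nhdsWithin_of_mem_nhds ((hUo.inter hUo').mem_nhds ⟨hxU, hxU'⟩), ?_⟩
      have hlim := ENNReal.Tendsto.const_mul (a := ENNReal.ofReal C) (h V W hV hW)
        (Or.inr ENNReal.ofReal_ne_top)
      rw [mul_zero] at hlim
      refine tendsto_of_tendsto_of_tendsto_of_le_of_le tendsto_const_nhds hlim
        (fun _ ↦ zero_le) fun n ↦ ?_
      change _ ≤ ENNReal.ofReal C * _
      rw [sqL2, ← lintegral_const_mul' _ _ ENNReal.ofReal_ne_top]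
      refine (setLIntegral_mono' (hUo.inter hUo').measurableSet fun x hx ↦ ?_).trans
        (setLIntegral_le_lintegral _ _)
      have e : d n x = (((chartLam g x₀ x)⁻¹ : ℝ) : ℂ) • (ξ n x (V x) (W x) - σ x (V x) (W x)) := by
        simp only [d]
        rw [contract_frame g (hξ n) (hUs hx.1) (hU x hx.1).1 (hU x hx.1).2.1,
          contract_frame g hσ (hUs hx.1) (hU x hx.1).1 (hU x hx.1).2.1, smul_sub]
      simp only [q]
      rw [← ENNReal.ofReal_mul hC, e, hs_smul_self_re, Complex.norm_real, Real.norm_eq_abs, sq_abs]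
      exact ENNReal.ofReal_le_ofReal
        (mul_le_mul_of_nonneg_right (hU' x hx.2) (hs_self_nonneg _))
  simp only [setLIntegral_univ] at key
  exact key

/-- Cauchy–Schwarz for the contractions. Of `τ` only a continuous contraction is required, which is
what is available for `τ = D''φ`. -/
theorem tendsto_pair2 (hE : IsSmoothHermitian E F) {ξ : ℕ → Form2 E} {σ τ : Form2 E}
    (hξ : ∀ n, IsForm2 F 0 (ξ n)) (hσ : IsForm2 F 0 σ) (hτ : IsForm0 F 0 (contract g τ))
    (h : ∀ V W : (∀ x : X, Tan x), IsSmoothField V → IsSmoothField W →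
      Tendsto (fun n ↦ sqL2 g (fun x ↦ ξ n x (V x) (W x) - σ x (V x) (W x))) atTop (𝓝 0)) :
    Tendsto (fun n ↦ pair2 g (ξ n) τ) atTop (𝓝 (pair2 g σ τ)) := by
  have hc (n : ℕ) := (hξ n).contract g (by simp)
  have hcσ := hσ.contract g (by simp)
  rw [tendsto_iff_norm_sub_tendsto_zero]
  have e (n : ℕ) : pair2 g (ξ n) τ - pair2 g σ τ =
      pair0 g (contract g (ξ n) - contract g σ) (contract g τ) := by
    rw [pair2_eq, pair2_eq, ← integral_sub (integrable_hs g hE (hc n) hτ)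
      (integrable_hs g hE hcσ hτ)]
    exact integral_congr_ae (Eventually.of_forall fun x ↦ (hs_sub_left _ _ _).symm)
  have h0 : Tendsto (fun n ↦ (pair0 g (contract g (ξ n) - contract g σ)
      (contract g (ξ n) - contract g σ)).re) atTop (𝓝 0) := by
    have h1 := (ENNReal.tendsto_toReal ENNReal.zero_ne_top).comp
      (tendsto_sqL2_contract g hE hξ hσ h)
    refine h1.congr fun n ↦ ?_
    rw [Function.comp_apply, sqL2_eq g hE ((hc n).sub hcσ), ENNReal.toReal_ofReal]
    exact (l2Core0 (F := F) g hE).re_inner_nonneg ⟨_, (hc n).sub hcσ⟩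
  have h2 := (h0.sqrt.mul_const (Real.sqrt (pair0 g (contract g τ) (contract g τ)).re))
  rw [Real.sqrt_zero, zero_mul] at h2
  refine squeeze_zero (fun n ↦ norm_nonneg _) (fun n ↦ ?_) h2
  rw [e]
  exact norm_pair0_le g hE ((hc n).sub hcσ) hτ

/-- `D''` of a smooth 1-form is continuous. -/
theorem isForm0_contract_D1 (hE : IsSmoothHermitian E F) {c : Form1 E} (hc : IsForm1 F ∞ c) :
    IsForm0 F 0 (contract g (D1 P c)) := by
  -- Continuity is tested against smooth sections, for which the Leibniz rule expresses the pairing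
  -- by continuous functions.
  refine isForm0_of_continuous_hs hE fun f hf ↦ ?_
  have h1 := continuous_hs_extCov g P.A hE hf (hc.part10 le_rfl)
  have h2 := continuous_ptw1 g hE ((isForm1_higgsAdj P hE le_rfl hf).of_le hE (by simp))
    (hc.of_le hE (n := 0) (by simp))
  refine (h1.add h2).congr fun x ↦ ?_
  rw [Pi.add_apply, ← ptw1_higgsAdj, ← mul_add, ← hs_add_right, contract, hs_smul_right, ← Complex.ofReal_inv,
    Complex.conj_ofReal]
  rfl

end SobolevLimits

/-! ### The moment map on the slice and the Kuranishi space. -/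

section Main

variable {X : Type*} [TopologicalSpace X] [ChartedSpace ℂ X] [IsManifold 𝓘(ℂ) ω X]
  [IsManifold 𝓘(ℝ, ℂ) ∞ X]
  {F : Type*} [NormedAddCommGroup F] [NormedSpace ℂ F] [FiniteDimensional ℂ F]
  {E : X → Type*} [TopologicalSpace (TotalSpace F E)]
  [∀ x, NormedAddCommGroup (E x)] [∀ x, InnerProductSpace ℂ (E x)]
  [∀ x, FiniteDimensional ℂ (E x)]
  [FiberBundle F E] [VectorBundle ℝ F E] [VectorBundle ℂ F E]
  [ContMDiffVectorBundle ∞ F E 𝓘(ℝ, ℂ)] (g : KahlerMetric X) (P : HitchinPair F E)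
  [MeasurableSpace X] [BorelSpace X] [CompactSpace X] [T2Space X]

/-- A continuous form orthogonal to the range of `(D'')^*` on smooth forms is orthogonal to
`(D'')^* ξ` for `ξ` in a Sobolev space. -/
theorem pair1_weak_dstar (hE : IsSmoothHermitian E F) {k : ℕ} {b m : Form1 E} {ξ : Form2 E}
    (hξ : ξ ∈ Sob2 P.A g (k + 1)) (hb : IsForm1 F 0 b) (hm : IsForm1 F 0 m)
    (hbξ : ∀ c, IsForm1 F ∞ c → pair1 g b c = pair2 g ξ (D1 P c))
    (hmo : ∀ τ, IsForm2 F ∞ τ → pair1 g (dstar g P τ) m = 0) : pair1 g b m = 0 := by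
  obtain ⟨hξ0, s, hs', hsV⟩ := hξ
  obtain ⟨C, hC⟩ := exists_norm1_dstar_le g P hE (Nat.le_add_left 1 k) hs'
    fun V W hV hW ↦ (hsV V W hV hW).1
  have hd (n : ℕ) := (isForm1_dstar g P hE (hs' n)).of_le hE (n := 0) (by simp)
  -- With `s_n → ξ` smooth and `φ` a smooth `ε`-approximation of `m`, one has `⟨b, φ⟩ = ⟨ξ, D''φ⟩ =
  -- lim ⟨s_n, D''φ⟩`. The approximation `φ` is needed because `m` is merely continuous and `b` is
  -- characterized by smooth test forms.
  have key (ε : ℝ) (hε : 0 < ε) : ‖pair1 g b m‖ ≤ (norm1 g b + C) * ε := by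
    obtain ⟨φ, hφ, hlt⟩ := exists_smooth_norm1_lt g hE hm hε
    have hφ0 := hφ.of_le hE (n := 0) (by simp)
    have hmφ := hm.sub hφ0
    have h1 : ‖pair1 g b (m - φ)‖ ≤ norm1 g b * ε := (norm_pair1_le g hE hb hmφ).trans
      (mul_le_mul_of_nonneg_left hlt.le (norm1_nonneg g b))
    have hlim : Tendsto (fun n ↦ ‖pair2 g (s n) (D1 P φ)‖) atTop (𝓝 ‖pair1 g b φ‖) := by
      rw [hbξ φ hφ]
      exact (tendsto_pair2 g hE (fun n ↦ (hs' n).of_le hE (by simp)) hξ0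
        (isForm0_contract_D1 g P hE hφ) fun V W hV hW ↦ (hsV V W hV hW).2).norm
    have h2 : ‖pair1 g b φ‖ ≤ C * ε := by
      refine le_of_tendsto hlim (hC.mono fun n hn ↦ ?_)
      -- Orthogonality of `m` to `(D'')^* s_n` replaces `φ` by the small difference `m - φ`, and
      -- `‖(D'')^* s_n‖` stays bounded.
      have e : pair2 g (s n) (D1 P φ) = -pair1 g (dstar g P (s n)) (m - φ) := by
        rw [pair2_D1 g P hE (hs' n) hφ, pair1_sub_right g hE hm hφ0 (hd n), hmo _ (hs' n), zero_sub,
          neg_neg]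
      rw [e, norm_neg]
      exact (norm_pair1_le g hE (hd n) hmφ).trans
        (mul_le_mul hn hlt.le (norm1_nonneg g _) ((norm1_nonneg g _).trans hn))
    have e : pair1 g b m = pair1 g b (m - φ) + pair1 g b φ := by
      rw [pair1_sub_right g hE hm hφ0 hb, sub_add_cancel]
    rw [e, add_mul]
    exact (norm_add_le _ _).trans (add_le_add h1 h2)
  have hlim : Tendsto (fun ε : ℝ ↦ (norm1 g b + C) * ε) (𝓝[>] 0) (𝓝 0) := by
    have : Tendsto (fun ε : ℝ ↦ (norm1 g b + C) * ε) (𝓝 0) (𝓝 ((norm1 g b + C) * 0)) :=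
      tendsto_id.const_mul _
    rw [mul_zero] at this
    exact this.mono_left nhdsWithin_le_nhds
  have h0 : ‖pair1 g b m‖ ≤ 0 := ge_of_tendsto hlim (by
    filter_upwards [self_mem_nhdsWithin] with ε hε using key ε hε)
  exact norm_le_zero_iff.mp h0

theorem pair1_zero_left (b : Form1 E) : pair1 g 0 b = 0 := by
  have h := pair1_smul_left g 0 0 b
  rwa [zero_smul, zero_mul] at h

theorem pair2_zero_left (τ : Form2 E) : pair2 g 0 τ = 0 := by
  have h := pair2_smul_left g 0 0 τ
  rwa [zero_smul, zero_mul] at h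

theorem adj_cases (T : Form1 E → Form2 E) (σ : Form2 E) : adj F g T σ = 0 ∨
    (IsForm1 F 0 (adj F g T σ) ∧
      ∀ a, IsForm1 F ∞ a → pair1 g (adj F g T σ) a = pair2 g σ (T a)) := by
  by_cases h : ∃ b : Form1 E, IsForm1 F 0 b ∧
      ∀ a, IsForm1 F ∞ a → pair1 g b a = pair2 g σ (T a)
  · rw [adj, dif_pos h]
    exact Or.inr h.choose_spec
  · rw [adj, dif_neg h]
    exact Or.inl rfl

theorem isForm1_adj (T : Form1 E → Form2 E) (σ : Form2 E) : IsForm1 F 0 (adj F g T σ) := by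
  rcases adj_cases (F := F) g T σ with h | h
  · rw [h]; exact IsForm1.zero
  · exact h.1

/-- Either the default value `0` is taken, or the weak adjoint is orthogonal to all smooth forms. -/
theorem adj_eq_zero (hE : IsSmoothHermitian E F) {T : Form1 E → Form2 E} {σ : Form2 E}
    (h : ∀ a, IsForm1 F ∞ a → pair2 g σ (T a) = 0) : adj F g T σ = 0 := by
  rcases adj_cases (F := F) g T σ with h0 | h0
  · exact h0
  · exact eq_zero_of_pair1_smooth g hE h0.1 fun c hc ↦ (h0.2 c hc).trans (h c hc)

theorem green_cases (k : ℕ) (σ : Form2 E) :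
    green P g k σ = 0 ∨ green P g k σ ∈ Sob2 P.A g (k + 1) := by
  unfold green
  split_ifs with h
  · exact Or.inr h.choose_spec.1
  · exact Or.inl rfl

/-- `(D'')^* G σ` is zero or is the weak adjoint applied to an element of a Sobolev space. -/
theorem adj_green_cases (hE : IsSmoothHermitian E F) (k : ℕ) (σ : Form2 E) :
    adj F g (D1 P) (green P g k σ) = 0 ∨ (green P g k σ ∈ Sob2 P.A g (k + 1) ∧
      ∀ a, IsForm1 F ∞ a →
        pair1 g (adj F g (D1 P) (green P g k σ)) a = pair2 g (green P g k σ) (D1 P a)) := by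
  rcases green_cases g P k σ with h | h
  · left
    rw [h]
    exact adj_eq_zero g hE fun a _ ↦ pair2_zero_left g _
  · rcases adj_cases (F := F) g (D1 P) (green P g k σ) with h0 | h0
    · exact Or.inl h0
    · exact Or.inr ⟨h, h0.2⟩

/-- The smooth case is `pair2_bracket_dstar`; the limit argument extends it to the Green form. If a
default value intervenes, the correction is zero and there is nothing to prove. -/
theorem pair2_bracket_adj_green (hE : IsSmoothHermitian E F) (k : ℕ) (σ : Form2 E) {c : Form1 E}
    (hc : IsForm1 F 0 c) (hcc : Coclosed1 P g c) {h : Form2 E} (hh : h ∈ H2 P g) :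
    pair2 g (bracket c (adj F g (D1 P) (green P g k σ))) h = 0 := by
  rw [pair2_bracket_eq g hc.1]
  rcases adj_green_cases g P hE k σ with h0 | ⟨h1, h2⟩
  · rw [h0, pair1_zero_left]
  · refine pair1_weak_dstar g P hE h1 (isForm1_adj g _ _)
      (isForm1_cupForm g hE (by simp) (hh.1.of_le hE (by simp)) hc) h2 fun τ hτ ↦ ?_
    rw [← pair2_bracket_eq g hc.1]
    exact pair2_bracket_dstar g P hE hh hτ hcc

/-- The adjoint form of `D'' D'' = 0`: testing against `D''u` yields a pairing with `D''D''u`. -/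
theorem coclosed1_adj_green (hE : IsSmoothHermitian E F) (k : ℕ) (σ : Form2 E) :
    Coclosed1 P g (adj F g (D1 P) (green P g k σ)) := by
  intro u hu
  rcases adj_green_cases g P hE k σ with h0 | ⟨h1, h2⟩
  · rw [h0, pair1_zero_left]
  · rw [h2 _ (isForm1_D0 P hE hu)]
    refine (integral_congr_ae (Eventually.of_forall fun x ↦ ?_)).trans (integral_zero' _ _)
    simp only [D1_D0 P hE hu, hs_zero_right, mul_zero, Pi.zero_apply]

theorem bracket_add_left (a b c : Form1 E) : bracket (a + b) c = bracket a c + bracket b c := by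
  funext x v w
  simp only [bracket, Pi.add_apply, end_add_lie]
  abel

/-- The Kuranishi map does not change the harmonic part of the quadratic term. -/
theorem pair2_bracket_kurF (hE : IsSmoothHermitian E F) (k : ℕ) {a : Form1 E} (ha : IsForm1 F 0 a)
    (hac : Coclosed1 P g a) {h : Form2 E} (hh : h ∈ H2 P g) :
    pair2 g (bracket (kurF P g k a) (kurF P g k a)) h = pair2 g (bracket a a) h := by
  rw [kurF]
  set σ := bracket (part01 a) (part10 a)
  -- With `b = (D'')^* Gσ`, both the cross term `[a, b]` and the square `[b, b]` are orthogonal to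
  -- `h`, because `a` and `b` are coclosed.
  have hab := pair2_bracket_adj_green g P hE k σ ha hac hh
  have hbb := pair2_bracket_adj_green g P hE k σ (isForm1_adj (F := F) g (D1 P) (green P g k σ))
    (coclosed1_adj_green g P hE k σ) hh
  have hb : IsForm1 F 0 (adj F g (D1 P) (green P g k σ)) := isForm1_adj g _ _
  set b := adj F g (D1 P) (green P g k σ)
  have hh0 := hh.1.of_le hE (n := 0) (by simp)
  have hba : pair2 g (bracket b a) h = 0 := by rw [bracket_symm, hab]
  have f1 (p q : Form1 E) (hp : IsForm1 F 0 p) (hq : IsForm1 F 0 q) : IsForm2 F 0 (bracket p q) :=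
    hp.bracket hq
  rw [bracket_add_left, bracket_symm a, bracket_symm b, bracket_add_left, bracket_add_left,
    pair2_add_left g hE ((f1 a a ha ha).add (f1 b a hb ha)) ((f1 a b ha hb).add (f1 b b hb hb)) hh0,
    pair2_add_left g hE (f1 a a ha ha) (f1 b a hb ha) hh0,
    pair2_add_left g hE (f1 a b ha hb) (f1 b b hb hb) hh0, hab, hba, hbb]
  simp

/-- On harmonic forms, the moment map is half the quadratic term. -/
theorem muC_harmonic (hE : IsSmoothHermitian E F) {a : Form1 E} (ha : IsForm1 F 0 a) {h : Form2 E}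
    (hh : h ∈ H2 P g) : muC P g a h = (1 / 2 : ℂ) * pair2 g (bracket a a) h := by
  -- The term with `∂̄_A(Φ + η)` vanishes because `∂̄_A^* h = 0`.
  have h0 : adj F g (dbar1 P.A) h = 0 := by
    refine adj_eq_zero g hE fun c hc ↦ ?_
    rw [pair2_dbar1 g P.A hE hh.1 hc]
    have : part10 (covJ P.A (contract g h)) = 0 := by
      funext x v
      exact (harmonic_parts g P hE hh x v).1
    rw [this, pair1_zero_left]
  have h1 : pair1 g (P.Φ + part10 a) (0 : Form1 E) = 0 := by
    rw [← pair1_conj_symm, pair1_zero_left, map_zero]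
  rw [muC, h0, h1, zero_add, ← pair2_smul_left, pair2_eq_contract_right, pair2_eq_contract_right]
  refine integral_congr_ae (Eventually.of_forall fun x ↦ ?_)
  have e : bracket (part01 a) (P.Φ + part10 a) = bracket P.Φ (part01 a) +
      bracket (part01 a) (part10 a) := by
    rw [bracket_symm _ (P.Φ + part10 a), bracket_add_left, bracket_symm (part10 a)]
  -- The linear term `[α'', Φ]` is pointwise orthogonal to `h` because `[Φ^*, Λh] = 0`.
  have hz : hs (bracket P.Φ (part01 a) x (tanOf x 1) (tanOf x Complex.I)) (contract g h x) = 0 := by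
    simp only [bracket, hs_sub_left, hs_lie_right, harmonic_adjoint_higgs g P hE hh, hs_zero_right,
      sub_zero]
  simp only [e, Pi.add_apply, Pi.smul_apply, hs_add_left, hz, zero_add,
    bracket_self_one_I (ha.1 x), smul_smul]
  norm_num

theorem zero_mem_H2 : (0 : Form2 E) ∈ H2 P g :=
  ⟨IsForm2.zero, fun a _ ↦ pair2_zero_left g _⟩

theorem smul_mem_H2 (r : ℂ) {s : Form2 E} (hs : s ∈ H2 P g) : r • s ∈ H2 P g :=
  ⟨hs.1.const_smul r, fun a ha ↦ by rw [pair2_smul_left, hs.2 a ha, mul_zero]⟩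

theorem pair2_conj_symm (σ τ : Form2 E) : starRingEnd ℂ (pair2 g σ τ) = pair2 g τ σ := by
  rw [pair2_eq, pair2_eq]
  exact pair0_conj_symm g _ _

/-- Uniqueness of the harmonic representative: the difference of two is itself harmonic and
orthogonal to both. -/
theorem harmDist_eq (hE : IsSmoothHermitian E F) {T : Form2 E → ℂ} {s : Form2 E} (hs : s ∈ H2 P g)
    (h : ∀ s' ∈ H2 P g, pair2 g s s' = T s') : harmDist P g T = s := by
  have hex : ∃ s : Form2 E, s ∈ H2 P g ∧ ∀ s' ∈ H2 P g, pair2 g s s' = T s' := ⟨s, hs, h⟩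
  rw [harmDist, dif_pos hex]
  obtain ⟨h1, h2⟩ := hex.choose_spec
  set t := hex.choose
  have ht0 := h1.1.of_le hE (n := 0) (by simp)
  have hs0 := hs.1.of_le hE (n := 0) (by simp)
  have hd0 := ht0.sub hs0
  have hz (s' : Form2 E) (hs' : s' ∈ H2 P g) : pair2 g (t - s) s' = 0 := by
    rw [pair2_sub_left g hE ht0 hs0 (hs'.1.of_le hE (by simp)), h2 s' hs', h s' hs', sub_self]
  refine sub_eq_zero.mp (eq_zero_of_pair2_self g hE hd0 ?_)
  rw [pair2_sub_left g hE ht0 hs0 hd0, ← pair2_conj_symm g (t - s) t, ← pair2_conj_symm g (t - s) s,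
    hz t h1, hz s hs]
  simp

theorem harmDist_mem (T : Form2 E → ℂ) : harmDist P g T ∈ H2 P g := by
  unfold harmDist
  split_ifs with h
  · exact h.choose_spec.1
  · exact zero_mem_H2 g P

/-- Only the values on `H²` matter. Since `r ≠ 0`, a representative exists for `T` exactly when one
exists for `T'`, so the default values also agree; existence of the projection is never needed. -/
theorem harmDist_smul (hE : IsSmoothHermitian E F) {T T' : Form2 E → ℂ} {r : ℂ} (hr : r ≠ 0)
    (h : ∀ s ∈ H2 P g, T s = r * T' s) : harmDist P g T = r • harmDist P g T' := by
  by_cases hex : ∃ s : Form2 E, s ∈ H2 P g ∧ ∀ s' ∈ H2 P g, pair2 g s s' = T' s'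
  · obtain ⟨s, hs, hs'⟩ := hex
    rw [harmDist_eq g P hE hs hs']
    exact harmDist_eq g P hE (smul_mem_H2 g P r hs) fun s' hs'' ↦ by
      rw [pair2_smul_left, hs' s' hs'', h s' hs'']
  · have hex' : ¬∃ s : Form2 E, s ∈ H2 P g ∧ ∀ s' ∈ H2 P g, pair2 g s s' = T s' := by
      rintro ⟨s, hs, hs'⟩
      refine hex ⟨r⁻¹ • s, smul_mem_H2 g P _ hs, fun s' hs'' ↦ ?_⟩
      rw [pair2_smul_left, hs' s' hs'', h s' hs'', inv_mul_cancel_left₀ hr]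
    rw [harmDist, harmDist, dif_neg hex, dif_neg hex', smul_zero]

theorem harmDist_muC (hE : IsSmoothHermitian E F) (k : ℕ) {a : Form1 E} (ha : IsForm1 F 0 a)
    (hac : Coclosed1 P g a) : harmDist P g (muC P g a) =
      (1 / 2 : ℂ) • harm P g (bracket (kurF P g k a) (kurF P g k a)) :=
  harmDist_smul g P hE (by norm_num) fun s hs ↦ by
    rw [muC_harmonic g P hE ha hs, pair2_bracket_kurF g P hE k ha hac hs]

theorem eqDist_muC (hE : IsSmoothHermitian E F) {k : ℕ} {a : Form1 E} (ha : a ∈ slice P g k) :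
    EqDist F g (muC P g a)
      ((1 / 2 : ℂ) • harm P g (bracket (kurF P g k a) (kurF P g k a))) := by
  rw [← harmDist_muC g P hE k ha.1.1 ha.2.2]
  exact ha.2.1

/-- A harmonic form is smooth, so it may be tested against itself. -/
theorem eqDist_zero_iff (hE : IsSmoothHermitian E F) {T : Form2 E → ℂ} {s : Form2 E}
    (hs : s ∈ H2 P g) (h : EqDist F g T s) : EqDist F g T 0 ↔ s = 0 := by
  refine ⟨fun h0 ↦ ?_, fun h0 ↦ h0 ▸ h⟩
  refine eq_zero_of_pair2_self g hE (hs.1.of_le hE (by simp)) ?_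
  rw [← h s hs.1, h0 s hs.1, pair2_zero_left]
  rfl

theorem zero_mem_H1 (hE : IsSmoothHermitian E F) : (0 : Form1 E) ∈ H1 P g := by
  refine ⟨IsForm1.zero, ?_, fun u _ ↦ pair1_zero_left g _⟩
  have h10 : part10 (0 : Form1 E) = 0 := by
    funext x v
    simp [part10]
  have hz (x : X) (v : Tan x) : covEnd P.A (fun y ↦ (0 : Module.End ℂ (E y))) x v = 0 := by
    have h := covEnd_const_smul P.A hE 0 (EndCnAt.zero (F := F) (E := E) (n := ∞) (x := x)) v
    simpa using h
  funext x v w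
  rw [D1, Pi.add_apply, Pi.add_apply, Pi.add_apply, dbar1, h10, extCov]
  simp only [Pi.zero_apply, hz, bracket]
  simp [Ring.lie_def]

theorem kuranishiSpace_isOpenNhd (hE : IsSmoothHermitian E F) {k : ℕ} {ρ : ℝ} {N : Set (Form1 E)}
    {θ : Form1 E → Form1 E} (hθ : IsKuranishiMap P g k ρ N θ) :
    IsOpenNhdZeroIn g (quadraticCone P g) (kuranishiSpace P g ρ N θ) := by
  -- The formula for `μ_ℂ` at `θ(x)`, with `F(θ(x)) = x` substituted.
  have key {x : Form1 E} (hx : x ∈ ball1 P g ρ) : EqDist F g (muC P g (θ x)) 0 ↔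
      (1 / 2 : ℂ) • harm P g (bracket x x) = 0 := by
    have h := eqDist_muC g P hE (hθ.isOpen.1 (hθ.mapsTo_inv hx))
    rw [hθ.invOn.2 hx] at h
    exact eqDist_zero_iff g P hE (smul_mem_H2 g P _ (harmDist_mem g P _)) h
  have hmem {x : Form1 E} (hx : x ∈ ball1 P g ρ)
      (hq : (1 / 2 : ℂ) • harm P g (bracket x x) = 0) : x ∈ kuranishiSpace P g ρ N θ :=
    ⟨hx, hθ.mapsTo_inv hx, (key hx).mpr hq⟩
  refine ⟨fun x hx ↦ ⟨hx.1.1, (key hx.1).mp hx.2.2⟩, ?_, fun z hz ↦ ?_⟩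
  · have h0 : bracket (0 : Form1 E) 0 = 0 := by
      funext x v w
      simp [bracket, Ring.lie_def]
    refine hmem ⟨zero_mem_H1 g P hE, ?_⟩ ?_
    · rw [norm1, pair1_zero_left, Complex.zero_re, Real.sqrt_zero]
      exact hθ.pos
    · rw [h0, harm, harmDist_eq g P hE (zero_mem_H2 g P) fun s' _ ↦ rfl, smul_zero]
  · refine ⟨ρ - norm1 g z, sub_pos.mpr hz.1.2, fun q hq hlt ↦ hmem ⟨hq.1, ?_⟩ hq.2⟩
    have hz0 := hz.1.1.1.of_le hE (n := 0) (by simp)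
    have h := norm1_add_le g hE ((hq.1.1.of_le hE (n := 0) (by simp)).sub hz0) hz0
    rw [sub_add_cancel] at h
    linarith

end Main

end HiggsKuranishi

end

open HiggsKuranishi in
theorem mainTheorem7
    {X : Type*} [TopologicalSpace X] [T2Space X] [CompactSpace X] [ConnectedSpace X]
    [ChartedSpace ℂ X] [IsManifold 𝓘(ℂ) ω X] [IsManifold 𝓘(ℝ, ℂ) ∞ X]
    [MeasurableSpace X] [BorelSpace X] (g : KahlerMetric X)
    {F : Type*} [NormedAddCommGroup F] [NormedSpace ℂ F] [FiniteDimensional ℂ F]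
    {E : X → Type*} [TopologicalSpace (TotalSpace F E)]
    [∀ x, NormedAddCommGroup (E x)] [∀ x, InnerProductSpace ℂ (E x)]
    [∀ x, FiniteDimensional ℂ (E x)]
    [FiberBundle F E] [VectorBundle ℂ F E] [VectorBundle ℝ F E]
    [ContMDiffVectorBundle ∞ F E 𝓘(ℝ, ℂ)] (hE : IsSmoothHermitian E F)
    (P : HitchinPair F E) (k : ℕ) (hk : 1 < k) :
    (∀ a ∈ slice P g k,
      EqDist F g (muC P g a)
        ((1 / 2 : ℂ) • harm P g (bracket (kurF P g k a) (kurF P g k a)))) ∧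
    (∀ (ρ : ℝ) (N : Set (Form1 E)) (θ : Form1 E → Form1 E), IsKuranishiMap P g k ρ N θ →
      IsOpenNhdZeroIn g (quadraticCone P g) (kuranishiSpace P g ρ N θ)) :=
  ⟨fun _ ha ↦ eqDist_muC g P hE ha, fun _ _ _ hθ ↦ kuranishiSpace_isOpenNhd g P hE hθ⟩
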